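/- Let $f:\mathbb R\to\mathbb C$ be a (centred) complex Gaussian stationary process: for all $t_1,\dots,t_n\in\mathbb R$ the vector $(f(t_1),\dots,f(t_n))$ is equal in distribution to $A\mathbf v$ for some $m$ and some complex $n\times m$ matrix $A$, where the $m$ coordinates of $\mathbf v$ are i.i.d. with density $\frac1\pi e^{-|z|^2}$ on $\mathbb C$, and for every $s\in\mathbb R$ it has the same law as $(f(t_1+s),\dots,f(t_n+s))$. Let $r(t)=\mathbb E[f(t)\overline{f(0)}]$ be its covariance kernel, normalized so that $r(0)=1$, and let $\rho$ be its spectral measure, i.e. the probability measure on $\mathbb R$ with $r(t)=\int_{\mathbb R}e^{-it\lambda}\,d\rho(\lambda)$ for all $t\in\mathbb R$. Assume that $\rho$ is not a single point mass and that, for some $\alpha>0$, $$\int_{\mathbb R}\lambda^2\log^{1+\alpha}(1+|\lambda|)\,d\rho(\lambda)<\infty .$$ (This condition guarantees that $f$ has a version with almost surely continuously differentiable paths; $f$ denotes such a version.) For $T>0$ define the winding of $f$ on $[0,T]$ by $$\Delta(T)=\frac1{2i}\int_0^T\left[\frac{f'(t)}{f(t)}-\overline{\left(\frac{f'(t)}{f(t)}\right)}\right]dt=\int_0^T\operatorname{Im}\frac{f'(t)}{f(t)}\,dt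 .$$ Put $R(x)=r'(x)/r(x)$ where $r(x)\ne0$, and define $\widetilde K:\mathbb R\to\mathbb R$ by $$\widetilde K(x)=\begin{cases}\frac12|r'(x)|^2,&\text{if }|r(x)|=0\text{ or }1,\\[4pt] \dfrac{|r(x)|^2}{1-|r(x)|^2}\bigl(\operatorname{Im}\{R(x)-R(0)\}\bigr)^2+\dfrac14\left(\log\dfrac1{1-|r(x)|^2}\right)'\left(\log\{|r(x)|^2\}\right)',&\text{if }0<|r(x)|<1.\end{cases}$$ Then $\widetilde K$ is non-negative and integrable on every compact subset of $\mathbb R$, and for every $T>0$ the integral defining $\Delta(T)$ converges absolutely almost surely, $\Delta(T)$ is square-integrable, and $$\frac{\operatorname{Var}[\Delta(T)]}{T}=\int_{-T}^{T}\left(1-\frac{|x|}{T}\right)\widetilde K(x)\,dx+\frac1{2T}\int_{|r(T)|^2}^1\log\frac1{1-y}\,\frac{dy}{y},$$ the last integral being absolutely convergent. -/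

import Mathlib

open MeasureTheory ProbabilityTheory

noncomputable section

namespace WindingGSP

/-- The standard complex Gaussian law on `ℂ`, with density `π⁻¹ exp (-|z|²)` with respect to
Lebesgue measure on the plane. -/
def stdComplexGaussian : Measure ℂ :=
  (volume : Measure ℂ).withDensity fun z => ENNReal.ofReal (Real.pi⁻¹ * Real.exp (-‖z‖ ^ 2))

/-- A (centred) complex Gaussian vector: a random vector equal in distribution to `A v`, where the
coordinates of `v` are i.i.d. standard complex Gaussians and `A` is a complex matrix. -/
def IsComplexGaussianVector {Ω : Type*} [MeasurableSpace Ω] (μ : Measure Ω) {n : ℕ}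
    (X : Ω → Fin n → ℂ) : Prop :=
  ∃ (m : ℕ) (A : Matrix (Fin n) (Fin m) ℂ),
    IdentDistrib X (fun v : Fin m → ℂ => A.mulVec v) μ
      (Measure.pi fun _ : Fin m => stdComplexGaussian)

/-- A complex Gaussian stationary process: all finite marginals are complex Gaussian vectors, and
their laws are invariant under real shifts. -/
structure IsComplexGSP {Ω : Type*} [MeasurableSpace Ω] (μ : Measure Ω) (f : ℝ → Ω → ℂ) :
    Prop where
  gaussian : ∀ (n : ℕ) (t : Fin n → ℝ),
    IsComplexGaussianVector μ fun ω (i : Fin n) => f (t i) ω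
  stationary : ∀ (n : ℕ) (t : Fin n → ℝ) (s : ℝ),
    IdentDistrib (fun ω (i : Fin n) => f (t i) ω) (fun ω (i : Fin n) => f (t i + s) ω) μ μ

/-- The covariance kernel `r(t) = 𝔼[f(t) * conj (f(0))]`. -/
def covKernel {Ω : Type*} [MeasurableSpace Ω] (μ : Measure Ω) (f : ℝ → Ω → ℂ) (t : ℝ) : ℂ :=
  ∫ ω, f t ω * (starRingEnd ℂ) (f 0 ω) ∂μ

/-- `ρ` is the spectral measure of a process with covariance kernel `r`: `ρ` is a probability
measure on `ℝ` whose Fourier transform `t ↦ ∫ exp (-i t x) dρ(x)` is `r`. -/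
def IsSpectralMeasure (ρ : Measure ℝ) (r : ℝ → ℂ) : Prop :=
  IsProbabilityMeasure ρ ∧
    ∀ t : ℝ, r t = ∫ x : ℝ, Complex.exp (-(Complex.I * (t : ℂ) * (x : ℂ))) ∂ρ

/-- The logarithmic moment condition `∫ x² log^{1+α} (1+|x|) dρ(x) < ∞` for some `α > 0`. -/
def LogMomentCondition (ρ : Measure ℝ) : Prop :=
  ∃ α : ℝ, 0 < α ∧ Integrable (fun x : ℝ => x ^ 2 * Real.log (1 + |x|) ^ (1 + α)) ρ

/-- The winding (increment of the argument) of `f` over `[0, T]`. -/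
def winding {Ω : Type*} (f : ℝ → Ω → ℂ) (T : ℝ) (ω : Ω) : ℝ :=
  ∫ t in (0 : ℝ)..T, (deriv (fun s => f s ω) t / f t ω).im

/-- The winding, written as `(2i)⁻¹ ∫ (f'/f - conj (f'/f))`. -/
theorem winding_eq {Ω : Type*} (f : ℝ → Ω → ℂ) (T : ℝ) (ω : Ω) :
    (winding f T ω : ℂ) = 1 / (2 * Complex.I) * ∫ t in (0 : ℝ)..T,
      (deriv (fun s => f s ω) t / f t ω
        - (starRingEnd ℂ) (deriv (fun s => f s ω) t / f t ω)) := by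
  rw [winding, ← intervalIntegral.integral_ofReal, ← intervalIntegral.integral_const_mul]
  congr 1
  funext t
  rw [Complex.sub_conj]
  field_simp [Complex.I_ne_zero]
  push_cast
  ring

/-- The logarithmic derivative `R = r' / r`, relevant only at points where `r ≠ 0`. -/
def logDerivKernel (r : ℝ → ℂ) (x : ℝ) : ℂ := deriv r x / r x

open Classical in
/-- The kernel `K̃`. -/
def kernelTilde (r : ℝ → ℂ) (x : ℝ) : ℝ :=
  if ‖r x‖ = 0 ∨ ‖r x‖ = 1 then (1 / 2) * ‖deriv r x‖ ^ 2
  else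
    ‖r x‖ ^ 2 / (1 - ‖r x‖ ^ 2) * ((logDerivKernel r x - logDerivKernel r 0).im) ^ 2
      + (1 / 4) * deriv (fun u : ℝ => Real.log (1 / (1 - ‖r u‖ ^ 2))) x
          * deriv (fun u : ℝ => Real.log (‖r u‖ ^ 2)) x

end WindingGSP

end

/-! Let m be the mean of ρ. Multiplying `f` by e^{itm} centres the spectral measure, so that r'(0) =
0, and changes the winding only by the deterministic amount mT. So let F be the centred process, and
write the integral of F'/F over [0,T] as A + iB. Here B is the winding and A = log|F(T)| - log|F(0)|
is a boundary term. The expectation of (A + iB)², squared without conjugation, has real part E A² -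
E B². Both this expectation and E A² can be computed exactly, and their difference is the variance.

For the square, replace 1/z by z̄/(ε + |z|²) (`approxInv`), whose ∂̄-derivative is an approximation
of π times the Dirac mass (`approxDirac`). Gaussian integration by parts removes F'(s) and F'(t),
each at the cost of a covariance and a ∂̄. Since r'(0) = 0, only the cross terms survive, and
`integral_pathDeriv_mul_pathDeriv` gives -|r'(s-t)|² times the expectation of a product of two
approximate Dirac masses. That expectation tends to 1/(1-|r(s-t)|²), which is π² times the joint
density at the origin (`tendsto_integral_approxDirac_mul`). The inequality |r'|² ≤ M(1-|r|²) of
`norm_deriv_spectralKernel_sq_le`, M being the variance of the centred spectral measure, makes the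
limit dominated.

For E A², Frullani's formula turns the squared difference of logarithms into an integral of the
joint Laplace transform of |F(T)|² and |F(0)|², which is explicit (`lintegral_log_sq`). This is the
source of the integral of log(1/(1-y))/y.

The two factors are smoothed with independent parameters. Hence the whole Gram matrix of the
smoothed windings converges and they are Cauchy in L² (`memLp_two_of_tendsto_integral_mul`). The
limit is identified almost surely through the absolute integrability of F'/F
(`ae_intervalIntegrable`). Finally, K̃ is |r' - r'(0)r|²/(1-|r|²) off a countable set
(`kernelTilde_ae_eq`), and this is the kernel found for the rotated process. -/

section WindingTheory

open Filter Topology Set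
open scoped ENNReal NNReal ComplexConjugate Matrix

namespace WindingGSP

/-! ### Standard complex Gaussian vectors: exponential integrals, density, moments. -/

section StandardGaussian

lemma integral_stdComplexGaussian {E : Type*} [NormedAddCommGroup E] [NormedSpace ℝ E]
    (F : ℂ → E) :
    ∫ z, F z ∂stdComplexGaussian = ∫ z, (Real.pi⁻¹ * Real.exp (-‖z‖ ^ 2)) • F z := by
  rw [stdComplexGaussian, integral_withDensity_eq_integral_toReal_smul (by fun_prop)
    (ae_of_all _ fun _ => ENNReal.ofReal_lt_top)]
  refine integral_congr_ae (ae_of_all _ fun z => ?_)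
  simp only
  rw [ENNReal.toReal_ofReal (by positivity)]

/-- The quadratic factor only changes the Gaussian parameter from 1 to 1 + b. Keeping c complex
covers characteristic functions (c = i) and Laplace transforms (c real) at once, and negative b
gives exponential moments. -/
lemma integral_cexp_stdComplexGaussian {b : ℝ} (hb : -1 < b) (c w : ℂ) :
    ∫ z, Complex.exp (-(b : ℂ) * (‖z‖ : ℂ) ^ 2 + c * (inner ℝ w z : ℝ)) ∂stdComplexGaussian
      = (1 + (b : ℂ))⁻¹ * Complex.exp (c ^ 2 * (‖w‖ : ℂ) ^ 2 / (4 * (1 + b))) := by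
  rw [integral_stdComplexGaussian]
  have h1 : ∀ z : ℂ, (Real.pi⁻¹ * Real.exp (-‖z‖ ^ 2)) •
      Complex.exp (-(b : ℂ) * (‖z‖ : ℂ) ^ 2 + c * (inner ℝ w z : ℝ))
      = (Real.pi : ℂ)⁻¹ * Complex.exp (-(1 + b : ℂ) * (‖z‖ : ℂ) ^ 2 + c * (inner ℝ w z : ℝ)) := by
    intro z
    rw [Complex.real_smul]
    push_cast
    rw [mul_assoc, ← Complex.exp_add]
    congr 2
    ring
  simp_rw [h1]
  rw [integral_const_mul]
  have hb' : 0 < (1 + (b : ℂ)).re := by simp; linarith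
  rw [GaussianFourier.integral_cexp_neg_mul_sq_norm_add hb' c w]
  have hpi : (Real.pi : ℂ) ≠ 0 := by exact_mod_cast Real.pi_ne_zero
  have hb1 : (1 + (b : ℂ)) ≠ 0 := fun h => by rw [h] at hb'; simp at hb'
  simp [Complex.finrank_real_complex]
  field_simp

instance : IsProbabilityMeasure stdComplexGaussian := by
  have h := integral_cexp_stdComplexGaussian (b := 0) (by norm_num) 0 0
  simp at h
  constructor
  have h2 : stdComplexGaussian.real univ = 1 := by exact_mod_cast h
  rw [measureReal_def] at h2
  rwa [ENNReal.toReal_eq_one_iff] at h2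

/-- The law of a vector of independent standard complex Gaussians. -/
noncomputable abbrev stdGaussianVector (m : ℕ) : Measure (Fin m → ℂ) :=
  Measure.pi fun _ : Fin m => stdComplexGaussian

lemma integral_cexp_dotProduct {m : ℕ} (c : ℂ) (a : Fin m → ℂ) :
    ∫ v, Complex.exp (c * ((a ⬝ᵥ v).re : ℝ)) ∂stdGaussianVector m
      = Complex.exp (c ^ 2 * ((∑ k, ‖a k‖ ^ 2 : ℝ) : ℂ) / 4) := by
  have h1 : ∀ v : Fin m → ℂ, Complex.exp (c * ((a ⬝ᵥ v).re : ℝ))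
      = ∏ k, Complex.exp (c * (inner ℝ (conj (a k)) (v k) : ℝ)) := by
    intro v
    rw [← Complex.exp_sum, ← Finset.mul_sum]
    congr 2
    rw [dotProduct, Complex.re_sum]
    push_cast
    refine Finset.sum_congr rfl fun k _ => ?_
    rw [Complex.inner]
    simp
    ring_nf
  simp_rw [h1]
  rw [integral_fintype_prod_eq_prod (fun k z => Complex.exp (c * (inner ℝ (conj (a k)) z : ℝ)))]
  have h2 : ∀ k, ∫ z, Complex.exp (c * (inner ℝ (conj (a k)) z : ℝ)) ∂stdComplexGaussian
      = Complex.exp (c ^ 2 * (‖a k‖ : ℂ) ^ 2 / 4) := by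
    intro k
    have := integral_cexp_stdComplexGaussian (b := 0) (by norm_num) c (conj (a k))
    simpa using this
  simp_rw [h2]
  rw [← Complex.exp_sum]
  congr 1
  push_cast
  rw [Finset.mul_sum, Finset.sum_div]

/-- Integration by parts is available against Lebesgue measure, so the product measure is needed as
one density on the whole space. -/
lemma stdGaussianVector_eq_withDensity (m : ℕ) :
    stdGaussianVector m = (volume : Measure (Fin m → ℂ)).withDensity
      fun v => ENNReal.ofReal (∏ k, Real.pi⁻¹ * Real.exp (-‖v k‖ ^ 2)) := by
  refine Measure.pi_eq fun s hs => ?_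
  have hint : ∀ t : Set ℂ, Integrable (fun z : ℂ => Real.pi⁻¹ * Real.exp (-‖z‖ ^ 2))
      (volume.restrict t) := by
    intro t
    refine Integrable.restrict ?_
    refine Integrable.const_mul (Integrable.of_integral_ne_zero ?_) _
    have := GaussianFourier.integral_rexp_neg_mul_sq_norm (V := ℂ) (b := 1) one_pos
    simp only [neg_mul, one_mul] at this
    rw [this]
    positivity
  rw [withDensity_apply _ (MeasurableSet.univ_pi hs), volume_pi, Measure.restrict_pi_pi,
    ← ofReal_integral_eq_lintegral_ofReal]
  · rw [integral_fintype_prod_eq_prod (fun _ z => Real.pi⁻¹ * Real.exp (-‖z‖ ^ 2)),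
      ENNReal.ofReal_prod_of_nonneg]
    · refine Finset.prod_congr rfl fun k _ => ?_
      rw [ofReal_integral_eq_lintegral_ofReal (hint _) (ae_of_all _ fun z => by positivity),
        stdComplexGaussian, withDensity_apply _ (hs k)]
    · exact fun k _ => integral_nonneg fun z => by positivity
  · exact Integrable.fintype_prod fun k => hint _
  · exact ae_of_all _ fun v => by positivity

lemma integral_stdGaussianVector {m : ℕ} {E : Type*} [NormedAddCommGroup E] [NormedSpace ℝ E]
    (F : (Fin m → ℂ) → E) :
    ∫ v, F v ∂stdGaussianVector m
      = ∫ v, (∏ k, Real.pi⁻¹ * Real.exp (-‖v k‖ ^ 2)) • F v := by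
  rw [stdGaussianVector_eq_withDensity, integral_withDensity_eq_integral_toReal_smul (by fun_prop)
    (ae_of_all _ fun _ => ENNReal.ofReal_lt_top)]
  refine integral_congr_ae (ae_of_all _ fun z => ?_)
  simp only
  rw [ENNReal.toReal_ofReal (by positivity)]

lemma integrable_stdGaussianVector_iff {m : ℕ} {E : Type*} [NormedAddCommGroup E]
    [NormedSpace ℝ E] (F : (Fin m → ℂ) → E) :
    Integrable F (stdGaussianVector m)
      ↔ Integrable fun v => (∏ k, Real.pi⁻¹ * Real.exp (-‖v k‖ ^ 2)) • F v := by
  rw [stdGaussianVector_eq_withDensity, integrable_withDensity_iff_integrable_smul' (by fun_prop)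
    (ae_of_all _ fun _ => ENNReal.ofReal_lt_top)]
  refine integrable_congr (ae_of_all _ fun z => ?_)
  simp only
  rw [ENNReal.toReal_ofReal (by positivity)]

lemma integrable_norm_pow_stdComplexGaussian (n : ℕ) :
    Integrable (fun z : ℂ => ‖z‖ ^ n) stdComplexGaussian := by
  -- The formula with b = -1/2 gives this integral the value 2. A non-integrable function would have
  -- Bochner integral 0, so a nonzero value proves integrability; the same device recurs below.
  have hexp : Integrable (fun z : ℂ => Real.exp (1 / 2 * ‖z‖ ^ 2)) stdComplexGaussian := by
    have h := integral_cexp_stdComplexGaussian (b := -(1 / 2)) (by norm_num) 0 0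
    have h3 : ∀ z : ℂ, Complex.exp (-((-(1 / 2) : ℝ) : ℂ) * (‖z‖ : ℂ) ^ 2
        + 0 * (inner ℝ (0 : ℂ) z : ℝ)) = ((Real.exp (1 / 2 * ‖z‖ ^ 2) : ℝ) : ℂ) := by
      intro z
      push_cast
      congr 1
      ring
    simp_rw [h3] at h
    rw [integral_complex_ofReal] at h
    refine Integrable.of_integral_ne_zero fun h0 => ?_
    rw [h0] at h
    norm_num at h
  refine (hexp.const_mul (n.factorial * 4 ^ n + 1)).mono' (by fun_prop) (ae_of_all _ fun z => ?_)
  rw [Real.norm_of_nonneg (by positivity)]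
  have h1 := Real.one_le_exp (x := 1 / 2 * ‖z‖ ^ 2) (by positivity)
  by_cases hz : ‖z‖ ≤ 1
  · calc ‖z‖ ^ n ≤ 1 := pow_le_one₀ (norm_nonneg _) hz
      _ ≤ Real.exp (1 / 2 * ‖z‖ ^ 2) := h1
      _ ≤ _ := le_mul_of_one_le_left (by positivity) (by
        have : (0:ℝ) ≤ n.factorial * 4 ^ n := by positivity
        linarith)
  · push Not at hz
    have h2 := Real.pow_div_factorial_le_exp (x := 1 / 2 * ‖z‖ ^ 2) (by positivity) n
    have h4 : ‖z‖ ^ n ≤ (‖z‖ ^ 2) ^ n := pow_le_pow_left₀ (norm_nonneg _) (by nlinarith) n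
    rw [div_le_iff₀ (by positivity), mul_pow] at h2
    have h5 : (‖z‖ ^ 2) ^ n ≤ Real.exp (1 / 2 * ‖z‖ ^ 2) * n.factorial * 2 ^ n := by
      have : (‖z‖ ^ 2) ^ n = ((1 / 2) ^ n * (‖z‖ ^ 2) ^ n) * 2 ^ n := by
        rw [mul_right_comm, ← mul_pow]; norm_num
      rw [this]
      gcongr
    have h6 : (2:ℝ) ^ n ≤ 4 ^ n := pow_le_pow_left₀ (by norm_num) (by norm_num) n
    calc ‖z‖ ^ n ≤ Real.exp (1 / 2 * ‖z‖ ^ 2) * n.factorial * 2 ^ n := h4.trans h5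
      _ ≤ Real.exp (1 / 2 * ‖z‖ ^ 2) * n.factorial * 4 ^ n := by gcongr
      _ ≤ _ := by nlinarith [Real.exp_pos (1 / 2 * ‖z‖ ^ 2)]

lemma integrable_norm_pow_stdGaussianVector {m : ℕ} (n : ℕ) :
    Integrable (fun v : Fin m → ℂ => ‖v‖ ^ n) (stdGaussianVector m) := by
  have h1 : ∀ k : Fin m, Integrable (fun v : Fin m → ℂ => ‖v k‖ ^ n) (stdGaussianVector m) :=
    fun k => integrable_comp_eval (μ := fun _ : Fin m => stdComplexGaussian) (i := k)
      (f := fun z : ℂ => ‖z‖ ^ n) (integrable_norm_pow_stdComplexGaussian n)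
  refine ((integrable_const (1 : ℝ)).add (integrable_finsetSum Finset.univ fun k _ => h1 k)).mono'
    (by fun_prop) (ae_of_all _ fun v => ?_)
  rw [Real.norm_of_nonneg (by positivity)]
  simp only [Pi.add_apply]
  rcases Nat.eq_zero_or_pos m with rfl | hm
  · rcases Nat.eq_zero_or_pos n with rfl | hn
    · simp
    · rw [Subsingleton.elim v 0, norm_zero, zero_pow hn.ne']
      simp
  · have : Nonempty (Fin m) := ⟨⟨0, hm⟩⟩
    obtain ⟨k, hk⟩ := Finite.exists_max fun k => ‖v k‖
    have hk' : ‖v‖ ^ n ≤ ‖v k‖ ^ n :=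
      pow_le_pow_left₀ (norm_nonneg _) ((pi_norm_le_iff_of_nonneg (norm_nonneg _)).2 hk) n
    have := Finset.single_le_sum (f := fun k => ‖v k‖ ^ n) (fun i _ => by positivity)
      (Finset.mem_univ k)
    linarith

lemma integrable_of_norm_le_pow {m : ℕ} {E : Type*} [NormedAddCommGroup E]
    {F : (Fin m → ℂ) → E} {C : ℝ} {n : ℕ}
    (hF : AEStronglyMeasurable F (stdGaussianVector m)) (h : ∀ v, ‖F v‖ ≤ C * (1 + ‖v‖) ^ n) :
    Integrable F (stdGaussianVector m) := by
  have : Integrable (fun v : Fin m → ℂ => C * (1 + ‖v‖) ^ n) (stdGaussianVector m) := by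
    refine Integrable.const_mul ?_ _
    simp_rw [add_comm (1 : ℝ), add_pow, one_pow, mul_one]
    exact integrable_finsetSum _ fun i _ =>
      (integrable_norm_pow_stdGaussianVector i).mul_const _
  exact this.mono' hF (ae_of_all _ h)

end StandardGaussian

/-! ### Gaussian integration by parts. -/

section Stein

/-- The Wirtinger derivative `∂/∂z̄` of a function `ℂ → ℂ`. -/
noncomputable def dbar (g : ℂ → ℂ) (z : ℂ) : ℂ :=
  1 / 2 * (fderiv ℝ g z 1 + Complex.I * fderiv ℝ g z Complex.I)

/-- A real-linear map splits as ∂g · ξ + ∂̄g · ξ̄, and the combination L(ξ) + iL(iξ) cancels the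
complex-linear half. -/
lemma half_fderiv_add_I_mul (g : ℂ → ℂ) (z ξ : ℂ) :
    1 / 2 * (fderiv ℝ g z ξ + Complex.I * fderiv ℝ g z (Complex.I * ξ)) = dbar g z * conj ξ := by
  have h1 : ∀ L : ℂ →L[ℝ] ℂ, ∀ η : ℂ, L η = η.re * L 1 + η.im * L Complex.I := by
    intro L η
    conv_lhs => rw [← Complex.re_add_im η]
    rw [map_add, mul_comm (η.im : ℂ) Complex.I]
    have e1 : (η.re : ℂ) = η.re • (1 : ℂ) := by simp
    have e2 : Complex.I * (η.im : ℂ) = η.im • Complex.I := by simp [mul_comm]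
    rw [e2, map_smul]
    nth_rewrite 1 [e1]
    rw [map_smul]
    simp
  rw [h1 _ ξ, h1 _ (Complex.I * ξ), dbar]
  have e3 : conj ξ = ξ.re - ξ.im * Complex.I := by
    apply Complex.ext <;> simp
  rw [e3]
  simp only [Complex.mul_re, Complex.I_re, Complex.I_im, Complex.mul_im, zero_mul, one_mul,
    zero_sub, zero_add]
  push_cast
  linear_combination (1 / 2 : ℂ) * (ξ.im) * (fderiv ℝ g z Complex.I) * Complex.I_sq

lemma integrable_re_dotProduct_mul {m : ℕ} {F : (Fin m → ℂ) → ℂ} (hF : Continuous F)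
    {C : ℝ} {n : ℕ} (hF0 : ∀ v, ‖F v‖ ≤ C * (1 + ‖v‖) ^ n) (w : Fin m → ℂ) :
    Integrable (fun v => ((2 * (star v ⬝ᵥ w).re : ℝ) : ℂ) * F v) (stdGaussianVector m) := by
  have hc : ∀ k : Fin m, ∀ v : Fin m → ℂ, ‖v k‖ ≤ 1 + ‖v‖ := fun k v => by
    linarith [norm_le_pi_norm v k]
  refine integrable_of_norm_le_pow (C := 2 * (∑ k, ‖w k‖) * C) (n := n + 1) ?_ fun v => ?_
  · refine AEStronglyMeasurable.mul ?_ hF.aestronglyMeasurable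
    have : Continuous fun v : Fin m → ℂ => ((2 * (star v ⬝ᵥ w).re : ℝ) : ℂ) := by
      unfold dotProduct
      simp only [Pi.star_apply]
      fun_prop
    exact this.aestronglyMeasurable
  · rw [norm_mul, Complex.norm_real, Real.norm_eq_abs, abs_mul, abs_two]
    have h1 : |(star v ⬝ᵥ w).re| ≤ (∑ k, ‖w k‖) * (1 + ‖v‖) := by
      refine (Complex.abs_re_le_norm _).trans ((norm_sum_le _ _).trans ?_)
      rw [Finset.sum_mul]
      refine Finset.sum_le_sum fun k _ => ?_
      rw [norm_mul, mul_comm, Pi.star_apply, norm_star]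
      exact mul_le_mul_of_nonneg_left (hc k v) (norm_nonneg _)
    have h2 := hF0 v
    have h3 : 0 ≤ ∑ k, ‖w k‖ := Finset.sum_nonneg fun k _ => norm_nonneg _
    calc 2 * |(star v ⬝ᵥ w).re| * ‖F v‖
        ≤ 2 * ((∑ k, ‖w k‖) * (1 + ‖v‖)) * (C * (1 + ‖v‖) ^ n) := by gcongr
      _ = _ := by ring

/-- The logarithmic derivative of the density along w is -2 Re⟨v, w⟩, so moving the derivative off F
produces this weight. Polynomial growth makes all three products integrable. -/
lemma integral_fderiv_stdGaussianVector {m : ℕ} {F : (Fin m → ℂ) → ℂ} (hF : Differentiable ℝ F)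
    {C : ℝ} {n : ℕ} (hF0 : ∀ v, ‖F v‖ ≤ C * (1 + ‖v‖) ^ n)
    (hF1 : ∀ v, ‖fderiv ℝ F v‖ ≤ C * (1 + ‖v‖) ^ n) (w : Fin m → ℂ) :
    ∫ v, fderiv ℝ F v w ∂stdGaussianVector m
      = ∫ v, ((2 * (star v ⬝ᵥ w).re : ℝ) : ℂ) * F v ∂stdGaussianVector m := by
  set p : (Fin m → ℂ) → ℝ := fun v => ∏ k, Real.pi⁻¹ * Real.exp (-‖v k‖ ^ 2) with hp
  have hp1 : p = fun v => (Real.pi⁻¹) ^ m * Real.exp (-∑ k, ‖v k‖ ^ 2) := by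
    funext v
    simp only [hp]
    rw [Finset.prod_mul_distrib, ← Real.exp_sum, Finset.sum_neg_distrib]
    simp
  have hpd : ∀ v, HasFDerivAt p (p v • -(∑ k, (2 : ℕ) • (innerSL ℝ (v k)).comp
      (ContinuousLinearMap.proj (R := ℝ) (φ := fun _ : Fin m => ℂ) k))) v := by
    intro v
    have h2 : ∀ k : Fin m, HasFDerivAt (fun v : Fin m → ℂ => ‖v k‖ ^ 2)
        ((2 : ℕ) • (innerSL ℝ (v k)).comp
          (ContinuousLinearMap.proj (R := ℝ) (φ := fun _ : Fin m => ℂ) k)) v := by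
      intro k
      have := (ContinuousLinearMap.proj (R := ℝ) (φ := fun _ : Fin m => ℂ) k).hasFDerivAt
        (x := v)
      exact this.norm_sq
    have h3 := ((HasFDerivAt.fun_sum fun k (_ : k ∈ Finset.univ) => h2 k).neg.exp).const_mul
      ((Real.pi⁻¹) ^ m)
    rw [hp1]
    rw [smul_smul] at h3
    exact h3
  have hpw : ∀ v, fderiv ℝ p v w = -(2 * (star v ⬝ᵥ w).re) * p v := by
    intro v
    rw [(hpd v).fderiv]
    simp only [smul_apply, neg_apply,
      sum_apply, ContinuousLinearMap.comp_apply,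
      ContinuousLinearMap.proj_apply, innerSL_apply_apply, smul_eq_mul]
    rw [dotProduct, Complex.re_sum, Finset.mul_sum, mul_comm, ]
    congr 2
    refine Finset.sum_congr rfl fun k _ => ?_
    rw [Complex.inner]
    simp
    ring_nf
  have hC : 0 ≤ C := by
    have := (norm_nonneg _).trans (hF0 0)
    simpa using this
  have hFm : AEStronglyMeasurable F (stdGaussianVector m) :=
    hF.continuous.aestronglyMeasurable
  have i1 : Integrable F (stdGaussianVector m) := integrable_of_norm_le_pow hFm hF0
  have i2 : Integrable (fun v => fderiv ℝ F v w) (stdGaussianVector m) := by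
    refine integrable_of_norm_le_pow (C := C * ‖w‖) (n := n)
      (measurable_fderiv_apply_const ℝ F w).aestronglyMeasurable fun v => ?_
    refine ((fderiv ℝ F v).le_opNorm w).trans ?_
    nlinarith [hF1 v, norm_nonneg w]
  have i3 := integrable_re_dotProduct_mul hF.continuous hF0 w
  have key := integral_smul_fderiv_eq_neg_fderiv_smul_of_integrable (μ := volume) (f := p) (g := F)
    (v := w) ?_ ?_ ?_ (fun v _ => (hpd v).differentiableAt) (fun v _ => hF v)
  · rw [integral_stdGaussianVector, integral_stdGaussianVector, key, ← integral_neg]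
    refine integral_congr_ae (ae_of_all _ fun v => ?_)
    change -(fderiv ℝ p v w • F v) = p v • (((2 * (star v ⬝ᵥ w).re : ℝ) : ℂ) * F v)
    rw [hpw]
    rw [Complex.real_smul, Complex.real_smul]
    push_cast
    ring
  · rw [integrable_stdGaussianVector_iff] at i3
    refine i3.neg.congr (ae_of_all _ fun v => ?_)
    change -(p v • (((2 * (star v ⬝ᵥ w).re : ℝ) : ℂ) * F v)) = fderiv ℝ p v w • F v
    rw [hpw]
    rw [Complex.real_smul, Complex.real_smul]
    push_cast
    ring
  · rwa [integrable_stdGaussianVector_iff] at i2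
  · rwa [integrable_stdGaussianVector_iff] at i1

/-- **Gaussian integration by parts** for a linear form of a standard complex Gaussian vector. -/
theorem integral_dotProduct_mul {m : ℕ} {F : (Fin m → ℂ) → ℂ} (hF : Differentiable ℝ F)
    {C : ℝ} {n : ℕ} (hF0 : ∀ v, ‖F v‖ ≤ C * (1 + ‖v‖) ^ n)
    (hF1 : ∀ v, ‖fderiv ℝ F v‖ ≤ C * (1 + ‖v‖) ^ n) (a : Fin m → ℂ) :
    ∫ v, (a ⬝ᵥ v) * F v ∂stdGaussianVector m
      = ∫ v, 1 / 2 * (fderiv ℝ F v (star a)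
          + Complex.I * fderiv ℝ F v (Complex.I • star a)) ∂stdGaussianVector m := by
  have i2 : ∀ w, Integrable (fun v => fderiv ℝ F v w) (stdGaussianVector m) := by
    intro w
    refine integrable_of_norm_le_pow (C := C * ‖w‖) (n := n)
      (measurable_fderiv_apply_const ℝ F w).aestronglyMeasurable fun v => ?_
    refine ((fderiv ℝ F v).le_opNorm w).trans ?_
    nlinarith [hF1 v, norm_nonneg w]
  have hC : 0 ≤ C := by
    have := (norm_nonneg _).trans (hF0 0)
    simpa using this
  have hlin := integrable_re_dotProduct_mul hF.continuous hF0
  -- The real directions ā and iā produce the weights 2 Re q and 2 Im q for q = a ⬝ᵥ v. Half of the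
  -- first plus i times half of the second is q.
  rw [integral_const_mul, integral_add (i2 _) ((i2 _).const_mul _), integral_const_mul,
    integral_fderiv_stdGaussianVector hF hF0 hF1, integral_fderiv_stdGaussianVector hF hF0 hF1,
    ← integral_const_mul, ← integral_add (hlin _) ((hlin _).const_mul _), ← integral_const_mul]
  refine integral_congr_ae (ae_of_all _ fun v => ?_)
  simp only
  have h1 : star v ⬝ᵥ star a = conj (a ⬝ᵥ v) := by
    simp [dotProduct, mul_comm]
  rw [dotProduct_smul, h1, smul_eq_mul]
  have h2 : a ⬝ᵥ v = ((a ⬝ᵥ v).re : ℂ) + (a ⬝ᵥ v).im * Complex.I := (Complex.re_add_im _).symm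
  generalize a ⬝ᵥ v = q at h2 ⊢
  simp only [Complex.conj_re, Complex.mul_re, Complex.I_re, Complex.I_im, Complex.conj_im]
  push_cast
  linear_combination F v * h2

end Stein

/-! ### Integration by parts and low moments for linear forms. -/

section LinearForms

/-- The linear form `v ↦ a ⬝ᵥ v`, as a real-linear map. -/
noncomputable def linForm {m : ℕ} (a : Fin m → ℂ) : (Fin m → ℂ) →L[ℝ] ℂ :=
  ∑ k, a k • (ContinuousLinearMap.proj k : (Fin m → ℂ) →L[ℝ] ℂ)

@[simp] lemma linForm_apply {m : ℕ} (a v : Fin m → ℂ) : linForm a v = a ⬝ᵥ v := by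
  simp [linForm, dotProduct, sum_apply]

lemma norm_dotProduct_le {m : ℕ} (a v : Fin m → ℂ) : ‖a ⬝ᵥ v‖ ≤ ‖linForm a‖ * ‖v‖ := by
  rw [← linForm_apply]
  exact (linForm a).le_opNorm v

lemma continuous_dotProduct {m : ℕ} (a : Fin m → ℂ) : Continuous fun v => a ⬝ᵥ v := by
  simp_rw [← linForm_apply]
  fun_prop

lemma hasFDerivAt_dotProduct {m : ℕ} (a v : Fin m → ℂ) :
    HasFDerivAt (fun v => a ⬝ᵥ v) (linForm a) v := by
  simp_rw [← linForm_apply]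
  exact (linForm a).hasFDerivAt

lemma measurable_dbar (g : ℂ → ℂ) : Measurable (dbar g) := by
  unfold dbar
  have h1 := measurable_fderiv_apply_const ℝ g 1
  have h2 := measurable_fderiv_apply_const ℝ g Complex.I
  fun_prop

lemma norm_dbar_le {g : ℂ → ℂ} {C : ℝ} (h : ∀ z, ‖fderiv ℝ g z‖ ≤ C) (z : ℂ) :
    ‖dbar g z‖ ≤ C := by
  have h1 : ‖fderiv ℝ g z 1‖ ≤ C := by simpa using (fderiv ℝ g z).le_of_opNorm_le (h z) 1
  have h2 : ‖fderiv ℝ g z Complex.I‖ ≤ C := by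
    simpa using (fderiv ℝ g z).le_of_opNorm_le (h z) Complex.I
  rw [dbar, norm_mul]
  have h3 := norm_add_le (fderiv ℝ g z 1) (Complex.I * fderiv ℝ g z Complex.I)
  rw [norm_mul, Complex.norm_I, one_mul] at h3
  norm_num
  linarith

lemma integrable_affine_mul {m : ℕ} (α : ℂ) (b : Fin m → ℂ) {G : (Fin m → ℂ) → ℂ} {C : ℝ}
    (hG : Measurable G) (hC : ∀ v, ‖G v‖ ≤ C) :
    Integrable (fun v => (α + b ⬝ᵥ v) * G v) (stdGaussianVector m) := by
  refine integrable_of_norm_le_pow (C := (‖α‖ + ‖linForm b‖) * C) (n := 1) ?_ fun v => ?_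
  · exact (((continuous_dotProduct b).measurable.const_add α).mul hG).aestronglyMeasurable
  · rw [norm_mul, pow_one]
    have h1 := norm_add_le α (b ⬝ᵥ v)
    have h2 := norm_dotProduct_le b v
    have h3 : ‖α + b ⬝ᵥ v‖ ≤ (‖α‖ + ‖linForm b‖) * (1 + ‖v‖) := by
      nlinarith [norm_nonneg α, norm_nonneg v, norm_nonneg (linForm b)]
    calc ‖α + b ⬝ᵥ v‖ * ‖G v‖ ≤ ((‖α‖ + ‖linForm b‖) * (1 + ‖v‖)) * C :=
          mul_le_mul h3 (hC v) (norm_nonneg _) (by positivity)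
      _ = _ := by ring

/-- Gaussian integration by parts against an affine holomorphic factor and two smooth bounded
functions of linear forms. -/
theorem integral_dotProduct_mul_mul {m : ℕ} (a b c d : Fin m → ℂ) (α : ℂ) {g h : ℂ → ℂ} {C : ℝ}
    (hg : Differentiable ℝ g) (hh : Differentiable ℝ h) (hg0 : ∀ z, ‖g z‖ ≤ C)
    (hh0 : ∀ z, ‖h z‖ ≤ C) (hg1 : ∀ z, ‖fderiv ℝ g z‖ ≤ C) (hh1 : ∀ z, ‖fderiv ℝ h z‖ ≤ C) :
    ∫ v, (a ⬝ᵥ v) * ((α + b ⬝ᵥ v) * (g (c ⬝ᵥ v) * h (d ⬝ᵥ v))) ∂stdGaussianVector m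
      = (a ⬝ᵥ star c) *
          ∫ v, (α + b ⬝ᵥ v) * (dbar g (c ⬝ᵥ v) * h (d ⬝ᵥ v)) ∂stdGaussianVector m
        + (a ⬝ᵥ star d) *
          ∫ v, (α + b ⬝ᵥ v) * (g (c ⬝ᵥ v) * dbar h (d ⬝ᵥ v)) ∂stdGaussianVector m := by
  have hC : 0 ≤ C := (norm_nonneg _).trans (hg0 0)
  have hder : ∀ v, HasFDerivAt (fun v => (α + b ⬝ᵥ v) * (g (c ⬝ᵥ v) * h (d ⬝ᵥ v)))
      ((α + b ⬝ᵥ v) • (g (c ⬝ᵥ v) • (fderiv ℝ h (d ⬝ᵥ v)).comp (linForm d)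
        + h (d ⬝ᵥ v) • (fderiv ℝ g (c ⬝ᵥ v)).comp (linForm c))
        + (g (c ⬝ᵥ v) * h (d ⬝ᵥ v)) • linForm b) v := by
    intro v
    have h1 := ((hg (c ⬝ᵥ v)).hasFDerivAt.comp v (hasFDerivAt_dotProduct c v))
    have h2 := ((hh (d ⬝ᵥ v)).hasFDerivAt.comp v (hasFDerivAt_dotProduct d v))
    exact ((hasFDerivAt_dotProduct b v).const_add α).mul (h1.mul h2)
  set K := ‖α‖ + ‖linForm b‖ with hK
  have hb : ∀ v, ‖α + b ⬝ᵥ v‖ ≤ K * (1 + ‖v‖) := fun v => by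
    have h1 := norm_add_le α (b ⬝ᵥ v)
    have h2 := norm_dotProduct_le b v
    nlinarith [norm_nonneg α, norm_nonneg v, norm_nonneg (linForm b)]
  have hK0 : 0 ≤ K := by positivity
  set C' := K * (C * C) + K * (C * (C * ‖linForm d‖) + C * (C * ‖linForm c‖))
    + C * C * ‖linForm b‖ with hC'
  rw [integral_dotProduct_mul (C := C') (n := 1) (fun v => (hder v).differentiableAt)]
  -- The affine factor is holomorphic, so ∂̄ annihilates it: its derivative appears with coefficient
  -- 1 + i² = 0. Only g and h are differentiated.
  · have e1 : ∀ v : Fin m → ℂ, 1 / 2 * (fderiv ℝ (fun v => (α + b ⬝ᵥ v) * (g (c ⬝ᵥ v) *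
        h (d ⬝ᵥ v))) v (star a) + Complex.I * fderiv ℝ (fun v => (α + b ⬝ᵥ v) * (g (c ⬝ᵥ v) *
        h (d ⬝ᵥ v))) v (Complex.I • star a))
        = (a ⬝ᵥ star c) * ((α + b ⬝ᵥ v) * (dbar g (c ⬝ᵥ v) * h (d ⬝ᵥ v)))
          + (a ⬝ᵥ star d) * ((α + b ⬝ᵥ v) * (g (c ⬝ᵥ v) * dbar h (d ⬝ᵥ v))) := by
      intro v
      have hc := half_fderiv_add_I_mul g (c ⬝ᵥ v) (c ⬝ᵥ star a)
      have hd := half_fderiv_add_I_mul h (d ⬝ᵥ v) (d ⬝ᵥ star a)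
      have conj_dot : ∀ x : Fin m → ℂ, conj (x ⬝ᵥ star a) = a ⬝ᵥ star x := by
        intro x
        simp [dotProduct, mul_comm]
      rw [conj_dot] at hc hd
      rw [(hder v).fderiv]
      simp only [add_apply, smul_apply, ContinuousLinearMap.comp_apply, linForm_apply,
        dotProduct_smul, smul_eq_mul]
      linear_combination (α + b ⬝ᵥ v) * h (d ⬝ᵥ v) * hc + (α + b ⬝ᵥ v) * g (c ⬝ᵥ v) * hd
        + 1 / 2 * g (c ⬝ᵥ v) * h (d ⬝ᵥ v) * (b ⬝ᵥ star a) * Complex.I_sq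
    simp_rw [e1]
    rw [integral_add, integral_const_mul, integral_const_mul]
    · refine (integrable_affine_mul α b (C := C * C) ?_ fun v => ?_).const_mul _
      · exact ((measurable_dbar g).comp (continuous_dotProduct c).measurable).mul
          (hh.continuous.comp (continuous_dotProduct d)).measurable
      · rw [norm_mul]
        exact mul_le_mul (norm_dbar_le hg1 _) (hh0 _) (norm_nonneg _) hC
    · refine (integrable_affine_mul α b (C := C * C) ?_ fun v => ?_).const_mul _
      · exact (hg.continuous.comp (continuous_dotProduct c)).measurable.mul
          ((measurable_dbar h).comp (continuous_dotProduct d).measurable)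
      · rw [norm_mul]
        exact mul_le_mul (hg0 _) (norm_dbar_le hh1 _) (norm_nonneg _) hC
  · intro v
    rw [norm_mul, norm_mul, pow_one]
    have h1 : ‖g (c ⬝ᵥ v)‖ * ‖h (d ⬝ᵥ v)‖ ≤ C * C :=
      mul_le_mul (hg0 _) (hh0 _) (norm_nonneg _) hC
    have h2 : K * (C * C) ≤ C' := by
      rw [hC']
      have : 0 ≤ K * (C * (C * ‖linForm d‖) + C * (C * ‖linForm c‖))
        + C * C * ‖linForm b‖ := by positivity
      linarith
    calc _ ≤ (K * (1 + ‖v‖)) * (C * C) := mul_le_mul (hb v) h1 (by positivity) (by positivity)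
      _ = K * (C * C) * (1 + ‖v‖) := by ring
      _ ≤ _ := by gcongr
  · intro v
    rw [(hder v).fderiv, pow_one]
    have comp_le : ∀ (f : ℂ → ℂ) (e : Fin m → ℂ) z, ‖fderiv ℝ f z‖ ≤ C →
        ‖(fderiv ℝ f z).comp (linForm e)‖ ≤ C * ‖linForm e‖ := fun f e z hf =>
      ((fderiv ℝ f z).opNorm_comp_le _).trans (by gcongr)
    calc _ ≤ ‖α + b ⬝ᵥ v‖ * (‖g (c ⬝ᵥ v)‖ * ‖(fderiv ℝ h (d ⬝ᵥ v)).comp (linForm d)‖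
        + ‖h (d ⬝ᵥ v)‖ * ‖(fderiv ℝ g (c ⬝ᵥ v)).comp (linForm c)‖)
        + ‖g (c ⬝ᵥ v)‖ * ‖h (d ⬝ᵥ v)‖ * ‖linForm b‖ := by
          refine (norm_add_le _ _).trans ?_
          rw [norm_smul, norm_smul, norm_mul]
          gcongr
          refine (norm_add_le _ _).trans ?_
          rw [norm_smul, norm_smul]
      _ ≤ (K * (1 + ‖v‖)) * (C * (C * ‖linForm d‖) + C * (C * ‖linForm c‖))
        + C * C * ‖linForm b‖ := by
          have h1 := comp_le h d _ (hh1 (d ⬝ᵥ v))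
          have h2 := comp_le g c _ (hg1 (c ⬝ᵥ v))
          gcongr
          exacts [hb v, hg0 _, hh0 _, hg0 _, hh0 _]
      _ ≤ C' * (1 + ‖v‖) := by
          rw [hC']
          have h1 : 0 ≤ C * C * ‖linForm b‖ * ‖v‖ := by positivity
          have h2 : 0 ≤ K * (C * C) * (1 + ‖v‖) := by positivity
          nlinarith

lemma integral_dotProduct_mul_conj {m : ℕ} (a b : Fin m → ℂ) :
    ∫ v, (a ⬝ᵥ v) * conj (b ⬝ᵥ v) ∂stdGaussianVector m = a ⬝ᵥ star b := by
  have hder : ∀ v, HasFDerivAt (fun v => conj (b ⬝ᵥ v))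
      (Complex.conjCLE.toContinuousLinearMap.comp (linForm b)) v := fun v =>
    Complex.conjCLE.toContinuousLinearMap.hasFDerivAt.comp v (hasFDerivAt_dotProduct b v)
  rw [integral_dotProduct_mul (C := ‖linForm b‖) (n := 1)
    (fun v => (hder v).differentiableAt)]
  · have : ∀ v : Fin m → ℂ, 1 / 2 * (fderiv ℝ (fun v => conj (b ⬝ᵥ v)) v (star a)
        + Complex.I * fderiv ℝ (fun v => conj (b ⬝ᵥ v)) v (Complex.I • star a))
        = a ⬝ᵥ star b := by
      intro v
      rw [(hder v).fderiv]
      have : a ⬝ᵥ star b = conj (b ⬝ᵥ star a) := by simp [dotProduct, mul_comm]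
      rw [this]
      simp only [ContinuousLinearMap.comp_apply, linForm_apply, dotProduct_smul]
      simp
      linear_combination (-1 / 2 : ℂ) * conj (b ⬝ᵥ star a) * Complex.I_sq
    simp_rw [this]
    simp
  · intro v
    rw [RCLike.norm_conj, pow_one]
    have := norm_dotProduct_le b v
    nlinarith [norm_nonneg (linForm b)]
  · intro v
    rw [(hder v).fderiv, pow_one]
    refine ((ContinuousLinearMap.opNorm_comp_le _ _)).trans ?_
    have : ‖Complex.conjCLE.toContinuousLinearMap‖ ≤ 1 :=
      ContinuousLinearMap.opNorm_le_bound _ zero_le_one fun z => by simp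
    nlinarith [norm_nonneg (linForm b), norm_nonneg v, mul_nonneg (norm_nonneg (linForm b)) (norm_nonneg v)]

lemma integrable_norm_dotProduct_pow {m : ℕ} (a : Fin m → ℂ) (n : ℕ) :
    Integrable (fun v => ‖a ⬝ᵥ v‖ ^ n) (stdGaussianVector m) := by
  refine integrable_of_norm_le_pow (C := ‖linForm a‖ ^ n) (n := n)
    ((continuous_dotProduct a).norm.pow n).aestronglyMeasurable fun v => ?_
  rw [norm_pow, norm_norm, ← mul_pow]
  gcongr
  exact (norm_dotProduct_le a v).trans (by gcongr; linarith)

lemma integral_norm_dotProduct_sq {m : ℕ} (a : Fin m → ℂ) :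
    ∫ v, ‖a ⬝ᵥ v‖ ^ 2 ∂stdGaussianVector m = ∑ k, ‖a k‖ ^ 2 := by
  have h := integral_dotProduct_mul_conj a a
  have h2 : ∀ z : ℂ, z * conj z = ((‖z‖ ^ 2 : ℝ) : ℂ) := fun z => by
    rw [Complex.mul_conj, Complex.normSq_eq_norm_sq]
  simp_rw [h2] at h
  rw [integral_complex_ofReal] at h
  have h3 : a ⬝ᵥ star a = ((∑ k, ‖a k‖ ^ 2 : ℝ) : ℂ) := by
    push_cast
    rw [dotProduct]
    refine Finset.sum_congr rfl fun k _ => ?_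
    rw [Pi.star_apply, RCLike.star_def, h2]
    push_cast
    rfl
  rw [h3] at h
  exact_mod_cast h

/-- Integration by parts applied to z · (z z̄²): the derivative ∂̄(z z̄²) = 2|z|² reduces the fourth
moment to twice the variance times the second moment. It bounds difference quotients in L⁴ by their
variance. -/
lemma integral_norm_dotProduct_pow_four {m : ℕ} (a : Fin m → ℂ) :
    ∫ v, ‖a ⬝ᵥ v‖ ^ 4 ∂stdGaussianVector m = 2 * (∑ k, ‖a k‖ ^ 2) ^ 2 := by
  set L := Complex.conjCLE.toContinuousLinearMap.comp (linForm a) with hL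
  have hd1 : ∀ v, HasFDerivAt (fun v => conj (a ⬝ᵥ v)) L v := fun v =>
    Complex.conjCLE.toContinuousLinearMap.hasFDerivAt.comp v (hasFDerivAt_dotProduct a v)
  have hder : ∀ v, HasFDerivAt (fun v => (a ⬝ᵥ v) * (conj (a ⬝ᵥ v) * conj (a ⬝ᵥ v)))
      ((a ⬝ᵥ v) • (conj (a ⬝ᵥ v) • L + conj (a ⬝ᵥ v) • L)
        + (conj (a ⬝ᵥ v) * conj (a ⬝ᵥ v)) • linForm a) v := fun v =>
    (hasFDerivAt_dotProduct a v).mul ((hd1 v).mul (hd1 v))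
  have hLn : ‖L‖ ≤ ‖linForm a‖ := by
    refine ((ContinuousLinearMap.opNorm_comp_le _ _)).trans ?_
    have : ‖Complex.conjCLE.toContinuousLinearMap‖ ≤ 1 :=
      ContinuousLinearMap.opNorm_le_bound _ zero_le_one fun z => by simp
    nlinarith [norm_nonneg (linForm a)]
  set N := ‖linForm a‖ with hN
  have hN0 : 0 ≤ N := norm_nonneg _
  have hb : ∀ v, ‖a ⬝ᵥ v‖ ≤ N * (1 + ‖v‖) := fun v =>
    (norm_dotProduct_le a v).trans (by gcongr; linarith)
  have key := integral_dotProduct_mul (C := 3 * N ^ 3) (n := 3)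
    (fun v => (hder v).differentiableAt) ?_ ?_ a
  · have e1 : ∀ v : Fin m → ℂ, (a ⬝ᵥ v) * ((a ⬝ᵥ v) * (conj (a ⬝ᵥ v) * conj (a ⬝ᵥ v)))
        = ((‖a ⬝ᵥ v‖ ^ 4 : ℝ) : ℂ) := by
      intro v
      have h2 : (a ⬝ᵥ v) * conj (a ⬝ᵥ v) = ((‖a ⬝ᵥ v‖ ^ 2 : ℝ) : ℂ) := by
        rw [Complex.mul_conj, Complex.normSq_eq_norm_sq]
      push_cast at h2 ⊢
      linear_combination ((a ⬝ᵥ v) * conj (a ⬝ᵥ v) + (‖a ⬝ᵥ v‖ : ℂ) ^ 2) * h2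
    have h3 : conj (a ⬝ᵥ star a) = ((∑ k, ‖a k‖ ^ 2 : ℝ) : ℂ) := by
      push_cast
      rw [dotProduct, map_sum]
      refine Finset.sum_congr rfl fun k _ => ?_
      rw [Pi.star_apply, RCLike.star_def, Complex.mul_conj, Complex.normSq_eq_norm_sq]
      simp
    have e2 : ∀ v : Fin m → ℂ, 1 / 2 * (fderiv ℝ (fun v => (a ⬝ᵥ v) * (conj (a ⬝ᵥ v) *
        conj (a ⬝ᵥ v))) v (star a) + Complex.I * fderiv ℝ (fun v => (a ⬝ᵥ v) * (conj (a ⬝ᵥ v) *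
        conj (a ⬝ᵥ v))) v (Complex.I • star a))
        = ((2 * (∑ k, ‖a k‖ ^ 2) * ‖a ⬝ᵥ v‖ ^ 2 : ℝ) : ℂ) := by
      intro v
      rw [(hder v).fderiv]
      have h2 : (a ⬝ᵥ v) * conj (a ⬝ᵥ v) = ((‖a ⬝ᵥ v‖ ^ 2 : ℝ) : ℂ) := by
        rw [Complex.mul_conj, Complex.normSq_eq_norm_sq]
      simp only [add_apply, smul_apply, hL, ContinuousLinearMap.comp_apply, linForm_apply,
        dotProduct_smul, smul_eq_mul, ContinuousLinearEquiv.coe_coe, Complex.conjCLE_apply, map_mul,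
        Complex.conj_I, h3]
      push_cast at h2 ⊢
      linear_combination 2 * (∑ k, (‖a k‖ : ℂ) ^ 2) * h2
        + (1 / 2 * (conj (a ⬝ᵥ v) * conj (a ⬝ᵥ v)) * (a ⬝ᵥ star a)
        - (a ⬝ᵥ v) * conj (a ⬝ᵥ v) * (∑ k, (‖a k‖ : ℂ) ^ 2)) * Complex.I_sq
    simp_rw [e1, e2] at key
    rw [integral_complex_ofReal, integral_complex_ofReal] at key
    have key' := Complex.ofReal_injective key
    rw [key', integral_const_mul, integral_norm_dotProduct_sq]
    ring
  · intro v
    rw [norm_mul, norm_mul, RCLike.norm_conj]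
    have := hb v
    calc ‖a ⬝ᵥ v‖ * (‖a ⬝ᵥ v‖ * ‖a ⬝ᵥ v‖)
        ≤ (N * (1 + ‖v‖)) * ((N * (1 + ‖v‖)) * (N * (1 + ‖v‖))) := by gcongr
      _ = N ^ 3 * (1 + ‖v‖) ^ 3 := by ring
      _ ≤ _ := by
        gcongr
        linarith [pow_nonneg hN0 3]
  · intro v
    rw [(hder v).fderiv]
    have := hb v
    have hv : 1 ≤ 1 + ‖v‖ := by linarith [norm_nonneg v]
    calc _ ≤ ‖a ⬝ᵥ v‖ * (‖a ⬝ᵥ v‖ * ‖L‖ + ‖a ⬝ᵥ v‖ * ‖L‖) + ‖a ⬝ᵥ v‖ * ‖a ⬝ᵥ v‖ * N := by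
          refine (norm_add_le _ _).trans ?_
          rw [norm_smul, norm_smul, norm_mul, RCLike.norm_conj]
          gcongr
          refine (norm_add_le _ _).trans ?_
          rw [norm_smul, RCLike.norm_conj]
      _ ≤ (N * (1 + ‖v‖)) * ((N * (1 + ‖v‖)) * N + (N * (1 + ‖v‖)) * N)
          + (N * (1 + ‖v‖)) * (N * (1 + ‖v‖)) * N := by gcongr
      _ = 3 * N ^ 3 * (1 + ‖v‖) ^ 2 := by ring
      _ ≤ _ := by
        gcongr
        norm_num

end LinearForms

/-! ### The joint Laplace transform of two squared moduli. -/

section Laplace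

/-- The Gaussian is its own Fourier transform. Written this way, a quadratic exponent in x becomes
linear, at the price of an auxiliary Gaussian variable. -/
lemma exp_neg_mul_norm_sq_eq_integral {l : ℝ} (hl : 0 ≤ l) (x : ℂ) :
    ((Real.exp (-l * ‖x‖ ^ 2) : ℝ) : ℂ)
      = ∫ z, Complex.exp (Complex.I * (inner ℝ ((2 * √l : ℝ) * x) z : ℝ)) ∂stdComplexGaussian := by
  have h := integral_cexp_stdComplexGaussian (b := 0) (by norm_num) Complex.I ((2 * √l : ℝ) * x)
  simp only [Complex.ofReal_zero, neg_zero, zero_mul, zero_add, add_zero, inv_one, one_mul,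
    mul_one] at h
  rw [h, Complex.ofReal_exp]
  congr 1
  rw [← Complex.ofReal_pow, norm_mul, mul_pow, Complex.norm_real, Real.norm_eq_abs, sq_abs,
    mul_pow, Real.sq_sqrt hl, Complex.I_sq]
  push_cast
  ring

lemma integral_rexp_stdComplexGaussian {b : ℝ} (hb : -1 < b) (c : ℝ) (w : ℂ) :
    ∫ z, Real.exp (-b * ‖z‖ ^ 2 + c * inner ℝ w z) ∂stdComplexGaussian
      = (1 + b)⁻¹ * Real.exp (c ^ 2 * ‖w‖ ^ 2 / (4 * (1 + b))) := by
  have h := integral_cexp_stdComplexGaussian hb c w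
  apply Complex.ofReal_injective
  rw [← integral_complex_ofReal]
  push_cast
  exact h

/-- The joint Laplace transform of the squared moduli of two normalized linear forms. -/
theorem integral_exp_neg_norm_sq_dotProduct {m : ℕ} {a b : Fin m → ℂ}
    (ha : ∑ k, ‖a k‖ ^ 2 = 1) (hb : ∑ k, ‖b k‖ ^ 2 = 1) (hab : ‖a ⬝ᵥ star b‖ ≤ 1)
    {l n : ℝ} (hl : 0 ≤ l) (hn : 0 ≤ n) :
    ∫ v, Real.exp (-l * ‖a ⬝ᵥ v‖ ^ 2 - n * ‖b ⬝ᵥ v‖ ^ 2) ∂stdGaussianVector m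
      = (1 + l + n + l * n * (1 - ‖a ⬝ᵥ star b‖ ^ 2))⁻¹ := by
  set r := a ⬝ᵥ star b with hr
  set s := √l with hs
  set t := √n with ht
  have hs2 : s ^ 2 = l := Real.sq_sqrt hl
  have ht2 : t ^ 2 = n := Real.sq_sqrt hn
  set A : ℂ × ℂ → Fin m → ℂ := fun p => (2 * s * conj p.1 : ℂ) • a
    + (2 * t * conj p.2 : ℂ) • b with hA
  have hA' : ∀ p, A p = fun k => 2 * s * conj p.1 * a k + 2 * t * conj p.2 * b k := by
    intro p
    funext k
    simp [hA]
  have hdot : ∀ p v, A p ⬝ᵥ v = 2 * s * conj p.1 * (a ⬝ᵥ v) + 2 * t * conj p.2 * (b ⬝ᵥ v) := by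
    intro p v
    simp [hA]
  have hAc : Continuous fun q : (Fin m → ℂ) × (ℂ × ℂ) => (A q.2 ⬝ᵥ q.1).re := by
    simp_rw [hdot]
    have h1 : Continuous fun q : (Fin m → ℂ) × (ℂ × ℂ) => a ⬝ᵥ q.1 :=
      (continuous_dotProduct a).comp continuous_fst
    have h2 : Continuous fun q : (Fin m → ℂ) × (ℂ × ℂ) => b ⬝ᵥ q.1 :=
      (continuous_dotProduct b).comp continuous_fst
    fun_prop
  -- Linearise both squares with an independent pair p of auxiliary Gaussians. After Fubini the
  -- v-integral is a characteristic function, and only two scalar Gaussian integrals in p remain.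
  have e1 : ∀ v : Fin m → ℂ, ((Real.exp (-l * ‖a ⬝ᵥ v‖ ^ 2 - n * ‖b ⬝ᵥ v‖ ^ 2) : ℝ) : ℂ)
      = ∫ p, Complex.exp (Complex.I * ((A p ⬝ᵥ v).re : ℝ))
          ∂(stdComplexGaussian.prod stdComplexGaussian) := by
    intro v
    rw [sub_eq_add_neg, Real.exp_add, ← neg_mul, Complex.ofReal_mul,
      exp_neg_mul_norm_sq_eq_integral hl, exp_neg_mul_norm_sq_eq_integral hn, ← integral_prod_mul]
    refine integral_congr_ae (ae_of_all _ fun p => ?_)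
    simp only
    rw [← Complex.exp_add, ← mul_add, ← Complex.ofReal_add, hdot]
    congr 3
    simp [Complex.inner]
    ring
  have e2 : ∀ p : ℂ × ℂ, ∫ v, Complex.exp (Complex.I * ((A p ⬝ᵥ v).re : ℝ)) ∂stdGaussianVector m
      = ((Real.exp (-n * ‖p.2‖ ^ 2) *
          Real.exp (-l * ‖p.1‖ ^ 2 + (-2 * s * t) * inner ℝ (r * p.2) p.1) : ℝ) : ℂ) := by
    intro p
    rw [integral_cexp_dotProduct, ← Real.exp_add, Complex.ofReal_exp]
    congr 1
    have hsum : ∑ k, ‖A p k‖ ^ 2 = 4 * (l * ‖p.1‖ ^ 2 + n * ‖p.2‖ ^ 2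
        + 2 * s * t * inner ℝ (r * p.2) p.1) := by
      have h1 : ∀ k, ‖A p k‖ ^ 2 = 4 * l * ‖p.1‖ ^ 2 * ‖a k‖ ^ 2 + 4 * n * ‖p.2‖ ^ 2 * ‖b k‖ ^ 2
          + 8 * s * t * (conj p.1 * p.2 * (a k * conj (b k))).re := by
        intro k
        rw [hA', ← hs2, ← ht2]
        simp only [← Complex.normSq_eq_norm_sq, Complex.normSq_apply]
        simp
        ring
      simp_rw [h1]
      rw [Finset.sum_add_distrib, Finset.sum_add_distrib, ← Finset.mul_sum, ← Finset.mul_sum,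
        ← Finset.mul_sum, ha, hb, ← Complex.re_sum, ← Finset.mul_sum]
      have h2 : ∑ k, a k * conj (b k) = r := rfl
      rw [h2]
      simp [Complex.inner]
      ring
    rw [hsum, Complex.I_sq]
    push_cast
    ring
  have hu : ‖r‖ ^ 2 ≤ 1 := pow_le_one₀ (norm_nonneg _) hab
  have hl1 : 0 < 1 + l := by linarith
  -- Integrating out `p.1` first completes the square and changes the coefficient of |p.2|² to this
  -- value. The condition |r| ≤ 1 keeps the remaining Gaussian integral convergent.
  have hb1 : -1 < n - l * n * ‖r‖ ^ 2 / (1 + l) := by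
    have : l * n * ‖r‖ ^ 2 / (1 + l) ≤ n := by
      rw [div_le_iff₀ hl1]
      nlinarith [mul_nonneg hl hn]
    linarith
  have hswap := integral_integral_swap (μ := stdGaussianVector m)
    (ν := stdComplexGaussian.prod stdComplexGaussian)
    (f := fun v p => Complex.exp (Complex.I * ((A p ⬝ᵥ v).re : ℝ))) (by
      refine Integrable.of_bound (C := 1) ?_ (ae_of_all _ fun q => ?_)
      · exact Continuous.aestronglyMeasurable (by
          unfold Function.uncurry
          exact Complex.continuous_exp.comp
            (continuous_const.mul (Complex.continuous_ofReal.comp hAc)))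
      · simp only [Function.uncurry]
        rw [mul_comm, Complex.norm_exp_ofReal_mul_I])
  simp_rw [← e1, e2] at hswap
  rw [integral_complex_ofReal, integral_complex_ofReal] at hswap
  have hswap' := Complex.ofReal_injective hswap
  rw [hswap']
  have e3 : ∀ y : ℂ, ∫ x, Real.exp (-n * ‖y‖ ^ 2) *
      Real.exp (-l * ‖x‖ ^ 2 + (-2 * s * t) * inner ℝ (r * y) x) ∂stdComplexGaussian
      = (1 + l)⁻¹ * Real.exp (-(n - l * n * ‖r‖ ^ 2 / (1 + l)) * ‖y‖ ^ 2
        + 0 * inner ℝ (0 : ℂ) y) := by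
    intro y
    rw [integral_const_mul, integral_rexp_stdComplexGaussian (by linarith), mul_left_comm,
      ← Real.exp_add]
    congr 2
    rw [norm_mul]
    simp only [mul_pow, neg_sq, hs2, ht2]
    field_simp
    ring
  have hint : Integrable (fun p : ℂ × ℂ => Real.exp (-n * ‖p.2‖ ^ 2) *
      Real.exp (-l * ‖p.1‖ ^ 2 + (-2 * s * t) * inner ℝ (r * p.2) p.1))
      (stdComplexGaussian.prod stdComplexGaussian) := by
    refine Integrable.of_integral_ne_zero fun h0 => ?_
    rw [h0] at hswap'
    have hpos : 0 < ∫ v, Real.exp (-l * ‖a ⬝ᵥ v‖ ^ 2 - n * ‖b ⬝ᵥ v‖ ^ 2)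
        ∂stdGaussianVector m := by
      refine integral_exp_pos (Integrable.of_bound (C := 1) ?_ (ae_of_all _ fun v => ?_))
      · have h1 := continuous_dotProduct a
        have h2 := continuous_dotProduct b
        exact Continuous.aestronglyMeasurable (by fun_prop)
      · rw [Real.norm_of_nonneg (Real.exp_pos _).le, Real.exp_le_one_iff]
        nlinarith [mul_nonneg hl (sq_nonneg ‖a ⬝ᵥ v‖), mul_nonneg hn (sq_nonneg ‖b ⬝ᵥ v‖)]
    linarith
  rw [integral_prod_symm _ hint]
  simp_rw [e3]
  rw [integral_const_mul, integral_rexp_stdComplexGaussian hb1]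
  simp only [norm_zero, ne_eq, OfNat.ofNat_ne_zero, not_false_eq_true, zero_pow, mul_zero,
    zero_div, Real.exp_zero, mul_one]
  rw [← mul_inv]
  congr 1
  field_simp
  ring

end Laplace

/-! ### Transfer to complex Gaussian vectors on an arbitrary probability space. -/

section GaussianVector

variable {Ω : Type*} [MeasurableSpace Ω] {μ : Measure Ω}

lemma IsComplexGaussianVector.mulVec {n k : ℕ} {X : Ω → Fin n → ℂ}
    (hX : IsComplexGaussianVector μ X) (B : Matrix (Fin k) (Fin n) ℂ) :
    IsComplexGaussianVector μ fun ω => B.mulVec (X ω) := by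
  obtain ⟨m, A, hA⟩ := hX
  refine ⟨m, B * A, ?_⟩
  have h := hA.comp (u := fun v => B.mulVec v) (by fun_prop)
  simp_rw [← Matrix.mulVec_mulVec]
  exact h

lemma IsComplexGaussianVector.aemeasurable {n : ℕ} {X : Ω → Fin n → ℂ}
    (hX : IsComplexGaussianVector μ X) (i : Fin n) : AEMeasurable (fun ω => X ω i) μ := by
  obtain ⟨m, A, hA⟩ := hX
  exact (measurable_pi_apply i).comp_aemeasurable hA.aemeasurable_fst

/-- One representation by linear forms of a standard vector serves all test functions
simultaneously, and its rows have the covariances of X as their Hermitian products. Later identities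
can therefore be stated through covariances alone. -/
lemma IsComplexGaussianVector.exists_integral_eq {n : ℕ} {X : Ω → Fin n → ℂ}
    (hX : IsComplexGaussianVector μ X) :
    ∃ (m : ℕ) (A : Fin n → Fin m → ℂ), (∀ φ : (Fin n → ℂ) → ℂ, Measurable φ →
      ∫ ω, φ (X ω) ∂μ = ∫ v, φ (fun i => A i ⬝ᵥ v) ∂stdGaussianVector m)
      ∧ (∀ φ : (Fin n → ℂ) → ℝ, Measurable φ →
      ∫ ω, φ (X ω) ∂μ = ∫ v, φ (fun i => A i ⬝ᵥ v) ∂stdGaussianVector m)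
      ∧ (∀ φ : (Fin n → ℂ) → ℝ, Measurable φ →
      (Integrable (fun ω => φ (X ω)) μ ↔
        Integrable (fun v => φ (fun i => A i ⬝ᵥ v)) (stdGaussianVector m)))
      ∧ ∀ i j, ∫ ω, X ω i * conj (X ω j) ∂μ = A i ⬝ᵥ star (A j) := by
  obtain ⟨m, A, hA⟩ := hX
  have h1 : ∀ φ : (Fin n → ℂ) → ℂ, Measurable φ →
      ∫ ω, φ (X ω) ∂μ = ∫ v, φ (fun i => A i ⬝ᵥ v) ∂stdGaussianVector m :=
    fun φ hφ => (hA.comp hφ).integral_eq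
  refine ⟨m, A, h1, fun φ hφ => (hA.comp hφ).integral_eq, fun φ hφ => (hA.comp hφ).integrable_iff,
    fun i j => ?_⟩
  rw [h1 (fun x => x i * conj (x j)) (by fun_prop), integral_dotProduct_mul_conj]

lemma dotProduct_star_self_eq {m : ℕ} (a : Fin m → ℂ) :
    a ⬝ᵥ star a = ((∑ k, ‖a k‖ ^ 2 : ℝ) : ℂ) := by
  push_cast
  rw [dotProduct]
  refine Finset.sum_congr rfl fun k _ => ?_
  rw [Pi.star_apply, RCLike.star_def, Complex.mul_conj, Complex.normSq_eq_norm_sq]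
  push_cast
  rfl

/-- Gaussian integration by parts for a complex Gaussian vector with four coordinates. -/
theorem IsComplexGaussianVector.integral_mul {X : Ω → Fin 4 → ℂ}
    (hX : IsComplexGaussianVector μ X) (α β : ℂ) {g h : ℂ → ℂ} {C : ℝ}
    (hg : Differentiable ℝ g) (hh : Differentiable ℝ h) (hg0 : ∀ z, ‖g z‖ ≤ C)
    (hh0 : ∀ z, ‖h z‖ ≤ C) (hg1 : ∀ z, ‖fderiv ℝ g z‖ ≤ C) (hh1 : ∀ z, ‖fderiv ℝ h z‖ ≤ C) :
    ∫ ω, X ω 0 * ((α + β * X ω 1) * (g (X ω 2) * h (X ω 3))) ∂μ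
      = (∫ ω, X ω 0 * conj (X ω 2) ∂μ) *
          ∫ ω, (α + β * X ω 1) * (dbar g (X ω 2) * h (X ω 3)) ∂μ
        + (∫ ω, X ω 0 * conj (X ω 3) ∂μ) *
          ∫ ω, (α + β * X ω 1) * (g (X ω 2) * dbar h (X ω 3)) ∂μ := by
  obtain ⟨m, A, h1, -, -, h2⟩ := hX.exists_integral_eq
  have mg := hg.continuous.measurable
  have mh := hh.continuous.measurable
  have mg' := measurable_dbar g
  have mh' := measurable_dbar h
  rw [h1 (fun x => x 0 * ((α + β * x 1) * (g (x 2) * h (x 3)))) (by fun_prop),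
    h1 (fun x => (α + β * x 1) * (dbar g (x 2) * h (x 3))) (by fun_prop),
    h1 (fun x => (α + β * x 1) * (g (x 2) * dbar h (x 3))) (by fun_prop), h2, h2]
  have := integral_dotProduct_mul_mul (A 0) (β • A 1) (A 2) (A 3) α hg hh hg0 hh0 hg1 hh1
  simpa only [smul_dotProduct, smul_eq_mul] using this

lemma IsComplexGaussianVector.integrable_norm_pow {n : ℕ} {X : Ω → Fin n → ℂ}
    (hX : IsComplexGaussianVector μ X) (i : Fin n) (p : ℕ) :
    Integrable (fun ω => ‖X ω i‖ ^ p) μ := by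
  obtain ⟨m, A, -, -, h3, -⟩ := hX.exists_integral_eq
  rw [h3 (fun x => ‖x i‖ ^ p) (by fun_prop)]
  exact integrable_norm_dotProduct_pow _ _

lemma IsComplexGaussianVector.integral_norm_pow_four {n : ℕ} {X : Ω → Fin n → ℂ}
    (hX : IsComplexGaussianVector μ X) (i : Fin n) :
    ∫ ω, ‖X ω i‖ ^ 4 ∂μ = 2 * (∫ ω, ‖X ω i‖ ^ 2 ∂μ) ^ 2 := by
  obtain ⟨m, A, -, h2, -, -⟩ := hX.exists_integral_eq
  rw [h2 (fun x => ‖x i‖ ^ 4) (by fun_prop), h2 (fun x => ‖x i‖ ^ 2) (by fun_prop),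
    integral_norm_dotProduct_pow_four, integral_norm_dotProduct_sq]

theorem IsComplexGaussianVector.integral_exp_neg {X : Ω → Fin 2 → ℂ}
    (hX : IsComplexGaussianVector μ X) (h0 : ∫ ω, X ω 0 * conj (X ω 0) ∂μ = 1)
    (h1 : ∫ ω, X ω 1 * conj (X ω 1) ∂μ = 1) {r : ℂ} (hr : ∫ ω, X ω 0 * conj (X ω 1) ∂μ = r)
    (hr1 : ‖r‖ ≤ 1) {l n : ℝ} (hl : 0 ≤ l) (hn : 0 ≤ n) :
    ∫ ω, Real.exp (-l * ‖X ω 0‖ ^ 2 - n * ‖X ω 1‖ ^ 2) ∂μ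
      = (1 + l + n + l * n * (1 - ‖r‖ ^ 2))⁻¹ := by
  obtain ⟨m, A, -, h2, -, h3⟩ := hX.exists_integral_eq
  rw [h3, dotProduct_star_self_eq] at h0 h1
  rw [h3] at hr
  rw [h2 (fun x => Real.exp (-l * ‖x 0‖ ^ 2 - n * ‖x 1‖ ^ 2)) (by fun_prop),
    integral_exp_neg_norm_sq_dotProduct (by exact_mod_cast h0) (by exact_mod_cast h1)
      (by rw [hr]; exact hr1) hl hn, hr]

end GaussianVector

/-! ### Explicit improper integrals and Frullani's formula. -/

section ImproperIntegrals

lemma lintegral_Ioi_of_hasDerivAt {F f : ℝ → ℝ} {L : ℝ} (hc : ContinuousWithinAt F (Ici 0) 0)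
    (hF : ∀ x ∈ Ioi (0 : ℝ), HasDerivAt F (f x) x) (hf : ∀ x ∈ Ioi (0 : ℝ), 0 ≤ f x)
    (hL : Tendsto F atTop (𝓝 L)) :
    ∫⁻ x in Ioi (0 : ℝ), ENNReal.ofReal (f x) = ENNReal.ofReal (L - F 0) := by
  rw [← integral_Ioi_of_hasDerivAt_of_nonneg hc hF hf hL,
    ofReal_integral_eq_lintegral_ofReal (integrableOn_Ioi_deriv_of_nonneg hc hF hf hL)]
  filter_upwards [ae_restrict_mem measurableSet_Ioi] with x hx using hf x hx

lemma lintegral_Ioi_exp_neg_mul {s : ℝ} (hs : 0 < s) :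
    ∫⁻ l in Ioi (0 : ℝ), ENNReal.ofReal (Real.exp (-l * s)) = ENNReal.ofReal s⁻¹ := by
  have hd : ∀ l : ℝ, HasDerivAt (fun l => -(s⁻¹ * Real.exp (-l * s))) (Real.exp (-l * s)) l := by
    intro l
    have := ((((hasDerivAt_id l).neg).mul_const s).exp.const_mul s⁻¹).neg
    refine HasDerivAt.congr_deriv this ?_
    simp only [Pi.neg_apply, id_eq]
    field_simp
  have ht : Tendsto (fun l => -(s⁻¹ * Real.exp (-l * s))) atTop (𝓝 0) := by
    have h1 : Tendsto (fun l : ℝ => -l * s) atTop atBot :=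
      (tendsto_neg_atTop_atBot).atBot_mul_const hs
    simpa using ((Real.tendsto_exp_atBot.comp h1).const_mul s⁻¹).neg
  rw [lintegral_Ioi_of_hasDerivAt (hd 0).continuousAt.continuousWithinAt (fun l _ => hd l)
    (fun l _ => (Real.exp_pos _).le) ht]
  simp

lemma lintegral_Ioi_inv_sq {A B : ℝ} (hA : 0 < A) (hB : 0 < B) :
    ∫⁻ l in Ioi (0 : ℝ), ENNReal.ofReal (((A + l * B) ^ 2)⁻¹) = ENNReal.ofReal ((A * B)⁻¹) := by
  have hd : ∀ l : ℝ, 0 ≤ l → HasDerivAt (fun l => -(B⁻¹ * (A + l * B)⁻¹))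
      (((A + l * B) ^ 2)⁻¹) l := by
    intro l hl
    have hne : A + l * B ≠ 0 := by positivity
    have := ((((((hasDerivAt_id l).mul_const B).const_add A)).inv hne).const_mul B⁻¹).neg
    refine HasDerivAt.congr_deriv this ?_
    simp only [id]
    field_simp
  have ht : Tendsto (fun l => -(B⁻¹ * (A + l * B)⁻¹)) atTop (𝓝 0) := by
    have h1 : Tendsto (fun l : ℝ => A + l * B) atTop atTop :=
      tendsto_atTop_add_const_left _ _ (tendsto_id.atTop_mul_const hB)
    simpa using ((tendsto_inv_atTop_zero.comp h1).const_mul B⁻¹).neg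
  rw [lintegral_Ioi_of_hasDerivAt (hd 0 le_rfl).continuousAt.continuousWithinAt
    (fun l hl => hd l (le_of_lt hl)) (fun l _ => by positivity) ht]
  congr 1
  simp

lemma lintegral_Ioi_inv_mul {w : ℝ} (hw : 0 < w) (hw1 : w < 1) :
    ∫⁻ n in Ioi (0 : ℝ), ENNReal.ofReal (((1 + n) * (1 + n * w))⁻¹)
      = ENNReal.ofReal (Real.log (1 / w) / (1 - w)) := by
  have h1w : 0 < 1 - w := by linarith
  have hd : ∀ n : ℝ, 0 ≤ n → HasDerivAt
      (fun n => (1 - w)⁻¹ * (Real.log (1 + n) - Real.log (1 + n * w)))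
      (((1 + n) * (1 + n * w))⁻¹) n := by
    intro n hn
    have h1 : 1 + n ≠ 0 := by positivity
    have h2 : 1 + n * w ≠ 0 := by positivity
    have := ((((hasDerivAt_id n).const_add 1).log h1).sub
      ((((hasDerivAt_id n).mul_const w).const_add 1).log h2)).const_mul (1 - w)⁻¹
    refine HasDerivAt.congr_deriv this ?_
    simp only [id]
    field_simp
    ring
  have ht : Tendsto (fun n => (1 - w)⁻¹ * (Real.log (1 + n) - Real.log (1 + n * w))) atTop
      (𝓝 (Real.log (1 / w) / (1 - w))) := by
    rw [div_eq_inv_mul]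
    refine Tendsto.const_mul _ ?_
    have h3 : Tendsto (fun n : ℝ => (1 + n) / (1 + n * w)) atTop (𝓝 (1 / w)) := by
      have h5 : Tendsto (fun n : ℝ => (n⁻¹ + 1) / (n⁻¹ + w)) atTop (𝓝 ((0 + 1) / (0 + w))) :=
        (tendsto_inv_atTop_zero.add_const 1).div (tendsto_inv_atTop_zero.add_const w)
          (by simpa using hw.ne')
      rw [zero_add, zero_add] at h5
      refine h5.congr' ?_
      filter_upwards [eventually_gt_atTop 0] with n hn
      field_simp
    have h4 := ((Real.continuousAt_log (by positivity : (1 / w) ≠ 0)).tendsto).comp h3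
    refine h4.congr' ?_
    filter_upwards [eventually_gt_atTop 0] with n hn
    simp only [Function.comp]
    rw [Real.log_div (by positivity) (by positivity)]
  rw [lintegral_Ioi_of_hasDerivAt (hd 0 le_rfl).continuousAt.continuousWithinAt
    (fun n hn => hd n (le_of_lt hn)) (fun n hn => ?_) ht]
  · simp
  · have : (0:ℝ) < n := hn
    positivity

lemma lintegral_Ioo_inv_sq {s p v : ℝ} (hs : 0 < s) (hp : 0 < p) (hv : 0 ≤ v) :
    ∫⁻ w in Ioo 0 v, ENNReal.ofReal (((s + p * w) ^ 2)⁻¹)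
      = ENNReal.ofReal ((s⁻¹ - (s + p * v)⁻¹) / p) := by
  have hd : ∀ w : ℝ, 0 ≤ w → HasDerivAt (fun w => -(p⁻¹ * (s + p * w)⁻¹))
      (((s + p * w) ^ 2)⁻¹) w := by
    intro w hw
    have hne : s + p * w ≠ 0 := by positivity
    have := ((((((hasDerivAt_id w).const_mul p).const_add s)).inv hne).const_mul p⁻¹).neg
    refine HasDerivAt.congr_deriv this ?_
    simp only [id]
    field_simp
  have hcont : ContinuousOn (fun w => ((s + p * w) ^ 2)⁻¹) (uIcc 0 v) := by
    refine ContinuousOn.inv₀ (by fun_prop) fun w hw => ?_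
    rw [uIcc_of_le hv] at hw
    have := hw.1
    positivity
  have hint := intervalIntegral.integral_eq_sub_of_hasDerivAt (a := 0) (b := v)
    (fun w hw => hd w (by rw [uIcc_of_le hv] at hw; exact hw.1)) hcont.intervalIntegrable
  rw [Measure.restrict_congr_set Ioo_ae_eq_Ioc, ← ofReal_integral_eq_lintegral_ofReal,
    ← intervalIntegral.integral_of_le hv, hint]
  · congr 1
    field_simp
    simp
  · have := hcont.intervalIntegrable (μ := volume)
    rwa [intervalIntegrable_iff_integrableOn_Ioc_of_le hv] at this
  · exact ae_of_all _ fun w => by positivity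

/-- Frullani: the quotient is the integral of e^{-ls} over s in [a, b], and Tonelli leaves the
integral of 1/s. -/
lemma lintegral_Ioi_exp_sub_exp_div {a b : ℝ} (ha : 0 < a) (hab : a ≤ b) :
    ∫⁻ l in Ioi (0 : ℝ), ENNReal.ofReal ((Real.exp (-l * a) - Real.exp (-l * b)) / l)
      = ENNReal.ofReal (Real.log b - Real.log a) := by
  have hb : 0 < b := ha.trans_le hab
  have h1 : ∀ l ∈ Ioi (0 : ℝ), ENNReal.ofReal ((Real.exp (-l * a) - Real.exp (-l * b)) / l)
      = ∫⁻ s in Ioc a b, ENNReal.ofReal (Real.exp (-l * s)) := by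
    intro l hl
    have hl' : l ≠ 0 := ne_of_gt hl
    have hd : ∀ s : ℝ, HasDerivAt (fun s => -(l⁻¹ * Real.exp (-l * s))) (Real.exp (-l * s)) s := by
      intro s
      have := (((hasDerivAt_id s).const_mul (-l)).exp.const_mul l⁻¹).neg
      refine HasDerivAt.congr_deriv this ?_
      simp only [id_eq]
      field_simp
    rw [← ofReal_integral_eq_lintegral_ofReal, ← intervalIntegral.integral_of_le hab,
      intervalIntegral.integral_eq_sub_of_hasDerivAt (fun s _ => hd s)]
    · congr 1
      field_simp
      ring
    · exact Continuous.intervalIntegrable (by fun_prop) _ _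
    · exact (Continuous.integrableOn_Icc (by fun_prop)).mono_set Ioc_subset_Icc_self
    · exact ae_of_all _ fun s => (Real.exp_pos _).le
  rw [setLIntegral_congr_fun measurableSet_Ioi h1, lintegral_lintegral_swap (by fun_prop)]
  have h2 : ∀ s ∈ Ioc a b, ∫⁻ l in Ioi (0 : ℝ), ENNReal.ofReal (Real.exp (-l * s))
      = ENNReal.ofReal s⁻¹ := fun s hs => lintegral_Ioi_exp_neg_mul (ha.trans hs.1)
  rw [setLIntegral_congr_fun measurableSet_Ioc h2, ← ofReal_integral_eq_lintegral_ofReal,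
    ← intervalIntegral.integral_of_le hab, integral_inv_of_pos ha hb,
    Real.log_div hb.ne' ha.ne']
  · have : IntervalIntegrable (fun s : ℝ => s⁻¹) volume a b := by
      refine ContinuousOn.intervalIntegrable (continuousOn_inv₀.mono fun s hs => ?_)
      rw [uIcc_of_le hab] at hs
      exact (ha.trans_le hs.1).ne'
    rwa [intervalIntegrable_iff_integrableOn_Ioc_of_le hab] at this
  · filter_upwards [ae_restrict_mem measurableSet_Ioc] with s hs
    exact inv_nonneg.2 (ha.le.trans hs.1.le)

/-- The square of a logarithm difference is a product of two Frullani integrals. The two differences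
of exponentials always have the same sign, so the integrand is nonnegative for either order of a and
b and expectations may later be exchanged freely. -/
lemma lintegral_lintegral_exp_sub_exp {a b : ℝ} (ha : 0 < a) (hb : 0 < b) :
    ∫⁻ l in Ioi (0 : ℝ), ∫⁻ n in Ioi (0 : ℝ), ENNReal.ofReal
      ((Real.exp (-l * a) - Real.exp (-l * b)) * (Real.exp (-n * a) - Real.exp (-n * b)) / (l * n))
      = ENNReal.ofReal ((Real.log a - Real.log b) ^ 2) := by
  wlog hab : a ≤ b generalizing a b
  · rw [← neg_sub (Real.log b), neg_sq, ← this hb ha (le_of_not_ge hab)]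
    refine lintegral_congr fun l => lintegral_congr fun n => ?_
    congr 2
    ring
  have h1 : ∀ l ∈ Ioi (0 : ℝ), 0 ≤ (Real.exp (-l * a) - Real.exp (-l * b)) / l := by
    intro l hl
    have hl' : 0 < l := hl
    refine div_nonneg (sub_nonneg.2 (Real.exp_le_exp.2 ?_)) hl'.le
    nlinarith
  have h2 : ∀ l ∈ Ioi (0 : ℝ), ∫⁻ n in Ioi (0 : ℝ), ENNReal.ofReal
      ((Real.exp (-l * a) - Real.exp (-l * b)) * (Real.exp (-n * a) - Real.exp (-n * b)) / (l * n))
      = ENNReal.ofReal ((Real.exp (-l * a) - Real.exp (-l * b)) / l)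
        * ENNReal.ofReal (Real.log b - Real.log a) := by
    intro l hl
    rw [← lintegral_Ioi_exp_sub_exp_div ha hab, ← lintegral_const_mul _ (by fun_prop)]
    refine lintegral_congr fun n => ?_
    rw [← ENNReal.ofReal_mul (h1 l hl), div_mul_div_comm]
  rw [setLIntegral_congr_fun measurableSet_Ioi h2, lintegral_mul_const _ (by fun_prop),
    lintegral_Ioi_exp_sub_exp_div ha hab, ← ENNReal.ofReal_mul]
  · congr 1
    ring
  · exact sub_nonneg.2 (Real.log_le_log ha hab)

/-- The singularity at 0 is logarithmic and the one at 1 is removable. The majorant 2 - 2 log w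
covers both, with the cases split at w = 1/2. -/
lemma integrableOn_log_inv_div : IntegrableOn (fun w : ℝ => Real.log (1 / w) / (1 - w)) (Ioo 0 1) := by
  have h1 : IntegrableOn (fun w : ℝ => 2 - 2 * Real.log w) (Ioo 0 1) := by
    have h : IntervalIntegrable (fun w : ℝ => 2 - 2 * Real.log w) volume 0 1 :=
      intervalIntegrable_const.sub (intervalIntegral.intervalIntegrable_log'.const_mul 2)
    rw [intervalIntegrable_iff_integrableOn_Ioc_of_le zero_le_one] at h
    exact h.mono_set Ioo_subset_Ioc_self
  refine h1.mono' (Measurable.aestronglyMeasurable (by fun_prop)) ?_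
  filter_upwards [ae_restrict_mem measurableSet_Ioo] with w hw
  have hw0 := hw.1
  have hw1 : 0 < 1 - w := by linarith [hw.2]
  have hlog : 0 ≤ -Real.log w := by linarith [Real.log_nonpos hw0.le hw.2.le]
  rw [one_div, Real.log_inv, Real.norm_of_nonneg (by positivity), div_le_iff₀ hw1]
  by_cases h : w ≤ 1 / 2
  · nlinarith
  · push Not at h
    have h3 : -Real.log w ≤ (1 - w) / w := by
      have := Real.log_le_sub_one_of_pos (inv_pos.2 hw0)
      rw [Real.log_inv] at this
      refine this.trans (le_of_eq ?_)
      field_simp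
    have h4 : (1 - w) / w ≤ 2 * (1 - w) := by
      rw [div_le_iff₀ hw0]
      nlinarith
    nlinarith

end ImproperIntegrals

/-! ### Logarithmic moments, approximate Dirac masses and negative moments of a Gaussian pair. -/

section GaussianPair

variable {Ω : Type*} [MeasurableSpace Ω] {μ : Measure Ω}

/-- `X, Y` have the joint Laplace transform of the squared moduli of two standard complex
Gaussians with squared correlation `1 - v`. -/
structure IsGaussianPair (μ : Measure Ω) (X Y : Ω → ℂ) (v : ℝ) : Prop where
  measurable_fst : Measurable X
  measurable_snd : Measurable Y
  nonneg : 0 ≤ v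
  le_one : v ≤ 1
  laplace : ∀ l n : ℝ, 0 ≤ l → 0 ≤ n →
    ∫ ω, Real.exp (-l * ‖X ω‖ ^ 2 - n * ‖Y ω‖ ^ 2) ∂μ = (1 + l + n + l * n * v)⁻¹

lemma IsGaussianPair.symm {X Y : Ω → ℂ} {v : ℝ} (h : IsGaussianPair μ X Y v) :
    IsGaussianPair μ Y X v where
  measurable_fst := h.measurable_snd
  measurable_snd := h.measurable_fst
  nonneg := h.nonneg
  le_one := h.le_one
  laplace l n hl hn := by
    have := h.laplace n l hn hl
    simp_rw [sub_eq_add_neg, ← neg_mul] at this ⊢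
    simp_rw [add_comm (-l * _)]
    rw [this]
    congr 1
    ring

lemma IsGaussianPair.laplace_fst {X Y : Ω → ℂ} {v : ℝ} (h : IsGaussianPair μ X Y v) {l : ℝ}
    (hl : 0 ≤ l) : ∫ ω, Real.exp (-l * ‖X ω‖ ^ 2) ∂μ = (1 + l)⁻¹ := by
  simpa using h.laplace l 0 hl le_rfl

variable [IsProbabilityMeasure μ]

lemma integrable_exp_neg {X Y : Ω → ℂ} (hX : Measurable X) (hY : Measurable Y) {l n : ℝ}
    (hl : 0 ≤ l) (hn : 0 ≤ n) :
    Integrable (fun ω => Real.exp (-l * ‖X ω‖ ^ 2 - n * ‖Y ω‖ ^ 2)) μ := by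
  refine Integrable.of_bound (C := 1) (by fun_prop) (ae_of_all _ fun ω => ?_)
  rw [Real.norm_of_nonneg (Real.exp_pos _).le, Real.exp_le_one_iff]
  nlinarith [mul_nonneg hl (sq_nonneg ‖X ω‖), mul_nonneg hn (sq_nonneg ‖Y ω‖)]

/-- The indicator of X = 0 is at most e^{-l|X|²}, whose mean 1/(1+l) vanishes as l grows. -/
lemma IsGaussianPair.ae_ne_zero {X Y : Ω → ℂ} {v : ℝ} (h : IsGaussianPair μ X Y v) :
    ∀ᵐ ω ∂μ, X ω ≠ 0 := by
  have hX := h.measurable_fst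
  have hm : MeasurableSet {ω | X ω = 0} := hX (measurableSet_singleton 0)
  have hle : ∀ l : ℝ, 0 ≤ l → μ.real {ω | X ω = 0} ≤ (1 + l)⁻¹ := by
    intro l hl
    rw [← h.laplace_fst hl, ← integral_indicator_one hm]
    have hint := integrable_exp_neg (μ := μ) hX hX hl le_rfl
    simp only [zero_mul, sub_zero] at hint
    refine integral_mono ((integrable_const 1).indicator hm) hint fun ω => ?_
    by_cases hω : X ω = 0
    · simp [indicator, hω]
    · simp only [indicator, mem_ofPred_eq, hω, if_false]
      positivity
  have h0 : μ.real {ω | X ω = 0} = 0 := by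
    have ht : Tendsto (fun l : ℝ => (1 + l)⁻¹) atTop (𝓝 0) :=
      tendsto_inv_atTop_zero.comp (tendsto_atTop_add_const_left _ _ tendsto_id)
    refine le_antisymm (ge_of_tendsto ht ?_) measureReal_nonneg
    filter_upwards [eventually_ge_atTop 0] with l hl using hle l hl
  rw [measureReal_eq_zero_iff] at h0
  rw [ae_iff]
  simpa using h0

/-- After Frullani the expectation is a second difference of Laplace transforms, 2/(ln) · (1/(1+l+n)
- 1/(1+l+n+lnv)), which equals twice the integral of 1/(1+l+n+lnw)² over w in (0, v). Integrating in
l gives 1/((1+n)(1+nw)), and then integrating in n gives log(1/w)/(1-w). Everything is nonnegative,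
so no integrability is needed in advance. -/
theorem IsGaussianPair.lintegral_log_sq {X Y : Ω → ℂ} {v : ℝ} (h : IsGaussianPair μ X Y v) :
    ∫⁻ ω, ENNReal.ofReal ((Real.log (‖X ω‖ ^ 2) - Real.log (‖Y ω‖ ^ 2)) ^ 2) ∂μ
      = 2 * ∫⁻ w in Ioo 0 v, ENNReal.ofReal (Real.log (1 / w) / (1 - w)) := by
  have hX := h.measurable_fst
  have hY := h.measurable_snd
  have hv := h.nonneg
  have e1 : ∫⁻ ω, ENNReal.ofReal ((Real.log (‖X ω‖ ^ 2) - Real.log (‖Y ω‖ ^ 2)) ^ 2) ∂μ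
      = ∫⁻ ω, (∫⁻ l in Ioi (0 : ℝ), ∫⁻ n in Ioi (0 : ℝ), ENNReal.ofReal
        ((Real.exp (-l * ‖X ω‖ ^ 2) - Real.exp (-l * ‖Y ω‖ ^ 2)) *
          (Real.exp (-n * ‖X ω‖ ^ 2) - Real.exp (-n * ‖Y ω‖ ^ 2)) / (l * n))) ∂μ := by
    refine lintegral_congr_ae ?_
    filter_upwards [h.ae_ne_zero, h.symm.ae_ne_zero] with ω h1 h2
    rw [lintegral_lintegral_exp_sub_exp (by positivity) (by positivity)]
  have e2 : ∀ l ∈ Ioi (0 : ℝ), ∀ n ∈ Ioi (0 : ℝ), ∫⁻ ω, ENNReal.ofReal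
        ((Real.exp (-l * ‖X ω‖ ^ 2) - Real.exp (-l * ‖Y ω‖ ^ 2)) *
          (Real.exp (-n * ‖X ω‖ ^ 2) - Real.exp (-n * ‖Y ω‖ ^ 2)) / (l * n)) ∂μ
      = 2 * ∫⁻ w in Ioo 0 v, ENNReal.ofReal (((1 + n + l * (1 + n * w)) ^ 2)⁻¹) := by
    intro l hl n hn
    have hl0 : 0 < l := hl
    have hn0 : 0 < n := hn
    have hexp : ∀ ω, (Real.exp (-l * ‖X ω‖ ^ 2) - Real.exp (-l * ‖Y ω‖ ^ 2)) *
          (Real.exp (-n * ‖X ω‖ ^ 2) - Real.exp (-n * ‖Y ω‖ ^ 2)) / (l * n)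
        = (Real.exp (-(l + n) * ‖X ω‖ ^ 2 - 0 * ‖Y ω‖ ^ 2)
          - Real.exp (-l * ‖X ω‖ ^ 2 - n * ‖Y ω‖ ^ 2)
          - Real.exp (-n * ‖X ω‖ ^ 2 - l * ‖Y ω‖ ^ 2)
          + Real.exp (-0 * ‖X ω‖ ^ 2 - (l + n) * ‖Y ω‖ ^ 2)) / (l * n) := by
      intro ω
      congr 1
      rw [sub_mul, mul_sub, mul_sub, ← Real.exp_add, ← Real.exp_add, ← Real.exp_add,
        ← Real.exp_add]
      ring_nf
    have i1 := integrable_exp_neg (μ := μ) hX hY (add_pos hl0 hn0).le le_rfl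
    have i2 := integrable_exp_neg (μ := μ) hX hY hl0.le hn0.le
    have i3 := integrable_exp_neg (μ := μ) hX hY hn0.le hl0.le
    have i4 := integrable_exp_neg (μ := μ) hX hY le_rfl (add_pos hl0 hn0).le
    have i12 : Integrable (fun ω => Real.exp (-(l + n) * ‖X ω‖ ^ 2 - 0 * ‖Y ω‖ ^ 2)
          - Real.exp (-l * ‖X ω‖ ^ 2 - n * ‖Y ω‖ ^ 2)) μ := i1.sub i2
    have i123 : Integrable (fun ω => Real.exp (-(l + n) * ‖X ω‖ ^ 2 - 0 * ‖Y ω‖ ^ 2)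
          - Real.exp (-l * ‖X ω‖ ^ 2 - n * ‖Y ω‖ ^ 2)
          - Real.exp (-n * ‖X ω‖ ^ 2 - l * ‖Y ω‖ ^ 2)) μ := i12.sub i3
    have hval : ∫ ω, (Real.exp (-l * ‖X ω‖ ^ 2) - Real.exp (-l * ‖Y ω‖ ^ 2)) *
          (Real.exp (-n * ‖X ω‖ ^ 2) - Real.exp (-n * ‖Y ω‖ ^ 2)) / (l * n) ∂μ
        = 2 * (((1 + l + n)⁻¹ - (1 + l + n + l * n * v)⁻¹) / (l * n)) := by
      simp_rw [hexp]
      rw [integral_div, integral_add i123 i4, integral_sub i12 i3,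
        integral_sub i1 i2, h.laplace _ _ (add_pos hl0 hn0).le le_rfl,
        h.laplace _ _ hl0.le hn0.le, h.laplace _ _ hn0.le hl0.le,
        h.laplace _ _ le_rfl (add_pos hl0 hn0).le]
      ring
    have h2 : ENNReal.ofReal 2 = 2 := by simp
    rw [← ofReal_integral_eq_lintegral_ofReal, hval, ENNReal.ofReal_mul zero_le_two, h2,
      ← lintegral_Ioo_inv_sq (by positivity) (by positivity) hv]
    · congr 1
      refine lintegral_congr fun w => ?_
      congr 3
      ring
    · simp_rw [hexp]
      exact (i123.add i4).div_const _
    · refine ae_of_all _ fun ω => ?_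
      refine div_nonneg ?_ (by positivity)
      rcases le_total (‖X ω‖ ^ 2) (‖Y ω‖ ^ 2) with hle | hle
      · exact mul_nonneg (sub_nonneg.2 (Real.exp_le_exp.2 (by nlinarith)))
          (sub_nonneg.2 (Real.exp_le_exp.2 (by nlinarith)))
      · exact mul_nonneg_of_nonpos_of_nonpos (sub_nonpos.2 (Real.exp_le_exp.2 (by nlinarith)))
          (sub_nonpos.2 (Real.exp_le_exp.2 (by nlinarith)))
  have e3 : ∀ w ∈ Ioo 0 v, ∫⁻ n in Ioi (0 : ℝ), ∫⁻ l in Ioi (0 : ℝ),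
      ENNReal.ofReal (((1 + n + l * (1 + n * w)) ^ 2)⁻¹)
      = ENNReal.ofReal (Real.log (1 / w) / (1 - w)) := by
    intro w hw
    rw [← lintegral_Ioi_inv_mul hw.1 (hw.2.trans_le h.le_one)]
    refine setLIntegral_congr_fun measurableSet_Ioi fun n hn => ?_
    have hn0 : 0 < n := hn
    have hw0 : 0 < w := hw.1
    exact lintegral_Ioi_inv_sq (by positivity) (by positivity)
  rw [e1, lintegral_lintegral_swap]
  · have e4 : ∀ l ∈ Ioi (0 : ℝ), ∫⁻ ω, (∫⁻ n in Ioi (0 : ℝ), ENNReal.ofReal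
        ((Real.exp (-l * ‖X ω‖ ^ 2) - Real.exp (-l * ‖Y ω‖ ^ 2)) *
          (Real.exp (-n * ‖X ω‖ ^ 2) - Real.exp (-n * ‖Y ω‖ ^ 2)) / (l * n))) ∂μ
        = 2 * ∫⁻ w in Ioo 0 v, ∫⁻ n in Ioi (0 : ℝ),
          ENNReal.ofReal (((1 + n + l * (1 + n * w)) ^ 2)⁻¹) := by
      intro l hl
      rw [lintegral_lintegral_swap (Measurable.aemeasurable (by fun_prop)),
        setLIntegral_congr_fun measurableSet_Ioi (fun n hn => e2 l hl n hn),
        lintegral_const_mul _ (Measurable.lintegral_prod_right (by fun_prop)),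
        lintegral_lintegral_swap (Measurable.aemeasurable (by fun_prop))]
    rw [setLIntegral_congr_fun measurableSet_Ioi e4,
      lintegral_const_mul _ (Measurable.lintegral_prod_right
        (Measurable.lintegral_prod_right (by fun_prop))),
      lintegral_lintegral_swap (Measurable.aemeasurable
        (Measurable.lintegral_prod_right (by fun_prop)))]
    congr 1
    refine setLIntegral_congr_fun measurableSet_Ioo fun w hw => ?_
    rw [lintegral_lintegral_swap (Measurable.aemeasurable (by fun_prop))]
    exact e3 w hw
  · refine Measurable.aemeasurable (Measurable.lintegral_prod_right ?_)
    fun_prop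

lemma intervalIntegrable_log_div {u : ℝ} (hu0 : 0 ≤ u) (hu1 : u ≤ 1) :
    IntervalIntegrable (fun y : ℝ => Real.log (1 / (1 - y)) / y) volume u 1 := by
  have h : IntervalIntegrable (fun w : ℝ => Real.log (1 / w) / (1 - w)) volume 0 1 := by
    rw [intervalIntegrable_iff_integrableOn_Ioo_of_le zero_le_one]
    exact integrableOn_log_inv_div
  have h1 := (h.comp_sub_left 1).symm
  simp only [sub_zero, sub_self, sub_sub_cancel] at h1
  refine h1.mono_set ?_
  rw [uIcc_of_le hu1, uIcc_of_le zero_le_one]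
  exact Icc_subset_Icc_left hu0

/-- Substitute y = 1 - w. The factor 1/2 is 2/4, since log|X|² = 2 log|X| contributes a square of 2.
-/
theorem IsGaussianPair.integral_log_sq {X Y : Ω → ℂ} {v : ℝ} (h : IsGaussianPair μ X Y v) :
    Integrable (fun ω => (Real.log ‖X ω‖ - Real.log ‖Y ω‖) ^ 2) μ ∧
    ∫ ω, (Real.log ‖X ω‖ - Real.log ‖Y ω‖) ^ 2 ∂μ
      = 1 / 2 * ∫ y in (1 - v)..1, Real.log (1 / (1 - y)) / y := by
  have hX := h.measurable_fst
  have hY := h.measurable_snd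
  have hI : IntegrableOn (fun w : ℝ => Real.log (1 / w) / (1 - w)) (Ioo 0 v) :=
    integrableOn_log_inv_div.mono_set (Ioo_subset_Ioo_right h.le_one)
  have hnn : 0 ≤ᵐ[volume.restrict (Ioo 0 v)] fun w : ℝ => Real.log (1 / w) / (1 - w) := by
    filter_upwards [ae_restrict_mem measurableSet_Ioo] with w hw
    have hw1 : w < 1 := hw.2.trans_le h.le_one
    refine div_nonneg (Real.log_nonneg ?_) (by linarith)
    rw [le_div_iff₀ hw.1]
    linarith
  have key := h.lintegral_log_sq
  rw [← ofReal_integral_eq_lintegral_ofReal hI hnn] at key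
  have hsub : ∫ y in (1 - v)..1, Real.log (1 / (1 - y)) / y
      = ∫ w in Ioo 0 v, Real.log (1 / w) / (1 - w) := by
    rw [← integral_Ioc_eq_integral_Ioo, ← intervalIntegral.integral_of_le h.nonneg]
    have := intervalIntegral.integral_comp_sub_left (a := 1 - v) (b := 1)
      (fun w : ℝ => Real.log (1 / w) / (1 - w)) 1
    simpa using this
  have hsq : ∀ ω, (Real.log (‖X ω‖ ^ 2) - Real.log (‖Y ω‖ ^ 2)) ^ 2
      = 4 * (Real.log ‖X ω‖ - Real.log ‖Y ω‖) ^ 2 := by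
    intro ω
    rw [Real.log_pow, Real.log_pow]
    push_cast
    ring
  simp_rw [hsq] at key
  have hint : Integrable (fun ω => 4 * (Real.log ‖X ω‖ - Real.log ‖Y ω‖) ^ 2) μ := by
    refine ⟨Measurable.aestronglyMeasurable (by fun_prop), ?_⟩
    rw [hasFiniteIntegral_iff_ofReal (ae_of_all _ fun ω => by positivity), key]
    exact ENNReal.mul_lt_top (by simp) ENNReal.ofReal_lt_top
  have hint' : Integrable (fun ω => (Real.log ‖X ω‖ - Real.log ‖Y ω‖) ^ 2) μ := by
    refine (hint.const_mul (1 / 4)).congr (ae_of_all _ fun ω => ?_)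
    simp only
    ring
  refine ⟨hint', ?_⟩
  rw [← ofReal_integral_eq_lintegral_ofReal hint (ae_of_all _ fun ω => by positivity),
    integral_const_mul] at key
  have h2 : (2 : ℝ≥0∞) = ENNReal.ofReal 2 := by simp
  rw [h2, ← ENNReal.ofReal_mul zero_le_two, ENNReal.ofReal_eq_ofReal_iff
    (by positivity) (mul_nonneg zero_le_two (integral_nonneg_of_ae hnn))] at key
  rw [hsub]
  linarith

/-- An approximation of `π` times the Dirac mass at the origin of `ℂ`. -/
noncomputable def approxDirac (ε : ℝ) (z : ℂ) : ℝ := ε / (ε + ‖z‖ ^ 2) ^ 2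

lemma approxDirac_nonneg {ε : ℝ} (hε : 0 ≤ ε) (z : ℂ) : 0 ≤ approxDirac ε z := by
  unfold approxDirac
  positivity

/-- A Gamma integral with Γ(2) = 1 writes the approximate Dirac mass as a mixture of Gaussians in
|z|. Its expectations are then determined by the Laplace transform. -/
lemma approxDirac_eq_integral {ε : ℝ} (hε : 0 < ε) (z : ℂ) :
    approxDirac ε z
      = ∫ a in Ioi (0 : ℝ), a * Real.exp (-a) / ε * Real.exp (-(a / ε) * ‖z‖ ^ 2) := by
  have h := Real.integral_rpow_mul_exp_neg_mul_Ioi (a := 2) (r := 1 + ‖z‖ ^ 2 / ε) (by norm_num)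
    (by positivity)
  have h2 : Real.Gamma 2 = 1 := Real.Gamma_two
  rw [h2, mul_one] at h
  have h3 : ∀ a : ℝ, a * Real.exp (-a) / ε * Real.exp (-(a / ε) * ‖z‖ ^ 2)
      = ε⁻¹ * (a ^ ((2 : ℝ) - 1) * Real.exp (-((1 + ‖z‖ ^ 2 / ε) * a))) := by
    intro a
    have : (2 : ℝ) - 1 = 1 := by norm_num
    rw [this, Real.rpow_one, div_mul_eq_mul_div, mul_assoc, ← Real.exp_add, div_eq_inv_mul]
    congr 3
    ring
  simp_rw [h3]
  rw [integral_const_mul, h, approxDirac, Real.rpow_two]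
  field_simp

lemma integrableOn_mul_exp_neg : IntegrableOn (fun a : ℝ => a * Real.exp (-a)) (Ioi 0) := by
  have := Real.GammaIntegral_convergent (s := 2) (by norm_num)
  refine this.congr_fun (fun a _ => ?_) measurableSet_Ioi
  have h : (2 : ℝ) - 1 = 1 := by norm_num
  simp only [h, Real.rpow_one]
  ring

/-- The Laplace transform is evaluated at l = a/ε, n = b/δ, and the prefactor 1/(εδ) is absorbed
into the denominator. The result stays regular as ε and δ tend to 0. -/
theorem IsGaussianPair.integral_approxDirac_mul {X Y : Ω → ℂ} {v : ℝ}
    (h : IsGaussianPair μ X Y v) {ε δ : ℝ} (hε : 0 < ε) (hδ : 0 < δ) :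
    ∫ ω, approxDirac ε (X ω) * approxDirac δ (Y ω) ∂μ
      = ∫ p, p.1 * Real.exp (-p.1) * (p.2 * Real.exp (-p.2)) *
          (ε * δ + p.1 * δ + p.2 * ε + p.1 * p.2 * v)⁻¹
          ∂((volume.restrict (Ioi (0 : ℝ))).prod (volume.restrict (Ioi (0 : ℝ)))) := by
  have hX := h.measurable_fst
  have hY := h.measurable_snd
  set P := (volume.restrict (Ioi (0 : ℝ))).prod (volume.restrict (Ioi (0 : ℝ))) with hP
  have hmem : ∀ᵐ p ∂P, 0 < p.1 ∧ 0 < p.2 := by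
    rw [hP, Measure.prod_restrict]
    filter_upwards [ae_restrict_mem (measurableSet_Ioi.prod measurableSet_Ioi)] with p hp
    exact hp
  have e1 : ∀ ω, approxDirac ε (X ω) * approxDirac δ (Y ω)
      = ∫ p, (p.1 * Real.exp (-p.1) / ε * Real.exp (-(p.1 / ε) * ‖X ω‖ ^ 2)) *
          (p.2 * Real.exp (-p.2) / δ * Real.exp (-(p.2 / δ) * ‖Y ω‖ ^ 2)) ∂P := by
    intro ω
    rw [approxDirac_eq_integral hε, approxDirac_eq_integral hδ, ← integral_prod_mul]
  simp_rw [e1]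
  have hdom : Integrable (fun q : Ω × (ℝ × ℝ) =>
      (q.2.1 * Real.exp (-q.2.1) / ε) * (q.2.2 * Real.exp (-q.2.2) / δ)) (μ.prod P) := by
    have h1 : Integrable (fun p : ℝ × ℝ =>
        (p.1 * Real.exp (-p.1) / ε) * (p.2 * Real.exp (-p.2) / δ)) P :=
      Integrable.mul_prod (integrableOn_mul_exp_neg.div_const ε)
        (integrableOn_mul_exp_neg.div_const δ)
    exact h1.comp_snd μ
  have hmem2 : ∀ᵐ q ∂(μ.prod P), 0 < q.2.1 ∧ 0 < q.2.2 :=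
    Measure.quasiMeasurePreserving_snd.ae hmem
  rw [integral_integral_swap]
  · refine integral_congr_ae ?_
    filter_upwards [hmem] with p hp
    have e2 : ∀ ω, (p.1 * Real.exp (-p.1) / ε * Real.exp (-(p.1 / ε) * ‖X ω‖ ^ 2)) *
          (p.2 * Real.exp (-p.2) / δ * Real.exp (-(p.2 / δ) * ‖Y ω‖ ^ 2))
        = (p.1 * Real.exp (-p.1) / ε) * (p.2 * Real.exp (-p.2) / δ) *
          Real.exp (-(p.1 / ε) * ‖X ω‖ ^ 2 - p.2 / δ * ‖Y ω‖ ^ 2) := by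
      intro ω
      rw [sub_eq_add_neg, Real.exp_add, ← neg_mul]
      ring
    simp_rw [e2]
    rw [integral_const_mul, h.laplace _ _ (div_nonneg hp.1.le hε.le) (div_nonneg hp.2.le hδ.le)]
    have hp1 := hp.1
    have hp2 := hp.2
    have hv := h.nonneg
    field_simp
  · refine hdom.mono' (Measurable.aestronglyMeasurable ?_) ?_
    · fun_prop
    · filter_upwards [hmem2] with q hq
      have hq1 := hq.1
      have hq2 := hq.2
      simp only [Function.uncurry]
      rw [Real.norm_of_nonneg (by positivity)]
      gcongr
      · refine mul_le_of_le_one_right (by positivity) ?_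
        rw [Real.exp_le_one_iff]
        have : 0 ≤ q.2.1 / ε * ‖X q.1‖ ^ 2 := by positivity
        linarith
      · refine mul_le_of_le_one_right (by positivity) ?_
        rw [Real.exp_le_one_iff]
        have : 0 ≤ q.2.2 / δ * ‖Y q.1‖ ^ 2 := by positivity
        linarith

lemma integral_exp_neg_mul_exp_neg (v : ℝ) :
    ∫ p, Real.exp (-p.1) * Real.exp (-p.2) * v⁻¹
      ∂((volume.restrict (Ioi (0 : ℝ))).prod (volume.restrict (Ioi (0 : ℝ)))) = v⁻¹ := by
  rw [integral_mul_const, integral_prod_mul (fun x : ℝ => Real.exp (-x)) fun x => Real.exp (-x),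
    integral_exp_neg_Ioi_zero]
  simp

/-- Drop every term of the denominator but abv; then a and b cancel. This majorant, free of ε and δ,
yields both the uniform bound and the limit 1/v. -/
lemma approxDirac_integrand_le {v ε δ : ℝ} (hv : 0 < v) (hε : 0 < ε) (hδ : 0 < δ) {a b : ℝ}
    (ha : 0 < a) (hb : 0 < b) :
    a * Real.exp (-a) * (b * Real.exp (-b)) * (ε * δ + a * δ + b * ε + a * b * v)⁻¹
      ≤ Real.exp (-a) * Real.exp (-b) * v⁻¹ := by
  have : (ε * δ + a * δ + b * ε + a * b * v)⁻¹ ≤ (a * b * v)⁻¹ := by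
    apply inv_anti₀ (by positivity)
    have : 0 ≤ ε * δ + a * δ + b * ε := by positivity
    linarith
  calc _ ≤ a * Real.exp (-a) * (b * Real.exp (-b)) * (a * b * v)⁻¹ := by gcongr
    _ = _ := by field_simp

lemma integrable_exp_neg_mul_exp_neg (v : ℝ) :
    Integrable (fun p : ℝ × ℝ => Real.exp (-p.1) * Real.exp (-p.2) * v⁻¹)
      ((volume.restrict (Ioi (0 : ℝ))).prod (volume.restrict (Ioi (0 : ℝ)))) := by
  refine Integrable.mul_const (Integrable.mul_prod (f := fun x : ℝ => Real.exp (-x))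
    (g := fun x : ℝ => Real.exp (-x)) ?_ ?_) _
  all_goals exact integrableOn_exp_neg_Ioi 0

lemma ae_pos_prod_restrict_Ioi :
    ∀ᵐ p ∂((volume.restrict (Ioi (0 : ℝ))).prod (volume.restrict (Ioi (0 : ℝ)))),
      0 < p.1 ∧ 0 < p.2 := by
  rw [Measure.prod_restrict]
  filter_upwards [ae_restrict_mem (measurableSet_Ioi.prod measurableSet_Ioi)] with p hp
  exact hp

theorem IsGaussianPair.integral_approxDirac_mul_le {X Y : Ω → ℂ} {v : ℝ}
    (h : IsGaussianPair μ X Y v) (hv : 0 < v) {ε δ : ℝ} (hε : 0 < ε) (hδ : 0 < δ) :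
    ∫ ω, approxDirac ε (X ω) * approxDirac δ (Y ω) ∂μ ≤ v⁻¹ := by
  rw [h.integral_approxDirac_mul hε hδ, ← integral_exp_neg_mul_exp_neg v]
  refine integral_mono_of_nonneg ?_ (integrable_exp_neg_mul_exp_neg v) ?_
  · filter_upwards [ae_pos_prod_restrict_Ioi] with p hp
    have hp1 := hp.1
    have hp2 := hp.2
    simp only [Pi.zero_apply]
    positivity
  · filter_upwards [ae_pos_prod_restrict_Ioi] with p hp
    exact approxDirac_integrand_le hv hε hδ hp.1 hp.2

theorem IsGaussianPair.tendsto_integral_approxDirac_mul {X Y : Ω → ℂ} {v : ℝ}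
    (h : IsGaussianPair μ X Y v) (hv : 0 < v) :
    Tendsto (fun e : ℝ × ℝ => ∫ ω, approxDirac e.1 (X ω) * approxDirac e.2 (Y ω) ∂μ)
      (𝓝[>] 0 ×ˢ 𝓝[>] 0) (𝓝 v⁻¹) := by
  have hpos : ∀ᶠ e : ℝ × ℝ in 𝓝[>] 0 ×ˢ 𝓝[>] 0, 0 < e.1 ∧ 0 < e.2 :=
    (eventually_mem_nhdsWithin).prod_mk eventually_mem_nhdsWithin
  have hlim : Tendsto (fun e : ℝ × ℝ => ∫ p, p.1 * Real.exp (-p.1) * (p.2 * Real.exp (-p.2)) *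
      (e.1 * e.2 + p.1 * e.2 + p.2 * e.1 + p.1 * p.2 * v)⁻¹
      ∂((volume.restrict (Ioi (0 : ℝ))).prod (volume.restrict (Ioi (0 : ℝ)))))
      (𝓝[>] 0 ×ˢ 𝓝[>] 0) (𝓝 (∫ p, Real.exp (-p.1) * Real.exp (-p.2) * v⁻¹
      ∂((volume.restrict (Ioi (0 : ℝ))).prod (volume.restrict (Ioi (0 : ℝ)))))) := by
    refine tendsto_integral_filter_of_dominated_convergence
      (fun p => Real.exp (-p.1) * Real.exp (-p.2) * v⁻¹) ?_ ?_
      (integrable_exp_neg_mul_exp_neg v) ?_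
    · exact Eventually.of_forall fun e => Measurable.aestronglyMeasurable (by fun_prop)
    · filter_upwards [hpos] with e he
      filter_upwards [ae_pos_prod_restrict_Ioi] with p hp
      have hp1 := hp.1
      have hp2 := hp.2
      have he1 := he.1
      have he2 := he.2
      rw [Real.norm_of_nonneg (by positivity)]
      exact approxDirac_integrand_le hv he.1 he.2 hp.1 hp.2
    · filter_upwards [ae_pos_prod_restrict_Ioi] with p hp
      have hp1 := hp.1
      have hp2 := hp.2
      have hfst : Tendsto (fun e : ℝ × ℝ => e.1) (𝓝[>] 0 ×ˢ 𝓝[>] 0) (𝓝 0) :=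
        (tendsto_fst).mono_right nhdsWithin_le_nhds
      have hsnd : Tendsto (fun e : ℝ × ℝ => e.2) (𝓝[>] 0 ×ˢ 𝓝[>] 0) (𝓝 0) :=
        (tendsto_snd).mono_right nhdsWithin_le_nhds
      have h1 : Tendsto (fun e : ℝ × ℝ => e.1 * e.2 + p.1 * e.2 + p.2 * e.1 + p.1 * p.2 * v)
          (𝓝[>] 0 ×ˢ 𝓝[>] 0) (𝓝 (0 * 0 + p.1 * 0 + p.2 * 0 + p.1 * p.2 * v)) :=
        (((hfst.mul hsnd).add (hsnd.const_mul _)).add (hfst.const_mul _)).add_const _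
      have h2 := (h1.inv₀ (by simp; exact ⟨⟨hp1.ne', hp2.ne'⟩, hv.ne'⟩)).const_mul
        (p.1 * Real.exp (-p.1) * (p.2 * Real.exp (-p.2)))
      convert h2 using 2
      simp
      field_simp
  rw [integral_exp_neg_mul_exp_neg] at hlim
  refine hlim.congr' ?_
  filter_upwards [hpos] with e he
  rw [h.integral_approxDirac_mul he.1 he.2]

/-- A bound for the negative moment of order `4 / 3`, uniform over Gaussian pairs. -/
theorem exists_lintegral_rpow_neg_le : ∃ K : ℝ≥0∞, K ≠ ⊤ ∧
    ∀ {Ω : Type _} [MeasurableSpace Ω] (μ : Measure Ω) [IsProbabilityMeasure μ] (X Y : Ω → ℂ)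
      (v : ℝ), IsGaussianPair μ X Y v →
      ∫⁻ ω, ENNReal.ofReal ((‖X ω‖ ^ 2) ^ (-(2 / 3) : ℝ)) ∂μ ≤ K := by
  set c := (Real.Gamma (2 / 3))⁻¹ with hc
  have hG : 0 < Real.Gamma (2 / 3) := Real.Gamma_pos_of_pos (by norm_num)
  -- The power q^{-2/3} is a Gamma integral of l^{-1/3} e^{-lq}, and the expectation replaces the
  -- exponential by 1/(1+l). The result converges at 0 like l^{-1/3} and at infinity like l^{-4/3}.
  refine ⟨∫⁻ l in Ioi (0 : ℝ), ENNReal.ofReal (c * (l ^ (-(1 / 3) : ℝ) * (1 + l)⁻¹)), ?_, ?_⟩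
  · refine ne_of_lt (Integrable.lintegral_lt_top (Integrable.const_mul ?_ c))
    change IntegrableOn _ _ _
    rw [← Ioc_union_Ioi_eq_Ioi zero_le_one]
    refine IntegrableOn.union ?_ ?_
    · have h1 : IntervalIntegrable (fun l : ℝ => l ^ (-(1 / 3) : ℝ)) volume 0 1 :=
        intervalIntegral.intervalIntegrable_rpow' (by norm_num)
      rw [intervalIntegrable_iff_integrableOn_Ioc_of_le zero_le_one] at h1
      refine h1.mono' (Measurable.aestronglyMeasurable (by fun_prop)) ?_
      filter_upwards [ae_restrict_mem measurableSet_Ioc] with l hl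
      have hl0 := hl.1
      rw [Real.norm_of_nonneg (by positivity)]
      exact mul_le_of_le_one_right (by positivity) (inv_le_one_of_one_le₀ (by linarith))
    · have h1 : IntegrableOn (fun l : ℝ => l ^ (-(4 / 3) : ℝ)) (Ioi 1) :=
        integrableOn_Ioi_rpow_of_lt (by norm_num) one_pos
      refine h1.mono' (Measurable.aestronglyMeasurable (by fun_prop)) ?_
      filter_upwards [ae_restrict_mem measurableSet_Ioi] with l hl
      have hl0 : 0 < l := one_pos.trans hl
      rw [Real.norm_of_nonneg (by positivity)]
      have : l ^ (-(4 / 3) : ℝ) = l ^ (-(1 / 3) : ℝ) * l⁻¹ := by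
        rw [← Real.rpow_neg_one l, ← Real.rpow_add hl0]
        norm_num
      rw [this]
      gcongr
      linarith
  · intro Ω _ μ _ X Y v h
    have hX := h.measurable_fst
    have e1 : ∀ᵐ ω ∂μ, ENNReal.ofReal ((‖X ω‖ ^ 2) ^ (-(2 / 3) : ℝ))
        = ∫⁻ l in Ioi (0 : ℝ),
          ENNReal.ofReal (c * (l ^ (-(1 / 3) : ℝ) * Real.exp (-l * ‖X ω‖ ^ 2))) := by
      filter_upwards [h.ae_ne_zero] with ω hω
      have hq : 0 < ‖X ω‖ ^ 2 := by positivity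
      have h1 := Real.integral_rpow_mul_exp_neg_mul_Ioi (a := 2 / 3) (by norm_num) hq
      have h2 : (2 / 3 : ℝ) - 1 = -(1 / 3) := by norm_num
      rw [h2] at h1
      have hval : 0 < (1 / ‖X ω‖ ^ 2) ^ (2 / 3 : ℝ) * Real.Gamma (2 / 3) := by positivity
      have hint : IntegrableOn (fun l : ℝ => l ^ (-(1 / 3) : ℝ) *
          Real.exp (-(‖X ω‖ ^ 2 * l))) (Ioi 0) :=
        Integrable.of_integral_ne_zero (by rw [h1]; exact hval.ne')
      have h3 : ∀ l : ℝ, c * (l ^ (-(1 / 3) : ℝ) * Real.exp (-l * ‖X ω‖ ^ 2))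
          = c * (l ^ (-(1 / 3) : ℝ) * Real.exp (-(‖X ω‖ ^ 2 * l))) := fun l => by
        congr 3
        ring
      simp_rw [h3]
      rw [← ofReal_integral_eq_lintegral_ofReal (hint.const_mul c), integral_const_mul, h1]
      · congr 1
        rw [hc, one_div, Real.inv_rpow hq.le, Real.rpow_neg hq.le]
        field_simp
      · filter_upwards [ae_restrict_mem measurableSet_Ioi] with l hl
        have hl0 : 0 < l := hl
        positivity
    rw [lintegral_congr_ae e1, lintegral_lintegral_swap (Measurable.aemeasurable (by fun_prop))]
    refine le_of_eq (setLIntegral_congr_fun measurableSet_Ioi fun l hl => ?_)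
    have hl0 : 0 < l := hl
    have hint := integrable_exp_neg (μ := μ) hX hX hl0.le le_rfl
    simp only [zero_mul, sub_zero] at hint
    rw [← ofReal_integral_eq_lintegral_ofReal ((hint.const_mul _).const_mul _)
      (ae_of_all _ fun ω => by positivity), integral_const_mul, integral_const_mul,
      h.laplace_fst hl0.le]

end GaussianPair

/-! ### The regularised inverse and its ∂̄-derivative. -/

section ApproxInv

/-- A smooth bounded approximation of `z ↦ z⁻¹`. -/
noncomputable def approxInv (ε : ℝ) (z : ℂ) : ℂ := (ε + ‖z‖ ^ 2)⁻¹ • conj z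

lemma hasFDerivAt_add_norm_sq (ε : ℝ) (z : ℂ) :
    HasFDerivAt (fun z : ℂ => ε + ‖z‖ ^ 2) (2 • innerSL ℝ z) z :=
  (hasStrictFDerivAt_norm_sq z).hasFDerivAt.const_add ε

variable {ε : ℝ}

lemma hasFDerivAt_approxInv (hε : 0 < ε) (z : ℂ) :
    HasFDerivAt (approxInv ε) ((ε + ‖z‖ ^ 2)⁻¹ • Complex.conjCLE.toContinuousLinearMap
      + ((-((ε + ‖z‖ ^ 2) ^ 2)⁻¹) • (2 • innerSL ℝ z)).smulRight (conj z)) z := by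
  have hq : ε + ‖z‖ ^ 2 ≠ 0 := by positivity
  have h1 : HasFDerivAt (fun z : ℂ => (ε + ‖z‖ ^ 2)⁻¹)
      ((-((ε + ‖z‖ ^ 2) ^ 2)⁻¹) • (2 • innerSL ℝ z)) z :=
    (hasDerivAt_inv hq).comp_hasFDerivAt z (hasFDerivAt_add_norm_sq ε z)
  exact h1.smul Complex.conjCLE.toContinuousLinearMap.hasFDerivAt

lemma differentiable_approxInv (hε : 0 < ε) : Differentiable ℝ (approxInv ε) :=
  fun z => (hasFDerivAt_approxInv hε z).differentiableAt

/-- Regularised form of ∂̄(1/z) = πδ: with q = ε + |z|², the derivative is 1/q - |z|²/q² = ε/q². -/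
lemma dbar_approxInv (hε : 0 < ε) (z : ℂ) : dbar (approxInv ε) z = approxDirac ε z := by
  have hq : ε + ‖z‖ ^ 2 ≠ 0 := by positivity
  have hqc : (ε : ℂ) + (‖z‖ : ℂ) ^ 2 ≠ 0 := by exact_mod_cast hq
  have hz : (‖z‖ : ℂ) ^ 2 = z.re ^ 2 + z.im ^ 2 := by
    rw [← Complex.ofReal_pow, ← Complex.normSq_eq_norm_sq, Complex.normSq_apply]
    push_cast
    ring
  rw [dbar, (hasFDerivAt_approxInv hε z).fderiv, approxDirac]
  simp only [add_apply, smul_apply, ContinuousLinearMap.smulRight_apply, innerSL_apply_apply,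
    ContinuousLinearEquiv.coe_coe, Complex.conjCLE_apply, map_one, Complex.conj_I, Complex.inner]
  simp only [Complex.real_smul, smul_eq_mul, nsmul_eq_mul]
  have hc : conj z = z.re - z.im * Complex.I := by apply Complex.ext <;> simp
  simp only [mul_one, one_mul, Complex.conj_re, Complex.mul_re, Complex.I_re, zero_mul,
    Complex.I_im, Complex.conj_im, zero_sub, neg_neg]
  rw [hc]
  push_cast
  field_simp
  rw [hz]
  linear_combination (-ε - z.re ^ 2 + z.im ^ 2 : ℂ) * Complex.I_sq

lemma norm_le_mul_add_norm_sq (hε : 0 < ε) (z : ℂ) : ‖z‖ ≤ (1 + ε⁻¹) * (ε + ‖z‖ ^ 2) := by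
  have h1 : 0 ≤ ε⁻¹ * ‖z‖ ^ 2 := by positivity
  have h2 : ε⁻¹ * ε = 1 := inv_mul_cancel₀ hε.ne'
  nlinarith [sq_nonneg (‖z‖ - 1)]

lemma norm_approxInv (hε : 0 < ε) (z : ℂ) : ‖approxInv ε z‖ = ‖z‖ / (ε + ‖z‖ ^ 2) := by
  rw [approxInv, norm_smul, RCLike.norm_conj, Real.norm_of_nonneg (by positivity),
    div_eq_inv_mul]

lemma norm_approxInv_le (hε : 0 < ε) (z : ℂ) : ‖approxInv ε z‖ ≤ 1 + ε⁻¹ := by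
  rw [norm_approxInv hε, div_le_iff₀ (by positivity)]
  exact norm_le_mul_add_norm_sq hε z

/-- Unlike the bound by 1 + 1/ε, this one is uniform in ε, so F'/F itself dominates its smoothings
wherever F is nonzero. -/
lemma norm_approxInv_le_inv (hε : 0 < ε) (z : ℂ) : ‖approxInv ε z‖ ≤ ‖z‖⁻¹ := by
  rw [norm_approxInv hε]
  rcases eq_or_ne z 0 with rfl | hz
  · simp
  · have : 0 < ‖z‖ := norm_pos_iff.2 hz
    rw [div_le_iff₀ (by positivity), inv_mul_eq_div, le_div_iff₀ this]
    nlinarith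

/-- The convergence is pointwise everywhere: at z = 0 every approximation vanishes, in agreement
with the convention 0⁻¹ = 0. -/
lemma tendsto_approxInv (z : ℂ) : Tendsto (fun ε => approxInv ε z) (𝓝[>] 0) (𝓝 z⁻¹) := by
  rcases eq_or_ne z 0 with rfl | hz
  · simp [approxInv]
  · have h0 : Tendsto (fun ε : ℝ => ε) (𝓝[>] 0) (𝓝 0) := nhdsWithin_le_nhds
    have hz' : (0 : ℝ) + ‖z‖ ^ 2 ≠ 0 := by simpa using hz
    have h1 : Tendsto (fun ε => approxInv ε z) (𝓝[>] 0) (𝓝 ((0 + ‖z‖ ^ 2)⁻¹ • conj z)) :=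
      ((h0.add_const (‖z‖ ^ 2)).inv₀ hz').smul_const (conj z)
    convert h1 using 2
    rw [zero_add, Complex.inv_def, Complex.normSq_eq_norm_sq, Complex.real_smul, mul_comm]

lemma norm_fderiv_approxInv_le (hε : 0 < ε) (z : ℂ) : ‖fderiv ℝ (approxInv ε) z‖ ≤ 3 * ε⁻¹ := by
  rw [(hasFDerivAt_approxInv hε z).fderiv]
  set q := ε + ‖z‖ ^ 2 with hq
  have hqpos : 0 < q := by positivity
  have hqε : q⁻¹ ≤ ε⁻¹ := inv_anti₀ hε (by rw [hq]; nlinarith [sq_nonneg ‖z‖])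
  refine ContinuousLinearMap.opNorm_le_bound _ (by positivity) fun w => ?_
  simp only [add_apply, smul_apply, ContinuousLinearMap.smulRight_apply, innerSL_apply_apply,
    ContinuousLinearEquiv.coe_coe, Complex.conjCLE_apply]
  have h1 : ‖(-(q ^ 2)⁻¹ • (2 • inner ℝ z w) : ℝ) • conj z‖ ≤ 2 * q⁻¹ * ‖w‖ := by
    rw [norm_smul, RCLike.norm_conj, norm_smul, norm_neg, Real.norm_of_nonneg (by positivity)]
    have h2 : ‖(2 • inner ℝ z w : ℝ)‖ ≤ 2 * (‖z‖ * ‖w‖) := by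
      rw [nsmul_eq_mul, norm_mul]
      simpa using norm_inner_le_norm (𝕜 := ℝ) z w
    have h3 : (q ^ 2)⁻¹ * ‖z‖ ^ 2 ≤ q⁻¹ := by
      rw [inv_mul_le_iff₀ (by positivity)]
      have : q ^ 2 * q⁻¹ = q := by field_simp
      rw [this, hq]
      linarith
    calc (q ^ 2)⁻¹ * ‖(2 • inner ℝ z w : ℝ)‖ * ‖z‖ ≤ (q ^ 2)⁻¹ * (2 * (‖z‖ * ‖w‖)) * ‖z‖ := by
          gcongr
      _ = 2 * ((q ^ 2)⁻¹ * ‖z‖ ^ 2) * ‖w‖ := by ring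
      _ ≤ _ := by gcongr
  have h4 : ‖q⁻¹ • conj w‖ = q⁻¹ * ‖w‖ := by
    rw [norm_smul, RCLike.norm_conj, Real.norm_of_nonneg (by positivity)]
  calc _ ≤ ‖q⁻¹ • conj w‖ + ‖(-(q ^ 2)⁻¹ • (2 • inner ℝ z w) : ℝ) • conj z‖ := norm_add_le _ _
    _ ≤ q⁻¹ * ‖w‖ + 2 * q⁻¹ * ‖w‖ := by rw [h4]; gcongr
    _ = 3 * q⁻¹ * ‖w‖ := by ring
    _ ≤ _ := by gcongr

lemma hasFDerivAt_approxDirac (hε : 0 < ε) (z : ℂ) :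
    HasFDerivAt (fun z => (approxDirac ε z : ℂ)) (Complex.ofRealCLM.comp
      ((ε * (-(2 * (ε + ‖z‖ ^ 2)) / ((ε + ‖z‖ ^ 2) ^ 2) ^ 2)) • (2 • innerSL ℝ z))) z := by
  have hq : ε + ‖z‖ ^ 2 ≠ 0 := by positivity
  have h1 : HasDerivAt (fun q : ℝ => ε / q ^ 2)
      (ε * (-(2 * (ε + ‖z‖ ^ 2)) / ((ε + ‖z‖ ^ 2) ^ 2) ^ 2)) (ε + ‖z‖ ^ 2) := by
    have := (((hasDerivAt_id (ε + ‖z‖ ^ 2)).pow 2).inv (pow_ne_zero 2 hq)).const_mul ε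
    simpa [div_eq_mul_inv] using this
  have h2 : HasFDerivAt (approxDirac ε) ((ε * (-(2 * (ε + ‖z‖ ^ 2)) /
      ((ε + ‖z‖ ^ 2) ^ 2) ^ 2)) • (2 • innerSL ℝ z)) z :=
    HasDerivAt.comp_hasFDerivAt (h₂ := fun q : ℝ => ε / q ^ 2) z h1 (hasFDerivAt_add_norm_sq ε z)
  exact Complex.ofRealCLM.hasFDerivAt.comp z h2

lemma differentiable_approxDirac (hε : 0 < ε) : Differentiable ℝ fun z => (approxDirac ε z : ℂ) :=
  fun z => (hasFDerivAt_approxDirac hε z).differentiableAt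

lemma norm_fderiv_approxDirac_le (hε : 0 < ε) (z : ℂ) :
    ‖fderiv ℝ (fun z => (approxDirac ε z : ℂ)) z‖ ≤ 4 * ((1 + ε⁻¹) * ε⁻¹) := by
  rw [(hasFDerivAt_approxDirac hε z).fderiv]
  have hz := norm_le_mul_add_norm_sq hε z
  set q := ε + ‖z‖ ^ 2 with hq
  have hqpos : 0 < q := by positivity
  have hqε : q⁻¹ ≤ ε⁻¹ := inv_anti₀ hε (by rw [hq]; nlinarith [sq_nonneg ‖z‖])
  refine ContinuousLinearMap.opNorm_le_bound _ (by positivity) fun w => ?_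
  simp only [ContinuousLinearMap.comp_apply, smul_apply, innerSL_apply_apply,
    Complex.ofRealCLM_apply, Complex.norm_real]
  have h2 : ‖(2 • inner ℝ z w : ℝ)‖ ≤ 2 * (‖z‖ * ‖w‖) := by
    rw [nsmul_eq_mul, norm_mul]
    simpa using norm_inner_le_norm (𝕜 := ℝ) z w
  have h3 : ‖ε * (-(2 * q) / (q ^ 2) ^ 2)‖ = ε * (2 * q⁻¹ ^ 3) := by
    rw [norm_mul, norm_div, norm_neg, Real.norm_of_nonneg hε.le,
      Real.norm_of_nonneg (by positivity), Real.norm_of_nonneg (by positivity)]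
    field_simp
  rw [norm_smul, h3]
  calc ε * (2 * q⁻¹ ^ 3) * ‖(2 • inner ℝ z w : ℝ)‖
      ≤ ε * (2 * q⁻¹ ^ 3) * (2 * (((1 + ε⁻¹) * q) * ‖w‖)) := by
        gcongr
        exact h2.trans (by gcongr)
    _ = 4 * ((1 + ε⁻¹) * (ε * (q⁻¹ * q⁻¹))) * ‖w‖ := by
        field_simp
        ring
    _ ≤ 4 * ((1 + ε⁻¹) * (ε * (ε⁻¹ * ε⁻¹))) * ‖w‖ := by gcongr
    _ = _ := by
        field_simp

lemma measurable_approxInv (ε : ℝ) : Measurable (approxInv ε) := by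
  unfold approxInv
  fun_prop

lemma measurable_approxDirac (ε : ℝ) : Measurable (approxDirac ε) := by
  unfold approxDirac
  fun_prop

/-- The real part of the smoothed logarithmic derivative is still exact, so its integral is a
boundary term. -/
lemma hasDerivAt_log_add_norm_sq (hε : 0 < ε) {γ : ℝ → ℂ} {γ' : ℂ} {t : ℝ}
    (hγ : HasDerivAt γ γ' t) :
    HasDerivAt (fun t => 1 / 2 * Real.log (ε + ‖γ t‖ ^ 2)) (γ' * approxInv ε (γ t)).re t := by
  have h1 := ((hasFDerivAt_add_norm_sq ε (γ t)).comp_hasDerivAt t hγ)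
  have hq : ε + ‖γ t‖ ^ 2 ≠ 0 := by positivity
  have h2 := (h1.log hq).const_mul (1 / 2)
  refine h2.congr_deriv ?_
  simp only [smul_apply, innerSL_apply_apply, approxInv, Function.comp, Complex.inner,
    Complex.real_smul, nsmul_eq_mul]
  rw [mul_left_comm, Complex.re_ofReal_mul]
  push_cast
  field_simp

end ApproxInv

/-! ### Differentiability and Cauchy–Schwarz estimates for the covariance kernel. -/

section SpectralKernel

/-- The Fourier transform of a measure on the line, with the sign convention of covariance
kernels. -/
noncomputable def spectralKernel (ρ : Measure ℝ) (t : ℝ) : ℂ :=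
  ∫ x : ℝ, Complex.exp (-(Complex.I * (t : ℂ) * (x : ℂ))) ∂ρ

lemma norm_exp_neg_I_mul (t x : ℝ) : ‖Complex.exp (-(Complex.I * (t : ℂ) * (x : ℂ)))‖ = 1 := by
  have : -(Complex.I * (t : ℂ) * (x : ℂ)) = ((-(t * x) : ℝ) : ℂ) * Complex.I := by
    push_cast
    ring
  rw [this, Complex.norm_exp_ofReal_mul_I]

variable {ρ : Measure ℝ} [IsProbabilityMeasure ρ]

lemma integrable_exp_neg_I_mul (t : ℝ) :
    Integrable (fun x : ℝ => Complex.exp (-(Complex.I * (t : ℂ) * (x : ℂ)))) ρ :=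
  Integrable.of_bound (C := 1) (Continuous.aestronglyMeasurable (by fun_prop))
    (ae_of_all _ fun x => (norm_exp_neg_I_mul t x).le)

lemma spectralKernel_zero : spectralKernel ρ 0 = 1 := by
  simp [spectralKernel]

lemma norm_spectralKernel_le (t : ℝ) : ‖spectralKernel ρ t‖ ≤ 1 := by
  refine (norm_integral_le_integral_norm _).trans ?_
  simp_rw [norm_exp_neg_I_mul]
  simp

lemma integrable_id_of_integrable_sq
    (hρ : Integrable (fun x : ℝ => x ^ 2) ρ) : Integrable (fun x : ℝ => x) ρ := by
  refine (hρ.add (integrable_const 1)).mono' (by fun_prop) (ae_of_all _ fun x => ?_)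
  simp only [Real.norm_eq_abs, Pi.add_apply]
  nlinarith [sq_abs x, sq_nonneg (|x| - 1), abs_nonneg x]

lemma hasDerivAt_spectralKernel
    (hρ : Integrable (fun x : ℝ => x ^ 2) ρ) (t : ℝ) : HasDerivAt (spectralKernel ρ)
    (∫ x : ℝ, -(Complex.I * x) * Complex.exp (-(Complex.I * (t : ℂ) * (x : ℂ))) ∂ρ) t := by
  have h := hasDerivAt_integral_of_dominated_loc_of_deriv_le (μ := ρ) (𝕜 := ℝ)
    (F := fun (t x : ℝ) => Complex.exp (-(Complex.I * (t : ℂ) * (x : ℂ))))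
    (F' := fun (t x : ℝ) => -(Complex.I * x) * Complex.exp (-(Complex.I * (t : ℂ) * (x : ℂ))))
    (x₀ := t) (s := univ) (bound := fun x => |x|) univ_mem
    (Eventually.of_forall fun t => Continuous.aestronglyMeasurable (by fun_prop))
    (integrable_exp_neg_I_mul t) (Continuous.aestronglyMeasurable (by fun_prop))
    (ae_of_all _ fun x t _ => by
      rw [norm_mul, norm_exp_neg_I_mul]
      simp)
    (integrable_id_of_integrable_sq hρ).abs
    (ae_of_all _ fun x t _ => by
      have := (((Complex.ofRealCLM.hasDerivAt (x := t)).const_mul Complex.I).mul_const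
        (x : ℂ)).neg.cexp
      refine this.congr_deriv ?_
      simp
      ring)
  exact h.2

lemma deriv_spectralKernel
    (hρ : Integrable (fun x : ℝ => x ^ 2) ρ) (t : ℝ) : deriv (spectralKernel ρ) t
    = ∫ x : ℝ, -(Complex.I * x) * Complex.exp (-(Complex.I * (t : ℂ) * (x : ℂ))) ∂ρ :=
  (hasDerivAt_spectralKernel hρ t).deriv

lemma hasDerivAt_deriv_spectralKernel
    (hρ : Integrable (fun x : ℝ => x ^ 2) ρ) (t : ℝ) : HasDerivAt (deriv (spectralKernel ρ))
    (∫ x : ℝ, -(x : ℂ) ^ 2 * Complex.exp (-(Complex.I * (t : ℂ) * (x : ℂ))) ∂ρ) t := by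
  have heq : deriv (spectralKernel ρ) = fun t : ℝ => ∫ x : ℝ, -(Complex.I * x) *
      Complex.exp (-(Complex.I * (t : ℂ) * (x : ℂ))) ∂ρ := funext (deriv_spectralKernel hρ)
  rw [heq]
  have h := hasDerivAt_integral_of_dominated_loc_of_deriv_le (μ := ρ) (𝕜 := ℝ)
    (F := fun (t x : ℝ) => -(Complex.I * x) * Complex.exp (-(Complex.I * (t : ℂ) * (x : ℂ))))
    (F' := fun (t x : ℝ) => -(x : ℂ) ^ 2 * Complex.exp (-(Complex.I * (t : ℂ) * (x : ℂ))))
    (x₀ := t) (s := univ) (bound := fun x => x ^ 2) univ_mem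
    (Eventually.of_forall fun t => Continuous.aestronglyMeasurable (by fun_prop))
    ?_ (Continuous.aestronglyMeasurable (by fun_prop))
    (ae_of_all _ fun x t _ => by
      rw [norm_mul, norm_exp_neg_I_mul]
      simp)
    hρ
    (ae_of_all _ fun x t _ => by
      have := ((((Complex.ofRealCLM.hasDerivAt (x := t)).const_mul Complex.I).mul_const
        (x : ℂ)).neg.cexp).const_mul (-(Complex.I * x))
      refine this.congr_deriv ?_
      simp
      linear_combination (x : ℂ) ^ 2 * Complex.exp (-(Complex.I * (t : ℂ) * (x : ℂ)))
        * Complex.I_sq)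
  · exact h.2
  · refine (integrable_id_of_integrable_sq hρ).abs.mono'
      (Continuous.aestronglyMeasurable (by fun_prop)) (ae_of_all _ fun x => ?_)
    rw [norm_mul, norm_exp_neg_I_mul]
    simp

lemma continuous_deriv_spectralKernel
    (hρ : Integrable (fun x : ℝ => x ^ 2) ρ) : Continuous (deriv (spectralKernel ρ)) :=
  continuous_iff_continuousAt.2 fun t => (hasDerivAt_deriv_spectralKernel hρ t).continuousAt

lemma deriv_spectralKernel_neg
    (hρ : Integrable (fun x : ℝ => x ^ 2) ρ) (t : ℝ) :
    deriv (spectralKernel ρ) (-t) = -conj (deriv (spectralKernel ρ) t) := by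
  rw [deriv_spectralKernel hρ, deriv_spectralKernel hρ, ← integral_conj, ← integral_neg]
  refine integral_congr_ae (ae_of_all _ fun x => ?_)
  simp only
  rw [map_mul, ← Complex.exp_conj]
  simp

lemma deriv_spectralKernel_zero
    (hρ : Integrable (fun x : ℝ => x ^ 2) ρ) :
    deriv (spectralKernel ρ) 0 = -(Complex.I * ((∫ x, x ∂ρ : ℝ) : ℂ)) := by
  rw [deriv_spectralKernel hρ, ← integral_complex_ofReal]
  simp [integral_neg, integral_const_mul]

/-- Integrate 2 - 2 cos u ≤ u². For a process with this kernel the left side is the mean square of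
an increment, so difference quotients are bounded in L². -/
lemma two_sub_two_mul_re_spectralKernel_le
    (hρ : Integrable (fun x : ℝ => x ^ 2) ρ) (t : ℝ) :
    2 - 2 * (spectralKernel ρ t).re ≤ (∫ x, x ^ 2 ∂ρ) * t ^ 2 := by
  have h1 : (spectralKernel ρ t).re = ∫ x, Real.cos (t * x) ∂ρ := by
    rw [spectralKernel, ← Complex.reCLM_apply,
      ← ContinuousLinearMap.integral_comp_comm _ (integrable_exp_neg_I_mul t)]
    refine integral_congr_ae (ae_of_all _ fun x => ?_)
    have : -(Complex.I * (t : ℂ) * (x : ℂ)) = ((-(t * x) : ℝ) : ℂ) * Complex.I := by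
      push_cast
      ring
    simp only
    rw [this, Complex.reCLM_apply, Complex.exp_ofReal_mul_I_re, Real.cos_neg]
  have hc : Integrable (fun x : ℝ => Real.cos (t * x)) ρ :=
    Integrable.of_bound (C := 1) (Continuous.aestronglyMeasurable (by fun_prop))
      (ae_of_all _ fun x => Real.abs_cos_le_one _)
  have h2 : 2 - 2 * ∫ x, Real.cos (t * x) ∂ρ = ∫ x, (2 - 2 * Real.cos (t * x)) ∂ρ := by
    rw [integral_sub (integrable_const _) (hc.const_mul 2), integral_const_mul]
    simp
  rw [h1, h2, ← integral_mul_const]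
  refine integral_mono ((integrable_const _).sub (hc.const_mul 2)) (hρ.mul_const _) fun x => ?_
  have := Real.one_sub_sq_div_two_le_cos (x := t * x)
  simp only
  nlinarith

/-- This is the variance of e^{-itx} under ρ. It is the second factor in the Cauchy–Schwarz bound
below, and its vanishing describes the points with |r(t)| = 1. -/
lemma integral_norm_exp_sub_spectralKernel_sq (t : ℝ) :
    Integrable (fun x : ℝ => ‖Complex.exp (-(Complex.I * (t : ℂ) * (x : ℂ)))
        - spectralKernel ρ t‖ ^ 2) ρ ∧
      ∫ x : ℝ, ‖Complex.exp (-(Complex.I * (t : ℂ) * (x : ℂ))) - spectralKernel ρ t‖ ^ 2 ∂ρ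
        = 1 - ‖spectralKernel ρ t‖ ^ 2 := by
  set r := spectralKernel ρ t with hr
  set e : ℝ → ℂ := fun x => Complex.exp (-(Complex.I * (t : ℂ) * (x : ℂ))) with he
  have hsq : ∀ x, ‖e x - r‖ ^ 2 = 1 + ‖r‖ ^ 2 - 2 * (conj r * e x).re := by
    intro x
    have h2 : ‖e x‖ ^ 2 = 1 := by rw [he, norm_exp_neg_I_mul]; norm_num
    rw [← Complex.normSq_eq_norm_sq] at h2 ⊢
    rw [Complex.normSq_sub, h2, Complex.normSq_eq_norm_sq, mul_comm (e x)]
  have hie : Integrable e ρ := integrable_exp_neg_I_mul t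
  have hire : Integrable (fun x => (conj r * e x).re) ρ := (hie.const_mul _).re
  have isq : Integrable (fun x => ‖e x - r‖ ^ 2) ρ := by
    simp_rw [hsq]
    exact (integrable_const _).sub (hire.const_mul 2)
  have hφ : ∫ x, ‖e x - r‖ ^ 2 ∂ρ = 1 - ‖r‖ ^ 2 := by
    simp_rw [hsq]
    rw [integral_sub (integrable_const _) (hire.const_mul 2), integral_const_mul]
    have h3 : ∫ x, (conj r * e x).re ∂ρ = ‖r‖ ^ 2 := by
      have := (Complex.reCLM.integral_comp_comm (hie.const_mul (conj r)))
      simp only [Complex.reCLM_apply] at this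
      rw [this, integral_const_mul]
      have h4 : ∫ x, e x ∂ρ = r := rfl
      rw [h4, mul_comm, Complex.mul_conj, Complex.ofReal_re, Complex.normSq_eq_norm_sq]
    rw [h3]
    simp
    ring
  exact ⟨isq, hφ⟩

/-- Because ρ has mean zero, the constant r(t) can be subtracted from e^{-itx} inside the integral
for r'(t) without changing it. Cauchy–Schwarz then gives the variance factor 1 - |r|², which cancels
the singular denominator of the winding kernel. -/
theorem norm_deriv_spectralKernel_sq_le
    (hρ : Integrable (fun x : ℝ => x ^ 2) ρ) (hmean : ∫ x, x ∂ρ = 0) (t : ℝ) :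
    ‖deriv (spectralKernel ρ) t‖ ^ 2 ≤ (∫ x, x ^ 2 ∂ρ) * (1 - ‖spectralKernel ρ t‖ ^ 2) := by
  set r := spectralKernel ρ t with hr
  set e : ℝ → ℂ := fun x => Complex.exp (-(Complex.I * (t : ℂ) * (x : ℂ))) with he
  have hid := integrable_id_of_integrable_sq hρ
  have hec : Continuous e := by fun_prop
  have i0 : Integrable (fun x : ℝ => -(Complex.I * x) * e x) ρ := by
    refine hid.abs.mono' (Continuous.aestronglyMeasurable (by fun_prop)) (ae_of_all _ fun x => ?_)
    rw [norm_mul, he, norm_exp_neg_I_mul]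
    simp
  have h1 : deriv (spectralKernel ρ) t = ∫ x : ℝ, -(Complex.I * x) * (e x - r) ∂ρ := by
    have i1 : Integrable (fun x : ℝ => -(Complex.I * x) * r) ρ :=
      ((hid.ofReal.const_mul Complex.I).neg).mul_const r
    have h0 : ∫ x : ℝ, -(Complex.I * x) * r ∂ρ = 0 := by
      rw [integral_mul_const, integral_neg, integral_const_mul, integral_complex_ofReal, hmean]
      simp
    simp_rw [mul_sub]
    rw [integral_sub i0 i1, h0, sub_zero, deriv_spectralKernel hρ]
  obtain ⟨isq, hφ⟩ := integral_norm_exp_sub_spectralKernel_sq (ρ := ρ) t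
  have hB : ‖deriv (spectralKernel ρ) t‖ ≤ ∫ x, |x| * ‖e x - r‖ ∂ρ := by
    rw [h1]
    refine (norm_integral_le_integral_norm _).trans (le_of_eq ?_)
    refine integral_congr_ae (ae_of_all _ fun x => ?_)
    simp
  have iB : Integrable (fun x => |x| * ‖e x - r‖) ρ := by
    refine (hρ.add isq).mono' (Continuous.aestronglyMeasurable (by fun_prop))
      (ae_of_all _ fun x => ?_)
    rw [Real.norm_of_nonneg (by positivity)]
    simp only [Pi.add_apply]
    nlinarith [sq_abs x, sq_nonneg (|x| - ‖e x - r‖), sq_nonneg (|x|), sq_nonneg ‖e x - r‖]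
  -- Cauchy–Schwarz through the discriminant of the nonnegative quadratic s ↦ ∫ (s|x| + |e - r|)²
  -- dρ.
  have hdisc := discrim_le_zero (a := ∫ x, x ^ 2 ∂ρ) (b := 2 * ∫ x, |x| * ‖e x - r‖ ∂ρ)
    (c := 1 - ‖r‖ ^ 2) (fun s => by
      have : 0 ≤ ∫ x, (s * |x| + ‖e x - r‖) ^ 2 ∂ρ := integral_nonneg fun x => by positivity
      have hexp : ∀ x : ℝ, (s * |x| + ‖e x - r‖) ^ 2
          = s ^ 2 * x ^ 2 + 2 * s * (|x| * ‖e x - r‖) + ‖e x - r‖ ^ 2 := fun x => by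
        rw [← sq_abs x]
        ring
      simp_rw [hexp] at this
      have i3 : Integrable (fun x : ℝ => s ^ 2 * x ^ 2 + 2 * s * (|x| * ‖e x - r‖)) ρ :=
        (hρ.const_mul _).add (iB.const_mul _)
      rw [integral_add i3 isq, integral_add (hρ.const_mul _) (iB.const_mul _),
        integral_const_mul, integral_const_mul, hφ] at this
      linarith)
  rw [discrim] at hdisc
  have h5 := pow_le_pow_left₀ (norm_nonneg _) hB 2
  linarith

end SpectralKernel

/-! ### Passing to the limit under a second moment bound. -/

section Convergence

variable {Ω : Type*} [MeasurableSpace Ω] {μ : Measure Ω} [IsProbabilityMeasure μ]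

/-- Almost sure convergence together with a bound on second moments gives convergence of
integrals. -/
theorem tendsto_integral_of_integral_sq_le {Z : ℕ → Ω → ℂ} {Z₀ : Ω → ℂ} {C : ℝ}
    (hZ : ∀ n, Measurable (Z n)) (hlim : ∀ ω, Tendsto (fun n => Z n ω) atTop (𝓝 (Z₀ ω)))
    (hint : ∀ n, Integrable (fun ω => ‖Z n ω‖ ^ 2) μ) (hC : ∀ n, ∫ ω, ‖Z n ω‖ ^ 2 ∂μ ≤ C) :
    Integrable Z₀ μ ∧ Tendsto (fun n => ∫ ω, Z n ω ∂μ) atTop (𝓝 (∫ ω, Z₀ ω ∂μ)) := by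
  have hZ₀ : Measurable Z₀ := measurable_of_tendsto_metrizable hZ (tendsto_pi_nhds.2 hlim)
  have hl2 : ∀ n, ∫⁻ ω, ENNReal.ofReal (‖Z n ω‖ ^ 2) ∂μ ≤ ENNReal.ofReal C := fun n => by
    rw [← ofReal_integral_eq_lintegral_ofReal (hint n) (ae_of_all _ fun ω => by positivity)]
    exact ENNReal.ofReal_le_ofReal (hC n)
  have hl0 : ∫⁻ ω, ENNReal.ofReal (‖Z₀ ω‖ ^ 2) ∂μ ≤ ENNReal.ofReal C := by
    have h1 : ∀ ω, ENNReal.ofReal (‖Z₀ ω‖ ^ 2)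
        = liminf (fun n => ENNReal.ofReal (‖Z n ω‖ ^ 2)) atTop := fun ω =>
      (((ENNReal.continuous_ofReal.tendsto _).comp ((hlim ω).norm.pow 2)).liminf_eq).symm
    simp_rw [h1]
    refine (lintegral_liminf_le fun n => by fun_prop).trans ?_
    exact (liminf_le_liminf (Eventually.of_forall hl2)).trans (by simp)
  have hint1 : ∀ {W : Ω → ℂ}, Measurable W → ∫⁻ ω, ENNReal.ofReal (‖W ω‖ ^ 2) ∂μ ≤
      ENNReal.ofReal C → Integrable W μ := by
    intro W hW hle
    have hsq : Integrable (fun ω => ‖W ω‖ ^ 2) μ := by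
      refine ⟨Measurable.aestronglyMeasurable (by fun_prop), ?_⟩
      rw [hasFiniteIntegral_iff_ofReal (ae_of_all _ fun ω => by positivity)]
      exact hle.trans_lt ENNReal.ofReal_lt_top
    refine (hsq.add (integrable_const 1)).mono' hW.aestronglyMeasurable (ae_of_all _ fun ω => ?_)
    simp only [Pi.add_apply]
    nlinarith [sq_nonneg (‖W ω‖ - 1), norm_nonneg (W ω)]
  have hi0 : Integrable Z₀ μ := hint1 hZ₀ hl0
  have hin : ∀ n, Integrable (Z n) μ := fun n => hint1 (hZ n) (hl2 n)
  refine ⟨hi0, ?_⟩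
  have hC0 : 0 ≤ C := (integral_nonneg fun ω => by positivity).trans (hC 0)
  have hui : UnifIntegrable Z 1 μ := by
    -- Above the level K one has |Z| ≤ |Z|²/K, so tails are at most C/K. With K = C/ε + 1 this is at
    -- most ε, and the added 1 keeps K positive when C = 0.
    refine unifIntegrable_of le_rfl ENNReal.one_ne_top (fun n => (hZ n).aestronglyMeasurable)
      fun ε hε => ⟨Real.toNNReal (C / ε + 1), fun n => ?_⟩
    have hK : (0 : ℝ) < C / ε + 1 := by positivity
    rw [eLpNorm_one_eq_lintegral_enorm]
    calc _ ≤ ∫⁻ ω, ENNReal.ofReal (‖Z n ω‖ ^ 2) * ENNReal.ofReal ((C / ε + 1)⁻¹) ∂μ := by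
          refine lintegral_mono fun ω => ?_
          by_cases hω : Real.toNNReal (C / ε + 1) ≤ ‖Z n ω‖₊
          · rw [indicator_of_mem (by exact hω), ← ofReal_norm,
              ← ENNReal.ofReal_mul (by positivity)]
            refine ENNReal.ofReal_le_ofReal ?_
            rw [Real.toNNReal_le_iff_le_coe, coe_nnnorm] at hω
            rw [← div_eq_mul_inv, le_div_iff₀ hK]
            nlinarith [norm_nonneg (Z n ω)]
          · rw [indicator_of_notMem (by exact hω)]
            simp
      _ ≤ ENNReal.ofReal C * ENNReal.ofReal ((C / ε + 1)⁻¹) := by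
          rw [lintegral_mul_const _ (by fun_prop)]
          gcongr
          exact hl2 n
      _ ≤ ENNReal.ofReal ε := by
          rw [← ENNReal.ofReal_mul hC0]
          refine ENNReal.ofReal_le_ofReal ?_
          rw [← div_eq_mul_inv, div_le_iff₀ hK]
          field_simp
          linarith
  have hL1 := tendsto_Lp_finite_of_tendsto_ae le_rfl ENNReal.one_ne_top
    (fun n => (hZ n).aestronglyMeasurable) (memLp_one_iff_integrable.2 hi0) hui
    (ae_of_all _ hlim)
  refine tendsto_integral_of_L1' Z₀ hi0.aestronglyMeasurable (Eventually.of_forall hin) ?_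
  exact hL1

end Convergence

/-- A centred complex Gaussian stationary process with measurable marginals and continuously
differentiable paths, whose spectral measure `ρ` is centred with finite variance. -/
structure IsSmoothGSP {Ω : Type*} [MeasurableSpace Ω] (μ : Measure Ω) (F : ℝ → Ω → ℂ)
    (ρ : Measure ℝ) : Prop where
  measurable : ∀ t, Measurable (F t)
  contDiff : ∀ ω, ContDiff ℝ 1 fun t => F t ω
  gaussian : ∀ (n : ℕ) (t : Fin n → ℝ), IsComplexGaussianVector μ fun ω (i : Fin n) => F (t i) ω
  cov : ∀ s t, ∫ ω, F s ω * conj (F t ω) ∂μ = spectralKernel ρ (s - t)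
  integrable_sq : Integrable (fun x : ℝ => x ^ 2) ρ
  mean : ∫ x, x ∂ρ = 0

/-- The derivative of the path of `F` at time `t`. -/
noncomputable def pathDeriv {Ω : Type*} (F : ℝ → Ω → ℂ) (t : ℝ) (ω : Ω) : ℂ :=
  deriv (fun s => F s ω) t

/-- The difference quotient of the path of `F` at time `t` with step `h`. -/
noncomputable def pathSlope {Ω : Type*} (F : ℝ → Ω → ℂ) (h t : ℝ) (ω : Ω) : ℂ :=
  (h : ℂ)⁻¹ * (F (t + h) ω - F t ω)

set_option linter.unusedSectionVars false

/-! ### Path derivatives as limits of difference quotients. -/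

namespace IsSmoothGSP

variable {Ω : Type*} [MeasurableSpace Ω] {μ : Measure Ω} [IsProbabilityMeasure μ]
  {F : ℝ → Ω → ℂ} {ρ : Measure ℝ} [IsProbabilityMeasure ρ]

lemma hasDerivAt (hF : IsSmoothGSP μ F ρ) (t : ℝ) (ω : Ω) :
    HasDerivAt (fun s => F s ω) (pathDeriv F t ω) t :=
  (((hF.contDiff ω).differentiable one_ne_zero) t).hasDerivAt

lemma continuous_path (hF : IsSmoothGSP μ F ρ) (ω : Ω) : Continuous fun t => F t ω :=
  (hF.contDiff ω).continuous

lemma continuous_pathDeriv (hF : IsSmoothGSP μ F ρ) (ω : Ω) :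
    Continuous fun t => pathDeriv F t ω :=
  (hF.contDiff ω).continuous_deriv_one

lemma tendsto_pathSlope (hF : IsSmoothGSP μ F ρ) (t : ℝ) (ω : Ω) :
    Tendsto (fun n : ℕ => pathSlope F (1 / (n + 1)) t ω) atTop (𝓝 (pathDeriv F t ω)) := by
  have h1 := (hF.hasDerivAt t ω).tendsto_slope_zero
  have h2 : Tendsto (fun n : ℕ => (1 / ((n : ℝ) + 1))) atTop (𝓝[≠] 0) := by
    refine tendsto_nhdsWithin_iff.2 ⟨tendsto_one_div_add_atTop_nhds_zero_nat,
      Eventually.of_forall fun n => ?_⟩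
    have : (1 / ((n : ℝ) + 1)) ≠ 0 := by positivity
    exact this
  refine (h1.comp h2).congr fun n => ?_
  simp only [Function.comp, pathSlope, Complex.real_smul]
  push_cast
  rfl

lemma measurable_pathSlope (hF : IsSmoothGSP μ F ρ) (h t : ℝ) : Measurable (pathSlope F h t) := by
  unfold pathSlope
  exact ((hF.measurable _).sub (hF.measurable _)).const_mul _

lemma measurable_pathDeriv (hF : IsSmoothGSP μ F ρ) (t : ℝ) : Measurable (pathDeriv F t) :=
  measurable_of_tendsto_metrizable (fun n : ℕ => hF.measurable_pathSlope (1 / (n + 1)) t)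
    (tendsto_pi_nhds.2 fun ω => hF.tendsto_pathSlope t ω)

lemma measurable_uncurry (hF : IsSmoothGSP μ F ρ) : Measurable (Function.uncurry F) :=
  measurable_uncurry_of_continuous_of_measurable hF.continuous_path hF.measurable

lemma measurable_uncurry_pathDeriv (hF : IsSmoothGSP μ F ρ) :
    Measurable (Function.uncurry (pathDeriv F)) :=
  measurable_uncurry_of_continuous_of_measurable hF.continuous_pathDeriv hF.measurable_pathDeriv

lemma isGaussianPair (hF : IsSmoothGSP μ F ρ) (s t : ℝ) :
    IsGaussianPair μ (F s) (F t) (1 - ‖spectralKernel ρ (s - t)‖ ^ 2) where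
  measurable_fst := hF.measurable s
  measurable_snd := hF.measurable t
  nonneg := by
    have := pow_le_one₀ (n := 2) (norm_nonneg _) (norm_spectralKernel_le (ρ := ρ) (s - t))
    linarith
  le_one := by
    have : 0 ≤ ‖spectralKernel ρ (s - t)‖ ^ 2 := by positivity
    linarith
  laplace l n hl hn := by
    have hG := hF.gaussian 2 ![s, t]
    have := hG.integral_exp_neg (r := spectralKernel ρ (s - t)) ?_ ?_ ?_
      (norm_spectralKernel_le _) hl hn
    · simpa using this
    · simp [hF.cov, spectralKernel_zero]
    · simp [hF.cov, spectralKernel_zero]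
    · simp [hF.cov]

lemma integrable_norm_pow (hF : IsSmoothGSP μ F ρ) (t : ℝ) (p : ℕ) :
    Integrable (fun ω => ‖F t ω‖ ^ p) μ :=
  (hF.gaussian 1 fun _ => t).integrable_norm_pow 0 p

lemma integrable_mul_conj (hF : IsSmoothGSP μ F ρ) (s t : ℝ) :
    Integrable (fun ω => F s ω * conj (F t ω)) μ := by
  have hs := hF.measurable s
  have ht := hF.measurable t
  refine ((hF.integrable_norm_pow s 2).add (hF.integrable_norm_pow t 2)).mono'
    (Measurable.aestronglyMeasurable (hs.mul (Complex.continuous_conj.measurable.comp ht)))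
    (ae_of_all _ fun ω => ?_)
  rw [norm_mul, RCLike.norm_conj]
  simp only [Pi.add_apply]
  nlinarith [sq_nonneg (‖F s ω‖ - ‖F t ω‖), sq_nonneg ‖F s ω‖, sq_nonneg ‖F t ω‖]

lemma integral_norm_sq (hF : IsSmoothGSP μ F ρ) (t : ℝ) : ∫ ω, ‖F t ω‖ ^ 2 ∂μ = 1 := by
  have h := hF.cov t t
  have h2 : ∀ z : ℂ, z * conj z = ((‖z‖ ^ 2 : ℝ) : ℂ) := fun z => by
    rw [Complex.mul_conj, Complex.normSq_eq_norm_sq]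
  simp_rw [h2] at h
  rw [integral_complex_ofReal, sub_self, spectralKernel_zero] at h
  exact_mod_cast h

/-- Joint Gaussianity is only known for values of the process, so derivatives enter through
difference quotients, which are linear in four values. -/
lemma gaussian_slope_slope (hF : IsSmoothGSP μ F ρ) (h s t : ℝ) :
    IsComplexGaussianVector μ fun ω =>
      ![pathSlope F h s ω, pathSlope F h t ω, F s ω, F t ω] := by
  have hB := (hF.gaussian 4 ![s + h, s, t + h, t]).mulVec
    !![(h : ℂ)⁻¹, -(h : ℂ)⁻¹, 0, 0; 0, 0, (h : ℂ)⁻¹, -(h : ℂ)⁻¹; 0, 1, 0, 0; 0, 0, 0, 1]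
  convert hB using 2 with ω
  funext i
  fin_cases i <;>
    simp [pathSlope, Matrix.mulVec, dotProduct, Fin.sum_univ_four] <;> ring

/-- The duplicated coordinate merely fills the slot of the affine factor, which is taken constant
when only one slope is left to integrate by parts. -/
lemma gaussian_slope (hF : IsSmoothGSP μ F ρ) (h s t : ℝ) :
    IsComplexGaussianVector μ fun ω =>
      ![pathSlope F h t ω, pathSlope F h t ω, F s ω, F t ω] := by
  have hB := (hF.gaussian_slope_slope h s t).mulVec
    !![0, 1, 0, 0; 0, 1, 0, 0; 0, 0, 1, 0; 0, 0, 0, 1]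
  convert hB using 2 with ω
  funext i
  fin_cases i <;> simp [Matrix.mulVec, dotProduct, Fin.sum_univ_four]

lemma integral_norm_pathSlope_sq_le (hF : IsSmoothGSP μ F ρ) {h : ℝ} (hh : h ≠ 0) (t : ℝ) :
    ∫ ω, ‖pathSlope F h t ω‖ ^ 2 ∂μ ≤ ∫ x, x ^ 2 ∂ρ := by
  have e1 : ∀ ω, ‖pathSlope F h t ω‖ ^ 2 = (h ^ 2)⁻¹ * (‖F (t + h) ω‖ ^ 2 + ‖F t ω‖ ^ 2
      - 2 * (F (t + h) ω * conj (F t ω)).re) := by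
    intro ω
    rw [pathSlope, norm_mul, mul_pow, norm_inv, Complex.norm_real, inv_pow, Real.norm_eq_abs,
      sq_abs, ← Complex.normSq_eq_norm_sq (_ - _), Complex.normSq_sub, Complex.normSq_eq_norm_sq,
      Complex.normSq_eq_norm_sq]
  have i1 := hF.integrable_norm_pow (t + h) 2
  have i2 := hF.integrable_norm_pow t 2
  have i3 := hF.integrable_mul_conj (t + h) t
  have i12 : Integrable (fun ω => ‖F (t + h) ω‖ ^ 2 + ‖F t ω‖ ^ 2) μ := i1.add i2
  have i4 : Integrable (fun ω => (F (t + h) ω * conj (F t ω)).re) μ := i3.re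
  have h3 : ∫ ω, (F (t + h) ω * conj (F t ω)).re ∂μ = (spectralKernel ρ h).re := by
    have := Complex.reCLM.integral_comp_comm i3
    simp only [Complex.reCLM_apply] at this
    rw [this, hF.cov, add_sub_cancel_left]
  simp_rw [e1]
  rw [integral_const_mul, integral_sub i12 (i4.const_mul 2), integral_add i1 i2,
    hF.integral_norm_sq, hF.integral_norm_sq, integral_const_mul, h3,
    inv_mul_le_iff₀ (by positivity)]
  have := two_sub_two_mul_re_spectralKernel_le hF.integrable_sq h
  linarith

lemma integrable_norm_pathSlope_pow (hF : IsSmoothGSP μ F ρ) (h t : ℝ) (p : ℕ) :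
    Integrable (fun ω => ‖pathSlope F h t ω‖ ^ p) μ := by
  simpa using (hF.gaussian_slope_slope h t t).integrable_norm_pow 0 p

lemma integral_norm_pathSlope_pow_four_le (hF : IsSmoothGSP μ F ρ) {h : ℝ} (hh : h ≠ 0) (t : ℝ) :
    ∫ ω, ‖pathSlope F h t ω‖ ^ 4 ∂μ ≤ 2 * (∫ x, x ^ 2 ∂ρ) ^ 2 := by
  have h4 := (hF.gaussian_slope_slope h t t).integral_norm_pow_four 0
  simp only [Matrix.cons_val_zero] at h4
  rw [h4]
  have := hF.integral_norm_pathSlope_sq_le hh t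
  gcongr

/-- Fatou along difference quotients, whose fourth moments are at most twice the squared spectral
variance, uniformly in step and time. -/
lemma lintegral_norm_pathDeriv_pow_four_le (hF : IsSmoothGSP μ F ρ) (t : ℝ) :
    ∫⁻ ω, ENNReal.ofReal (‖pathDeriv F t ω‖ ^ 4) ∂μ
      ≤ ENNReal.ofReal (2 * (∫ x, x ^ 2 ∂ρ) ^ 2) := by
  have h1 : ∀ ω, ENNReal.ofReal (‖pathDeriv F t ω‖ ^ 4)
      = liminf (fun n : ℕ => ENNReal.ofReal (‖pathSlope F (1 / (n + 1)) t ω‖ ^ 4)) atTop :=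
    fun ω => (((ENNReal.continuous_ofReal.tendsto _).comp
      ((hF.tendsto_pathSlope t ω).norm.pow 4)).liminf_eq).symm
  simp_rw [h1]
  refine (lintegral_liminf_le fun n => ?_).trans ?_
  · have := hF.measurable_pathSlope (1 / (n + 1)) t
    fun_prop
  · refine (liminf_le_liminf (v := fun _ => ENNReal.ofReal (2 * (∫ x, x ^ 2 ∂ρ) ^ 2))
      (Eventually.of_forall fun n => ?_)).trans (by simp)
    rw [← ofReal_integral_eq_lintegral_ofReal (hF.integrable_norm_pathSlope_pow _ _ _)
      (ae_of_all _ fun ω => by positivity)]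
    exact ENNReal.ofReal_le_ofReal (hF.integral_norm_pathSlope_pow_four_le (by positivity) t)

lemma cov_pathSlope (hF : IsSmoothGSP μ F ρ) (h s t : ℝ) :
    ∫ ω, pathSlope F h s ω * conj (F t ω) ∂μ
      = (h : ℂ)⁻¹ * (spectralKernel ρ (s - t + h) - spectralKernel ρ (s - t)) := by
  have e1 : ∀ ω, pathSlope F h s ω * conj (F t ω)
      = (h : ℂ)⁻¹ * (F (s + h) ω * conj (F t ω) - F s ω * conj (F t ω)) := by
    intro ω
    rw [pathSlope]
    ring
  simp_rw [e1]
  rw [integral_const_mul, integral_sub (hF.integrable_mul_conj _ _) (hF.integrable_mul_conj _ _),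
    hF.cov, hF.cov]
  congr 3
  ring

lemma tendsto_cov_pathSlope (hF : IsSmoothGSP μ F ρ) (s t : ℝ) :
    Tendsto (fun n : ℕ => ∫ ω, pathSlope F (1 / (n + 1)) s ω * conj (F t ω) ∂μ) atTop
      (𝓝 (deriv (spectralKernel ρ) (s - t))) := by
  have h1 := (hasDerivAt_spectralKernel hF.integrable_sq (s - t)).differentiableAt.hasDerivAt
  have h2 : Tendsto (fun n : ℕ => (1 / ((n : ℝ) + 1))) atTop (𝓝[≠] 0) := by
    refine tendsto_nhdsWithin_iff.2 ⟨tendsto_one_div_add_atTop_nhds_zero_nat,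
      Eventually.of_forall fun n => ?_⟩
    have : (1 / ((n : ℝ) + 1)) ≠ 0 := by positivity
    exact this
  refine (h1.tendsto_slope_zero.comp h2).congr fun n => ?_
  rw [hF.cov_pathSlope]
  simp only [Function.comp, Complex.real_smul]
  push_cast
  rfl

/-- This is what centring buys: F'(t) and F(t) are uncorrelated, so the diagonal terms in the
integrations by parts disappear. -/
lemma deriv_spectralKernel_zero (hF : IsSmoothGSP μ F ρ) : deriv (spectralKernel ρ) 0 = 0 := by
  rw [WindingGSP.deriv_spectralKernel_zero hF.integrable_sq, hF.mean]
  simp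

lemma integrable_norm_mul_norm_sq (hF : IsSmoothGSP μ F ρ) {h : ℝ} (hh : h ≠ 0) (s t : ℝ)
    {G : Ω → ℂ} {C : ℝ} (hG : Measurable G) (hC : ∀ ω, ‖G ω‖ ≤ C) :
    Integrable (fun ω => ‖pathSlope F h s ω * (pathSlope F h t ω * G ω)‖ ^ 2) μ ∧
    ∫ ω, ‖pathSlope F h s ω * (pathSlope F h t ω * G ω)‖ ^ 2 ∂μ
      ≤ C ^ 2 * (2 * (∫ x, x ^ 2 ∂ρ) ^ 2) := by
  have hs := hF.measurable_pathSlope h s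
  have ht := hF.measurable_pathSlope h t
  have is := hF.integrable_norm_pathSlope_pow h s 4
  have it := hF.integrable_norm_pathSlope_pow h t 4
  have hle : ∀ ω, ‖pathSlope F h s ω * (pathSlope F h t ω * G ω)‖ ^ 2
      ≤ C ^ 2 / 2 * (‖pathSlope F h s ω‖ ^ 4 + ‖pathSlope F h t ω‖ ^ 4) := by
    intro ω
    rw [norm_mul, norm_mul, mul_pow, mul_pow]
    have h1 : ‖G ω‖ ^ 2 ≤ C ^ 2 := pow_le_pow_left₀ (norm_nonneg _) (hC ω) 2
    calc ‖pathSlope F h s ω‖ ^ 2 * (‖pathSlope F h t ω‖ ^ 2 * ‖G ω‖ ^ 2)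
        ≤ ‖pathSlope F h s ω‖ ^ 2 * (‖pathSlope F h t ω‖ ^ 2 * C ^ 2) := by gcongr
      _ = C ^ 2 / 2 * (2 * ‖pathSlope F h s ω‖ ^ 2 * ‖pathSlope F h t ω‖ ^ 2) := by ring
      _ ≤ _ := by
        gcongr
        nlinarith [sq_nonneg (‖pathSlope F h s ω‖ ^ 2 - ‖pathSlope F h t ω‖ ^ 2)]
  have hint : Integrable (fun ω => C ^ 2 / 2 * (‖pathSlope F h s ω‖ ^ 4
      + ‖pathSlope F h t ω‖ ^ 4)) μ := (is.add it).const_mul _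
  have hint2 : Integrable (fun ω => ‖pathSlope F h s ω * (pathSlope F h t ω * G ω)‖ ^ 2) μ := by
    refine hint.mono' (Measurable.aestronglyMeasurable (by fun_prop)) (ae_of_all _ fun ω => ?_)
    rw [Real.norm_of_nonneg (by positivity)]
    exact hle ω
  refine ⟨hint2, (integral_mono hint2 hint hle).trans ?_⟩
  rw [integral_const_mul, integral_add is it]
  have h1 := hF.integral_norm_pathSlope_pow_four_le hh s
  have h2 := hF.integral_norm_pathSlope_pow_four_le hh t
  calc _ ≤ C ^ 2 / 2 * (2 * (∫ x, x ^ 2 ∂ρ) ^ 2 + 2 * (∫ x, x ^ 2 ∂ρ) ^ 2) := by gcongr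
    _ = _ := by ring

lemma integrable_norm_slope_mul_sq (hF : IsSmoothGSP μ F ρ) {h : ℝ} (hh : h ≠ 0) (t : ℝ)
    {G : Ω → ℂ} {C : ℝ} (hG : Measurable G) (hC : ∀ ω, ‖G ω‖ ≤ C) :
    Integrable (fun ω => ‖pathSlope F h t ω * G ω‖ ^ 2) μ ∧
    ∫ ω, ‖pathSlope F h t ω * G ω‖ ^ 2 ∂μ ≤ C ^ 2 * ∫ x, x ^ 2 ∂ρ := by
  have ht := hF.measurable_pathSlope h t
  have it := hF.integrable_norm_pathSlope_pow h t 2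
  have hle : ∀ ω, ‖pathSlope F h t ω * G ω‖ ^ 2 ≤ C ^ 2 * ‖pathSlope F h t ω‖ ^ 2 := by
    intro ω
    rw [norm_mul, mul_pow, mul_comm]
    have h1 : ‖G ω‖ ^ 2 ≤ C ^ 2 := pow_le_pow_left₀ (norm_nonneg _) (hC ω) 2
    gcongr
  have hint := it.const_mul (C ^ 2)
  have hint2 : Integrable (fun ω => ‖pathSlope F h t ω * G ω‖ ^ 2) μ := by
    refine hint.mono' (Measurable.aestronglyMeasurable (by fun_prop)) (ae_of_all _ fun ω => ?_)
    rw [Real.norm_of_nonneg (by positivity)]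
    exact hle ω
  refine ⟨hint2, (integral_mono hint2 hint hle).trans ?_⟩
  rw [integral_const_mul]
  have h2 := hF.integral_norm_pathSlope_sq_le hh t
  gcongr

/-- The covariance structure of `F' g(F)`, for smooth bounded `g`. -/
theorem integral_pathDeriv_mul_pathDeriv (hF : IsSmoothGSP μ F ρ) (s t : ℝ) {g k : ℂ → ℂ} {C : ℝ}
    (hg : Differentiable ℝ g) (hk : Differentiable ℝ k) (hk' : Differentiable ℝ (dbar k))
    (hg0 : ∀ z, ‖g z‖ ≤ C) (hk0 : ∀ z, ‖k z‖ ≤ C) (hg1 : ∀ z, ‖fderiv ℝ g z‖ ≤ C)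
    (hk1 : ∀ z, ‖fderiv ℝ k z‖ ≤ C) (hk2 : ∀ z, ‖fderiv ℝ (dbar k) z‖ ≤ C) :
    ∫ ω, pathDeriv F s ω * (pathDeriv F t ω * (g (F s ω) * k (F t ω))) ∂μ
      = -(‖deriv (spectralKernel ρ) (s - t)‖ : ℂ) ^ 2 *
        ∫ ω, dbar g (F s ω) * dbar k (F t ω) ∂μ := by
  have hC : 0 ≤ C := (norm_nonneg _).trans (hg0 0)
  have hdg : ∀ z, ‖dbar g z‖ ≤ C := norm_dbar_le hg1
  have hdk : ∀ z, ‖dbar k z‖ ≤ C := norm_dbar_le hk1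
  have hs := hF.measurable s
  have ht := hF.measurable t
  have mg := hg.continuous.measurable
  have mk := hk.continuous.measurable
  have mg' := measurable_dbar g
  have mk' := measurable_dbar k
  have hn : ∀ n : ℕ, (1 / ((n : ℝ) + 1)) ≠ 0 := fun n => by positivity
  have bd : ∀ {p q : ℂ → ℂ}, (∀ z, ‖p z‖ ≤ C) → (∀ z, ‖q z‖ ≤ C) → ∀ ω,
      ‖p (F s ω) * q (F t ω)‖ ≤ C * C := fun hp hq ω => by
    rw [norm_mul]
    exact mul_le_mul (hp _) (hq _) (norm_nonneg _) hC
  have lim0 := (tendsto_integral_of_integral_sq_le (μ := μ)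
    (Z := fun (n : ℕ) ω => pathSlope F (1 / (n + 1)) s ω * (pathSlope F (1 / (n + 1)) t ω *
      (g (F s ω) * k (F t ω))))
    (Z₀ := fun ω => pathDeriv F s ω * (pathDeriv F t ω * (g (F s ω) * k (F t ω))))
    (fun n => (hF.measurable_pathSlope _ s).mul ((hF.measurable_pathSlope _ t).mul (by fun_prop)))
    (fun ω => (hF.tendsto_pathSlope s ω).mul ((hF.tendsto_pathSlope t ω).mul_const _))
    (fun n => (hF.integrable_norm_mul_norm_sq (hn n) s t (by fun_prop) (bd hg0 hk0)).1)
    (fun n => (hF.integrable_norm_mul_norm_sq (hn n) s t (by fun_prop) (bd hg0 hk0)).2)).2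
  -- Only the existence of a finite limit matters here, since its prefactor tends to r'(0) = 0.
  have lim1 := (tendsto_integral_of_integral_sq_le (μ := μ)
    (Z := fun (n : ℕ) ω => pathSlope F (1 / (n + 1)) t ω * (dbar g (F s ω) * k (F t ω)))
    (Z₀ := fun ω => pathDeriv F t ω * (dbar g (F s ω) * k (F t ω)))
    (fun n => (hF.measurable_pathSlope _ t).mul (by fun_prop))
    (fun ω => (hF.tendsto_pathSlope t ω).mul_const _)
    (fun n => (hF.integrable_norm_slope_mul_sq (hn n) t (by fun_prop) (bd hdg hk0)).1)
    (fun n => (hF.integrable_norm_slope_mul_sq (hn n) t (by fun_prop) (bd hdg hk0)).2)).2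
  have stein1 : ∀ n : ℕ, ∫ ω, pathSlope F (1 / (n + 1)) s ω * (pathSlope F (1 / (n + 1)) t ω *
      (g (F s ω) * k (F t ω))) ∂μ
      = (∫ ω, pathSlope F (1 / (n + 1)) s ω * conj (F s ω) ∂μ) *
          (∫ ω, pathSlope F (1 / (n + 1)) t ω * (dbar g (F s ω) * k (F t ω)) ∂μ)
        + (∫ ω, pathSlope F (1 / (n + 1)) s ω * conj (F t ω) ∂μ) *
          ((∫ ω, pathSlope F (1 / (n + 1)) t ω * conj (F s ω) ∂μ) *
            (∫ ω, dbar g (F s ω) * dbar k (F t ω) ∂μ)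
          + (∫ ω, pathSlope F (1 / (n + 1)) t ω * conj (F t ω) ∂μ) *
            (∫ ω, g (F s ω) * dbar (dbar k) (F t ω) ∂μ)) := by
    intro n
    -- The first integration by parts keeps the slope at t as the holomorphic factor, which ∂̄ does
    -- not see. The second treats that slope with k already replaced by ∂̄k, hence the regularity
    -- demanded of ∂̄k.
    have h1 := (hF.gaussian_slope_slope (1 / (n + 1)) s t).integral_mul 0 1 hg hk hg0 hk0 hg1 hk1
    have h2 := (hF.gaussian_slope (1 / (n + 1)) s t).integral_mul 1 0 hg hk' hg0 hdk hg1 hk2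
    simp only [Matrix.cons_val_zero, Matrix.cons_val_one, Matrix.cons_val, zero_add, one_mul,
      zero_mul, add_zero] at h1 h2
    rw [h1, h2]
  simp_rw [stein1] at lim0
  have lim2 := ((hF.tendsto_cov_pathSlope s s).mul lim1).add ((hF.tendsto_cov_pathSlope s t).mul
    (((hF.tendsto_cov_pathSlope t s).mul_const (∫ ω, dbar g (F s ω) * dbar k (F t ω) ∂μ)).add
    ((hF.tendsto_cov_pathSlope t t).mul_const (∫ ω, g (F s ω) * dbar (dbar k) (F t ω) ∂μ))))
  -- What survives is r'(s-t) r'(t-s), and Hermitian symmetry r'(-x) = -conj r'(x) turns it into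
  -- -|r'(s-t)|².
  rw [tendsto_nhds_unique lim0 lim2, sub_self, sub_self, hF.deriv_spectralKernel_zero,
    ← neg_sub s t, deriv_spectralKernel_neg hF.integrable_sq]
  have h3 := Complex.mul_conj (deriv (spectralKernel ρ) (s - t))
  rw [Complex.normSq_eq_norm_sq] at h3
  push_cast at h3
  linear_combination (-∫ ω, dbar g (F s ω) * dbar k (F t ω) ∂μ) * h3

/-- A single integration by parts produces the factor r'(0) = 0. Consequently the winding of the
centred process has mean zero. -/
theorem integral_pathDeriv_mul (hF : IsSmoothGSP μ F ρ) (t : ℝ) {g : ℂ → ℂ} {C : ℝ}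
    (hg : Differentiable ℝ g) (hg0 : ∀ z, ‖g z‖ ≤ C) (hg1 : ∀ z, ‖fderiv ℝ g z‖ ≤ C) :
    ∫ ω, pathDeriv F t ω * g (F t ω) ∂μ = 0 := by
  have ht := hF.measurable t
  have mg := hg.continuous.measurable
  have hn : ∀ n : ℕ, (1 / ((n : ℝ) + 1)) ≠ 0 := fun n => by positivity
  have lim0 := (tendsto_integral_of_integral_sq_le (μ := μ)
    (Z := fun (n : ℕ) ω => pathSlope F (1 / (n + 1)) t ω * g (F t ω))
    (Z₀ := fun ω => pathDeriv F t ω * g (F t ω))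
    (fun n => (hF.measurable_pathSlope _ t).mul (by fun_prop))
    (fun ω => (hF.tendsto_pathSlope t ω).mul_const _)
    (fun n => (hF.integrable_norm_slope_mul_sq (hn n) t (by fun_prop) fun ω => hg0 _).1)
    (fun n => (hF.integrable_norm_slope_mul_sq (hn n) t (by fun_prop) fun ω => hg0 _).2)).2
  have hC : 0 ≤ C := (norm_nonneg _).trans (hg0 0)
  have stein : ∀ n : ℕ, ∫ ω, pathSlope F (1 / (n + 1)) t ω * g (F t ω) ∂μ
      = (∫ ω, pathSlope F (1 / (n + 1)) t ω * conj (F t ω) ∂μ) * (∫ ω, dbar g (F t ω) ∂μ) := by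
    intro n
    have h1 := (hF.gaussian_slope (1 / (n + 1)) t t).integral_mul (C := max C 1) 1 0 hg
      (differentiable_const (1 : ℂ)) (fun z => (hg0 z).trans (le_max_left _ _)) (fun z => by simp)
      (fun z => (hg1 z).trans (le_max_left _ _)) (fun z => by simp)
    have h2 : ∀ z, dbar (fun _ : ℂ => (1 : ℂ)) z = 0 := fun z => by simp [dbar]
    simp only [Matrix.cons_val_zero, Matrix.cons_val_one, Matrix.cons_val, one_mul,
      zero_mul, add_zero, mul_one, h2, mul_zero, integral_zero] at h1
    exact h1
  simp_rw [stein] at lim0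
  have lim2 := (hF.tendsto_cov_pathSlope t t).mul_const (∫ ω, dbar g (F t ω) ∂μ)
  rw [tendsto_nhds_unique lim0 lim2, sub_self, hF.deriv_spectralKernel_zero, zero_mul]

end IsSmoothGSP

/-! ### From convergence of Gram matrices to limits in L². -/

section SquareIntegrableLimits

variable {Ω : Type*} [MeasurableSpace Ω] {μ : Measure Ω} [IsProbabilityMeasure μ]

/-- A sequence of random variables whose Gram matrix converges is Cauchy in `L²`, and so its almost
sure limit is a limit in `L²`. -/
theorem memLp_two_of_tendsto_integral_mul {B : ℕ → Ω → ℝ} {B₀ : Ω → ℝ} {L : ℝ}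
    (hB : ∀ n, MemLp (B n) 2 μ) (hlim : ∀ᵐ ω ∂μ, Tendsto (fun n => B n ω) atTop (𝓝 (B₀ ω)))
    (hL : Tendsto (fun p : ℕ × ℕ => ∫ ω, B p.1 ω * B p.2 ω ∂μ) (atTop ×ˢ atTop) (𝓝 L)) :
    MemLp B₀ 2 μ ∧ ∫ ω, B₀ ω ^ 2 ∂μ = L ∧
      Tendsto (fun n => ∫ ω, B n ω ∂μ) atTop (𝓝 (∫ ω, B₀ ω ∂μ)) := by
  set f : ℕ → Lp ℝ 2 μ := fun n => (hB n).toLp (B n) with hf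
  have hinner : ∀ {g h : Ω → ℝ} (hg : MemLp g 2 μ) (hh : MemLp h 2 μ),
      inner ℝ (hg.toLp g) (hh.toLp h) = ∫ ω, g ω * h ω ∂μ := by
    intro g h hg hh
    rw [L2.inner_def]
    refine integral_congr_ae ?_
    filter_upwards [hg.coeFn_toLp, hh.coeFn_toLp] with ω h1 h2
    rw [h1, h2]
    simp [mul_comm]
  have hfst : Tendsto (fun p : ℕ × ℕ => (p.1, p.1)) (atTop ×ˢ atTop) (atTop ×ˢ atTop) :=
    tendsto_fst.prodMk tendsto_fst
  have hsnd : Tendsto (fun p : ℕ × ℕ => (p.2, p.2)) (atTop ×ˢ atTop) (atTop ×ˢ atTop) :=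
    tendsto_snd.prodMk tendsto_snd
  -- Expanding the square, all three inner products have the same limit L, and L - 2L + L = 0. This
  -- is why both indices must tend to infinity independently.
  have hdist : Tendsto (fun p : ℕ × ℕ => ‖f p.1 - f p.2‖ ^ 2) (atTop ×ˢ atTop) (𝓝 0) := by
    have h1 : ∀ p : ℕ × ℕ, ‖f p.1 - f p.2‖ ^ 2 = (∫ ω, B p.1 ω * B p.1 ω ∂μ)
        - 2 * (∫ ω, B p.1 ω * B p.2 ω ∂μ) + ∫ ω, B p.2 ω * B p.2 ω ∂μ := by
      intro p
      rw [norm_sub_sq_real, ← real_inner_self_eq_norm_sq, ← real_inner_self_eq_norm_sq, hf]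
      simp only [hinner]
    simp_rw [h1]
    have h2 := ((hL.comp hfst).sub (hL.const_mul 2)).add (hL.comp hsnd)
    rw [show L - 2 * L + L = 0 by ring] at h2
    exact h2
  have hcauchy : CauchySeq f := by
    rw [cauchySeq_iff_tendsto_dist_atTop_0, ← prod_atTop_atTop_eq]
    have h1 := hdist.sqrt
    rw [Real.sqrt_zero] at h1
    refine h1.congr fun p => ?_
    rw [Real.sqrt_sq (norm_nonneg _), dist_eq_norm]
  obtain ⟨g, hg⟩ := cauchySeq_tendsto_of_complete hcauchy
  have hae : g =ᵐ[μ] B₀ := by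
    have h1 := tendstoInMeasure_of_tendsto_Lp hg
    obtain ⟨ns, hns, h2⟩ := h1.exists_seq_tendsto_ae
    have h3 : ∀ᵐ ω ∂μ, ∀ n, f n ω = B n ω := ae_all_iff.2 fun n => (hB n).coeFn_toLp
    filter_upwards [h2, h3, hlim] with ω h4 h5 h6
    simp only [h5] at h4
    exact tendsto_nhds_unique h4 (h6.comp hns.tendsto_atTop)
  have hmem : MemLp B₀ 2 μ := (memLp_congr_ae hae).1 (Lp.memLp g)
  have hgB : g = hmem.toLp B₀ := by
    apply Lp.ext
    filter_upwards [hae, hmem.coeFn_toLp] with ω h1 h2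
    rw [h1, h2]
  have hone : MemLp (fun _ : Ω => (1 : ℝ)) 2 μ := memLp_const 1
  refine ⟨hmem, ?_, ?_⟩
  · have h1 : Tendsto (fun n => inner ℝ (f n) (f n)) atTop (𝓝 (inner ℝ g g)) := hg.inner hg
    rw [hgB, hinner] at h1
    simp only [hf, hinner] at h1
    have h2 : Tendsto (fun n : ℕ => (n, n)) atTop (atTop ×ˢ atTop) :=
      tendsto_id.prodMk tendsto_id
    have h3 := tendsto_nhds_unique h1 (hL.comp h2)
    simp_rw [pow_two]
    exact h3
  · have h1 : Tendsto (fun n => inner ℝ (f n) (hone.toLp _)) atTop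
        (𝓝 (inner ℝ g (hone.toLp _))) := hg.inner tendsto_const_nhds
    rw [hgB, hinner] at h1
    simp only [hf, hinner] at h1
    simpa using h1

end SquareIntegrableLimits

/-- As a function of u = log x, the smoothed logarithm has slope in [0, 1], so smoothing contracts
differences. The unsmoothed difference thus dominates the real parts. -/
lemma abs_log_add_sub_log_add_le {x y ε : ℝ} (hx : 0 < x) (hy : 0 < y) (hε : 0 ≤ ε) :
    |1 / 2 * Real.log (ε + x ^ 2) - 1 / 2 * Real.log (ε + y ^ 2)|
      ≤ |Real.log x - Real.log y| := by
  wlog hxy : y ≤ x generalizing x y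
  · rw [abs_sub_comm, abs_sub_comm (Real.log x)]
    exact this hy hx (le_of_not_ge hxy)
  have h1 : Real.log y ≤ Real.log x := Real.log_le_log hy hxy
  have h2 : Real.log (ε + y ^ 2) ≤ Real.log (ε + x ^ 2) :=
    Real.log_le_log (by positivity) (by gcongr)
  rw [abs_of_nonneg (by linarith), abs_of_nonneg (by linarith)]
  have h3 : Real.log (ε + x ^ 2) + Real.log (y ^ 2) ≤ Real.log (ε + y ^ 2) + Real.log (x ^ 2) := by
    rw [← Real.log_mul (by positivity) (by positivity),
      ← Real.log_mul (by positivity) (by positivity)]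
    refine Real.log_le_log (by positivity) ?_
    have : y ^ 2 ≤ x ^ 2 := by gcongr
    nlinarith
  rw [Real.log_pow, Real.log_pow] at h3
  push_cast at h3
  linarith

/-- A Young inequality with exponents 4 and 4/3: for a = y^{-1/3} the product is xa³ ≤ max(x, a)⁴.
It separates the fourth moment of F' from a negative moment of F of order below 2, which is finite
in the plane. -/
lemma mul_inv_le_pow_four_add {x y : ℝ} (hx : 0 ≤ x) (hy : 0 ≤ y) :
    x * y⁻¹ ≤ x ^ 4 + (y ^ 2) ^ (-(2 / 3) : ℝ) := by
  rcases hy.eq_or_lt with rfl | hy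
  · simp only [inv_zero, mul_zero]
    positivity
  have h1 : (y ^ 2) ^ (-(2 / 3) : ℝ) = y ^ (-(1 / 3) : ℝ) * y⁻¹ := by
    rw [← Real.rpow_natCast y 2, ← Real.rpow_mul hy.le, ← Real.rpow_neg_one y,
      ← Real.rpow_add hy]
    norm_num
  have h2 : y⁻¹ = (y ^ (-(1 / 3) : ℝ)) ^ 3 := by
    rw [← Real.rpow_natCast (y ^ (-(1 / 3) : ℝ)) 3, ← Real.rpow_mul hy.le, ← Real.rpow_neg_one y]
    norm_num
  have h0 : 0 < y ^ (-(1 / 3) : ℝ) := by positivity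
  rw [h1]
  generalize y ^ (-(1 / 3) : ℝ) = a at *
  rw [h2]
  rcases le_total x a with h | h
  · have h3 : x * a ^ 3 ≤ a * a ^ 3 := by gcongr
    have h4 : 0 ≤ x ^ 4 := by positivity
    linarith
  · have h3 : x * a ^ 3 ≤ x * x ^ 3 := by gcongr
    have h4 : 0 ≤ a * a ^ 3 := by positivity
    nlinarith

/-- The limiting covariance kernel of the logarithmic derivative. -/
noncomputable def windingKernel (ρ : Measure ℝ) (x : ℝ) : ℝ :=
  ‖deriv (spectralKernel ρ) x‖ ^ 2 / (1 - ‖spectralKernel ρ x‖ ^ 2)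

/-- The smoothed logarithmic derivative of `F`. -/
noncomputable def approxLogDeriv {Ω : Type*} (F : ℝ → Ω → ℂ) (n : ℕ) (t : ℝ) (ω : Ω) : ℂ :=
  pathDeriv F t ω * approxInv (1 / (n + 1)) (F t ω)

/-- The integral of the smoothed logarithmic derivative. -/
noncomputable def approxLogIncrement {Ω : Type*} (F : ℝ → Ω → ℂ) (T : ℝ) (n : ℕ) (ω : Ω) : ℂ :=
  ∫ t in Ioc 0 T, approxLogDeriv F n t ω

set_option linter.unusedSectionVars false

/-! ### The smoothed winding, its second moments and its limit. -/

namespace IsSmoothGSP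

variable {Ω : Type*} [MeasurableSpace Ω] {μ : Measure Ω} [IsProbabilityMeasure μ]
  {F : ℝ → Ω → ℂ} {ρ : Measure ℝ} [IsProbabilityMeasure ρ]

/-- The mean of |F'(t)/F(t)| is bounded uniformly in t by a fourth moment of F' and a negative
moment of F. Tonelli then makes the time integral finite almost surely. -/
theorem ae_intervalIntegrable (hF : IsSmoothGSP μ F ρ) {T : ℝ} (hT : 0 ≤ T) :
    ∀ᵐ ω ∂μ, IntervalIntegrable (fun t => pathDeriv F t ω / F t ω) volume 0 T := by
  obtain ⟨K, hK, hneg⟩ := exists_lintegral_rpow_neg_le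
  have hmF := hF.measurable_uncurry
  have hmF' := hF.measurable_uncurry_pathDeriv
  have hm : Measurable fun q : Ω × ℝ => pathDeriv F q.2 q.1 / F q.2 q.1 :=
    (hmF'.comp measurable_swap).div (hmF.comp measurable_swap)
  set K' := ENNReal.ofReal (2 * (∫ x, x ^ 2 ∂ρ) ^ 2) + K with hK'
  have hbound : ∀ t, ∫⁻ ω, ‖pathDeriv F t ω / F t ω‖ₑ ∂μ ≤ K' := by
    intro t
    have ht := hF.measurable t
    have ht' := hF.measurable_pathDeriv t
    calc ∫⁻ ω, ‖pathDeriv F t ω / F t ω‖ₑ ∂μ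
        ≤ ∫⁻ ω, (ENNReal.ofReal (‖pathDeriv F t ω‖ ^ 4)
          + ENNReal.ofReal ((‖F t ω‖ ^ 2) ^ (-(2 / 3) : ℝ))) ∂μ := by
          refine lintegral_mono fun ω => ?_
          rw [← ofReal_norm, ← ENNReal.ofReal_add (by positivity) (by positivity), norm_div,
            div_eq_mul_inv]
          exact ENNReal.ofReal_le_ofReal
            (mul_inv_le_pow_four_add (norm_nonneg _) (norm_nonneg _))
      _ ≤ K' := by
          rw [lintegral_add_left (by fun_prop)]
          exact add_le_add (hF.lintegral_norm_pathDeriv_pow_four_le t)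
            (hneg μ _ _ _ (hF.isGaussianPair t t))
  have htot : ∫⁻ ω, (∫⁻ t in Ioc 0 T, ‖pathDeriv F t ω / F t ω‖ₑ) ∂μ ≠ ⊤ := by
    rw [lintegral_lintegral_swap (Measurable.aemeasurable hm.enorm)]
    refine ne_of_lt ((setLIntegral_mono measurable_const fun t _ => hbound t).trans_lt ?_)
    rw [setLIntegral_const]
    refine ENNReal.mul_lt_top ?_ (by simp)
    rw [hK']
    exact ENNReal.add_lt_top.2 ⟨ENNReal.ofReal_lt_top, hK.lt_top⟩
  have hae := ae_lt_top hm.enorm.lintegral_prod_right' htot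
  filter_upwards [hae] with ω hω
  rw [intervalIntegrable_iff_integrableOn_Ioc_of_le hT]
  exact ⟨(hm.comp measurable_prodMk_left).aestronglyMeasurable, hω⟩

lemma measurable_approxLogDeriv (hF : IsSmoothGSP μ F ρ) (n : ℕ) :
    Measurable fun q : Ω × ℝ => approxLogDeriv F n q.2 q.1 := by
  have hmF := hF.measurable_uncurry.comp (measurable_swap (α := Ω) (β := ℝ))
  have hmF' := hF.measurable_uncurry_pathDeriv.comp (measurable_swap (α := Ω) (β := ℝ))
  exact hmF'.mul ((measurable_approxInv _).comp hmF)

lemma measurable_approxLogIncrement (hF : IsSmoothGSP μ F ρ) (T : ℝ) (n : ℕ) :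
    Measurable (approxLogIncrement F T n) :=
  (StronglyMeasurable.integral_prod_right
    (hF.measurable_approxLogDeriv n).stronglyMeasurable).measurable

theorem ae_tendsto_approxLogIncrement (hF : IsSmoothGSP μ F ρ) {T : ℝ} (hT : 0 ≤ T) :
    ∀ᵐ ω ∂μ, Tendsto (fun n => approxLogIncrement F T n ω) atTop
      (𝓝 (∫ t in Ioc 0 T, pathDeriv F t ω / F t ω)) := by
  filter_upwards [hF.ae_intervalIntegrable hT] with ω hω
  rw [intervalIntegrable_iff_integrableOn_Ioc_of_le hT] at hω
  refine tendsto_integral_of_dominated_convergence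
    (fun t => ‖pathDeriv F t ω / F t ω‖) (fun n => ?_) hω.norm (fun n => ?_) ?_
  · exact ((hF.measurable_approxLogDeriv n).comp measurable_prodMk_left).aestronglyMeasurable
  · refine ae_of_all _ fun t => ?_
    rw [approxLogDeriv, norm_mul, norm_div, div_eq_mul_inv]
    exact mul_le_mul_of_nonneg_left (norm_approxInv_le_inv (by positivity) _) (norm_nonneg _)
  · refine ae_of_all _ fun t => ?_
    rw [div_eq_mul_inv]
    refine Tendsto.const_mul _ ((tendsto_approxInv (F t ω)).comp ?_)
    refine tendsto_nhdsWithin_iff.2 ⟨tendsto_one_div_add_atTop_nhds_zero_nat,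
      Eventually.of_forall fun n => ?_⟩
    exact (by positivity : (0 : ℝ) < 1 / ((n : ℝ) + 1))

lemma continuous_approxLogDeriv (hF : IsSmoothGSP μ F ρ) (n : ℕ) (ω : Ω) :
    Continuous fun t => approxLogDeriv F n t ω :=
  (hF.continuous_pathDeriv ω).mul
    ((differentiable_approxInv (by positivity)).continuous.comp (hF.continuous_path ω))

lemma re_approxLogIncrement (hF : IsSmoothGSP μ F ρ) {T : ℝ} (hT : 0 ≤ T) (n : ℕ) (ω : Ω) :
    (approxLogIncrement F T n ω).re = 1 / 2 * Real.log (1 / ((n : ℝ) + 1) + ‖F T ω‖ ^ 2)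
      - 1 / 2 * Real.log (1 / ((n : ℝ) + 1) + ‖F 0 ω‖ ^ 2) := by
  have hc := hF.continuous_approxLogDeriv n ω
  have hε : (0 : ℝ) < 1 / ((n : ℝ) + 1) := by positivity
  rw [approxLogIncrement, ← intervalIntegral.integral_of_le hT, ← Complex.reCLM_apply,
    ← ContinuousLinearMap.intervalIntegral_comp_comm _ (hc.intervalIntegrable _ _)]
  simp only [Complex.reCLM_apply]
  exact intervalIntegral.integral_eq_sub_of_hasDerivAt
    (fun t _ => hasDerivAt_log_add_norm_sq hε (hF.hasDerivAt t ω))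
    ((Complex.continuous_re.comp hc).intervalIntegrable _ _)

/-- Justifies Fubini at fixed smoothing levels; the bound may blow up with n and m because the limit
is taken only after the expectation has been computed. -/
lemma integrable_approxLogDeriv_mul (hF : IsSmoothGSP μ F ρ) (T : ℝ) (n m : ℕ) :
    Integrable (fun q : Ω × (ℝ × ℝ) => approxLogDeriv F n q.2.1 q.1 * approxLogDeriv F m q.2.2 q.1)
      (μ.prod ((volume.restrict (Ioc 0 T)).prod (volume.restrict (Ioc 0 T)))) := by
  set ν := (volume.restrict (Ioc 0 T)).prod (volume.restrict (Ioc 0 T)) with hν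
  have hmF' := hF.measurable_uncurry_pathDeriv.comp (measurable_swap (α := Ω) (β := ℝ))
  have pow4 : ∀ φ : ℝ × ℝ → ℝ, Measurable φ →
      Integrable (fun q : Ω × (ℝ × ℝ) => ‖pathDeriv F (φ q.2) q.1‖ ^ 4) (μ.prod ν) := by
    intro φ hφ
    have hm : Measurable fun q : Ω × (ℝ × ℝ) => pathDeriv F (φ q.2) q.1 :=
      hmF'.comp (measurable_fst.prodMk (hφ.comp measurable_snd))
    refine ⟨Measurable.aestronglyMeasurable (by fun_prop), ?_⟩
    rw [hasFiniteIntegral_iff_ofReal (ae_of_all _ fun q => by positivity),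
      lintegral_prod_symm _ (Measurable.aemeasurable (by fun_prop))]
    refine (lintegral_mono fun p => hF.lintegral_norm_pathDeriv_pow_four_le (φ p)).trans_lt ?_
    rw [lintegral_const]
    exact ENNReal.mul_lt_top ENNReal.ofReal_lt_top (measure_lt_top _ _)
  set C := (1 + (1 / ((n : ℝ) + 1))⁻¹) * (1 + (1 / ((m : ℝ) + 1))⁻¹) with hC
  refine ((((pow4 _ measurable_fst).add (pow4 _ measurable_snd)).add
    (integrable_const (1 : ℝ))).const_mul C).mono' ?_ (ae_of_all _ fun q => ?_)
  · exact Measurable.aestronglyMeasurable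
      (((hF.measurable_approxLogDeriv n).comp (measurable_fst.prodMk
        (measurable_fst.comp measurable_snd))).mul
      ((hF.measurable_approxLogDeriv m).comp (measurable_fst.prodMk
        (measurable_snd.comp measurable_snd))))
  · simp only [approxLogDeriv, norm_mul, Pi.add_apply]
    have h1 := norm_approxInv_le (ε := 1 / ((n : ℝ) + 1)) (by positivity) (F q.2.1 q.1)
    have h2 := norm_approxInv_le (ε := 1 / ((m : ℝ) + 1)) (by positivity) (F q.2.2 q.1)
    set x := ‖pathDeriv F q.2.1 q.1‖
    set y := ‖pathDeriv F q.2.2 q.1‖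
    have hx : 0 ≤ x := norm_nonneg _
    have hy : 0 ≤ y := norm_nonneg _
    have h3 : x * y ≤ x ^ 4 + y ^ 4 + 1 := by
      nlinarith [sq_nonneg (x - y), sq_nonneg (x ^ 2 - 1), sq_nonneg (y ^ 2 - 1),
        sq_nonneg (x ^ 2), sq_nonneg (y ^ 2)]
    calc x * ‖approxInv (1 / ((n : ℝ) + 1)) (F q.2.1 q.1)‖ *
          (y * ‖approxInv (1 / ((m : ℝ) + 1)) (F q.2.2 q.1)‖)
        ≤ x * (1 + (1 / ((n : ℝ) + 1))⁻¹) * (y * (1 + (1 / ((m : ℝ) + 1))⁻¹)) := by gcongr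
      _ = C * (x * y) := by rw [hC]; ring
      _ ≤ _ := by
        have : 0 ≤ C := by positivity
        gcongr

lemma approxLogIncrement_mul (n m : ℕ) (T : ℝ) (ω : Ω) :
    approxLogIncrement F T n ω * approxLogIncrement F T m ω
      = ∫ p, approxLogDeriv F n p.1 ω * approxLogDeriv F m p.2 ω
        ∂((volume.restrict (Ioc 0 T)).prod (volume.restrict (Ioc 0 T))) := by
  rw [approxLogIncrement, approxLogIncrement,
    integral_prod_mul (fun t => approxLogDeriv F n t ω) fun t => approxLogDeriv F m t ω]

lemma integrable_approxLogIncrement_mul (hF : IsSmoothGSP μ F ρ) (T : ℝ) (n m : ℕ) :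
    Integrable (fun ω => approxLogIncrement F T n ω * approxLogIncrement F T m ω) μ := by
  simp_rw [approxLogIncrement_mul]
  exact (hF.integrable_approxLogDeriv_mul T n m).integral_prod_left

lemma memLp_approxLogIncrement (hF : IsSmoothGSP μ F ρ) (T : ℝ) (n : ℕ) :
    MemLp (approxLogIncrement F T n) 2 μ := by
  rw [memLp_two_iff_integrable_sq_norm (hF.measurable_approxLogIncrement T n).aestronglyMeasurable]
  refine (hF.integrable_approxLogIncrement_mul T n n).norm.congr (ae_of_all _ fun ω => ?_)
  simp only
  rw [norm_mul, pow_two]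

/-- The smoothed version of the kernel, `|r'(s - t)|² 𝔼[δ_n(F s) δ_m(F t)]`. -/
lemma integral_approxLogDeriv_mul (hF : IsSmoothGSP μ F ρ) (n m : ℕ) (s t : ℝ) :
    ∫ ω, approxLogDeriv F n s ω * approxLogDeriv F m t ω ∂μ
      = ((-(‖deriv (spectralKernel ρ) (s - t)‖ ^ 2 * ∫ ω, approxDirac (1 / (n + 1)) (F s ω) *
        approxDirac (1 / (m + 1)) (F t ω) ∂μ) : ℝ) : ℂ) := by
  have hn : (0 : ℝ) < 1 / (n + 1) := by positivity
  have hm : (0 : ℝ) < 1 / (m + 1) := by positivity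
  set εn : ℝ := 1 / (n + 1) with hεn
  set εm : ℝ := 1 / (m + 1) with hεm
  have hdb : dbar (approxInv εm) = fun z => (approxDirac εm z : ℂ) :=
    funext fun z => dbar_approxInv hm z
  set C := (1 + εn⁻¹) + (1 + εm⁻¹) + 3 * εn⁻¹ + 3 * εm⁻¹ + 4 * ((1 + εm⁻¹) * εm⁻¹) with hC
  have p1 : 0 ≤ εn⁻¹ := by positivity
  have p2 : 0 ≤ εm⁻¹ := by positivity
  have p3 : 0 ≤ (1 + εm⁻¹) * εm⁻¹ := by positivity
  have key := hF.integral_pathDeriv_mul_pathDeriv s t (C := C) (differentiable_approxInv hn)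
    (differentiable_approxInv hm) (by rw [hdb]; exact differentiable_approxDirac hm)
    (fun z => (norm_approxInv_le hn z).trans (by linarith))
    (fun z => (norm_approxInv_le hm z).trans (by linarith))
    (fun z => (norm_fderiv_approxInv_le hn z).trans (by linarith))
    (fun z => (norm_fderiv_approxInv_le hm z).trans (by linarith))
    (fun z => by rw [hdb]; exact (norm_fderiv_approxDirac_le hm z).trans (by linarith))
  have e1 : ∀ ω, approxLogDeriv F n s ω * approxLogDeriv F m t ω = pathDeriv F s ω *
      (pathDeriv F t ω * (approxInv εn (F s ω) * approxInv εm (F t ω))) := by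
    intro ω
    rw [approxLogDeriv, approxLogDeriv]
    ring
  simp_rw [e1]
  rw [key]
  simp_rw [dbar_approxInv hn, dbar_approxInv hm, ← Complex.ofReal_mul]
  rw [integral_complex_ofReal]
  push_cast
  ring

lemma integral_approxLogIncrement_mul (hF : IsSmoothGSP μ F ρ) (T : ℝ) (n m : ℕ) :
    ∫ ω, approxLogIncrement F T n ω * approxLogIncrement F T m ω ∂μ
      = ((-∫ p, ‖deriv (spectralKernel ρ) (p.1 - p.2)‖ ^ 2 *
          (∫ ω, approxDirac (1 / (n + 1)) (F p.1 ω) * approxDirac (1 / (m + 1)) (F p.2 ω) ∂μ)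
          ∂((volume.restrict (Ioc 0 T)).prod (volume.restrict (Ioc 0 T))) : ℝ) : ℂ) := by
  simp_rw [approxLogIncrement_mul]
  rw [integral_integral_swap (hF.integrable_approxLogDeriv_mul T n m)]
  simp_rw [hF.integral_approxLogDeriv_mul]
  rw [integral_complex_ofReal, integral_neg]

lemma integral_approxLogIncrement (hF : IsSmoothGSP μ F ρ) (T : ℝ) (n : ℕ) :
    ∫ ω, approxLogIncrement F T n ω ∂μ = 0 := by
  have hn : (0 : ℝ) < 1 / (n + 1) := by positivity
  have hmF' := hF.measurable_uncurry_pathDeriv.comp (measurable_swap (α := Ω) (β := ℝ))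
  have hint : Integrable (fun q : Ω × ℝ => approxLogDeriv F n q.2 q.1)
      (μ.prod (volume.restrict (Ioc 0 T))) := by
    have pow4 : Integrable (fun q : Ω × ℝ => ‖pathDeriv F q.2 q.1‖ ^ 4)
        (μ.prod (volume.restrict (Ioc 0 T))) := by
      have hm : Measurable fun q : Ω × ℝ => pathDeriv F q.2 q.1 := hmF'
      refine ⟨Measurable.aestronglyMeasurable (by fun_prop), ?_⟩
      rw [hasFiniteIntegral_iff_ofReal (ae_of_all _ fun q => by positivity),
        lintegral_prod_symm _ (Measurable.aemeasurable (by fun_prop))]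
      refine (lintegral_mono fun p => hF.lintegral_norm_pathDeriv_pow_four_le p).trans_lt ?_
      rw [lintegral_const]
      exact ENNReal.mul_lt_top ENNReal.ofReal_lt_top (measure_lt_top _ _)
    refine ((pow4.add (integrable_const (1 : ℝ))).const_mul
      (1 + (1 / ((n : ℝ) + 1))⁻¹)).mono'
      (hF.measurable_approxLogDeriv n).aestronglyMeasurable (ae_of_all _ fun q => ?_)
    rw [approxLogDeriv, norm_mul, mul_comm]
    have h2 : ‖pathDeriv F q.2 q.1‖ ≤ ‖pathDeriv F q.2 q.1‖ ^ 4 + 1 := by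
      have := norm_nonneg (pathDeriv F q.2 q.1)
      nlinarith [sq_nonneg (‖pathDeriv F q.2 q.1‖ ^ 2 - 1), sq_nonneg (‖pathDeriv F q.2 q.1‖ - 1),
        sq_nonneg (‖pathDeriv F q.2 q.1‖ ^ 2)]
    exact mul_le_mul (norm_approxInv_le hn _) h2 (norm_nonneg _) (by positivity)
  have h0 : ∀ t, ∫ ω, approxLogDeriv F n t ω ∂μ = 0 := fun t =>
    hF.integral_pathDeriv_mul t (C := (1 + (1 / ((n : ℝ) + 1))⁻¹) + 3 * (1 / ((n : ℝ) + 1))⁻¹)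
      (differentiable_approxInv hn)
      (fun z => (norm_approxInv_le hn z).trans (by
        have : 0 ≤ (1 / ((n : ℝ) + 1))⁻¹ := by positivity
        linarith))
      (fun z => (norm_fderiv_approxInv_le hn z).trans (by
        have : 0 ≤ (1 / ((n : ℝ) + 1))⁻¹ := by positivity
        linarith))
  simp_rw [approxLogIncrement]
  rw [integral_integral_swap hint]
  simp [h0]

lemma tendsto_one_div_add_one_prod :
    Tendsto (fun p : ℕ × ℕ => ((1 / ((p.1 : ℝ) + 1), 1 / ((p.2 : ℝ) + 1)) : ℝ × ℝ))
      (atTop ×ˢ atTop) (𝓝[>] 0 ×ˢ 𝓝[>] 0) := by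
  have h : Tendsto (fun n : ℕ => 1 / ((n : ℝ) + 1)) atTop (𝓝[>] 0) :=
    tendsto_nhdsWithin_iff.2 ⟨tendsto_one_div_add_atTop_nhds_zero_nat,
      Eventually.of_forall fun n => (by positivity : (0 : ℝ) < 1 / ((n : ℝ) + 1))⟩
  exact (h.comp tendsto_fst).prodMk (h.comp tendsto_snd)

/-- With v = 1 - |r|², the expectation is at most 1/v and |r'|² is at most the spectral variance
times v, so the product is bounded by a constant. Where v = 0 the factor r' vanishes, which matches
the value 0 of the kernel under division by zero. -/
lemma tendsto_integral_approxDirac_kernel (hF : IsSmoothGSP μ F ρ) (T : ℝ) :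
    Tendsto (fun p : ℕ × ℕ => ∫ q, ‖deriv (spectralKernel ρ) (q.1 - q.2)‖ ^ 2 *
          (∫ ω, approxDirac (1 / (p.1 + 1)) (F q.1 ω) * approxDirac (1 / (p.2 + 1)) (F q.2 ω) ∂μ)
          ∂((volume.restrict (Ioc 0 T)).prod (volume.restrict (Ioc 0 T))))
      (atTop ×ˢ atTop)
      (𝓝 (∫ q, windingKernel ρ (q.1 - q.2)
        ∂((volume.restrict (Ioc 0 T)).prod (volume.restrict (Ioc 0 T))))) := by
  have hmF := hF.measurable_uncurry
  have hder := (continuous_deriv_spectralKernel hF.integrable_sq).measurable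
  have hM : 0 ≤ ∫ x, x ^ 2 ∂ρ := integral_nonneg fun x => sq_nonneg x
  have hCS := norm_deriv_spectralKernel_sq_le hF.integrable_sq hF.mean
  have hzero : ∀ x, ¬ 0 < 1 - ‖spectralKernel ρ x‖ ^ 2 →
      ‖deriv (spectralKernel ρ) x‖ ^ 2 = 0 := by
    intro x hx
    refine le_antisymm ((hCS x).trans ?_) (sq_nonneg _)
    nlinarith
  refine tendsto_integral_filter_of_dominated_convergence (fun _ => ∫ x, x ^ 2 ∂ρ) ?_ ?_
    (integrable_const _) ?_
  · refine Eventually.of_forall fun p => ?_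
    refine (Measurable.mul (by fun_prop) ?_).aestronglyMeasurable
    refine (StronglyMeasurable.integral_prod_right (f := fun (q : ℝ × ℝ) ω =>
      approxDirac (1 / (p.1 + 1)) (F q.1 ω) * approxDirac (1 / (p.2 + 1)) (F q.2 ω)) ?_).measurable
    refine Measurable.stronglyMeasurable (Measurable.mul ?_ ?_)
    · exact (measurable_approxDirac _).comp (hmF.comp
        ((measurable_fst.comp measurable_fst).prodMk measurable_snd))
    · exact (measurable_approxDirac _).comp (hmF.comp
        ((measurable_snd.comp measurable_fst).prodMk measurable_snd))
  · refine Eventually.of_forall fun p => ae_of_all _ fun q => ?_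
    have h1 : (0 : ℝ) < 1 / ((p.1 : ℝ) + 1) := by positivity
    have h2 : (0 : ℝ) < 1 / ((p.2 : ℝ) + 1) := by positivity
    have hnn : 0 ≤ ∫ ω, approxDirac (1 / (p.1 + 1)) (F q.1 ω) *
        approxDirac (1 / (p.2 + 1)) (F q.2 ω) ∂μ := integral_nonneg fun ω =>
      mul_nonneg (approxDirac_nonneg h1.le _) (approxDirac_nonneg h2.le _)
    rw [Real.norm_of_nonneg (by positivity)]
    by_cases hv : 0 < 1 - ‖spectralKernel ρ (q.1 - q.2)‖ ^ 2
    · have hle := (hF.isGaussianPair q.1 q.2).integral_approxDirac_mul_le hv h1 h2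
      calc _ ≤ ((∫ x, x ^ 2 ∂ρ) * (1 - ‖spectralKernel ρ (q.1 - q.2)‖ ^ 2)) *
            (1 - ‖spectralKernel ρ (q.1 - q.2)‖ ^ 2)⁻¹ :=
            mul_le_mul (hCS _) hle hnn (by positivity)
        _ = _ := by field_simp
    · rw [hzero _ hv, zero_mul]
      exact hM
  · refine ae_of_all _ fun q => ?_
    by_cases hv : 0 < 1 - ‖spectralKernel ρ (q.1 - q.2)‖ ^ 2
    · rw [windingKernel, div_eq_mul_inv]
      exact (((hF.isGaussianPair q.1 q.2).tendsto_integral_approxDirac_mul hv).comp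
        tendsto_one_div_add_one_prod).const_mul _
    · rw [windingKernel, hzero _ hv]
      simp

/-- The variance formula for a smooth process with centred spectral measure. -/
theorem variance_winding (hF : IsSmoothGSP μ F ρ) {T : ℝ} (hT : 0 ≤ T) :
    MemLp (winding F T) 2 μ ∧
    Var[winding F T; μ] = 1 / 2 * (∫ y in (‖spectralKernel ρ T‖ ^ 2)..1, Real.log (1 / (1 - y)) / y)
      + ∫ q, windingKernel ρ (q.1 - q.2)
        ∂((volume.restrict (Ioc 0 T)).prod (volume.restrict (Ioc 0 T))) := by
  set κ := ∫ q, windingKernel ρ (q.1 - q.2)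
        ∂((volume.restrict (Ioc 0 T)).prod (volume.restrict (Ioc 0 T))) with hκ
  set B₀ : Ω → ℝ := fun ω => (∫ t in Ioc 0 T, pathDeriv F t ω / F t ω).im with hB₀
  have hW : winding F T =ᵐ[μ] B₀ := by
    filter_upwards [hF.ae_intervalIntegrable hT] with ω hω
    rw [hB₀]
    simp only
    rw [← intervalIntegral.integral_of_le hT, ← Complex.imCLM_apply,
      ← ContinuousLinearMap.intervalIntegral_comp_comm _ hω]
    rfl
  have hpair := hF.isGaussianPair T 0
  obtain ⟨hAint, hAval⟩ := hpair.integral_log_sq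
  rw [sub_zero, sub_sub_cancel] at hAval
  have hAlim : Tendsto (fun p : ℕ × ℕ => ∫ ω, (approxLogIncrement F T p.1 ω).re *
      (approxLogIncrement F T p.2 ω).re ∂μ) (atTop ×ˢ atTop)
      (𝓝 (∫ ω, (Real.log ‖F T ω‖ - Real.log ‖F 0 ω‖) ^ 2 ∂μ)) := by
    refine tendsto_integral_filter_of_dominated_convergence
      (fun ω => (Real.log ‖F T ω‖ - Real.log ‖F 0 ω‖) ^ 2) ?_ ?_ hAint ?_
    · refine Eventually.of_forall fun p => ?_
      have h1 := hF.measurable_approxLogIncrement T p.1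
      have h2 := hF.measurable_approxLogIncrement T p.2
      exact ((Complex.measurable_re.comp h1).mul
        (Complex.measurable_re.comp h2)).aestronglyMeasurable
    · refine Eventually.of_forall fun p => ?_
      filter_upwards [hpair.ae_ne_zero, hpair.symm.ae_ne_zero] with ω h1 h2
      rw [hF.re_approxLogIncrement hT, hF.re_approxLogIncrement hT, norm_mul,
        ← sq_abs (Real.log ‖F T ω‖ - Real.log ‖F 0 ω‖), pow_two |_|]
      exact mul_le_mul
        (abs_log_add_sub_log_add_le (norm_pos_iff.2 h1) (norm_pos_iff.2 h2) (by positivity))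
        (abs_log_add_sub_log_add_le (norm_pos_iff.2 h1) (norm_pos_iff.2 h2) (by positivity))
        (norm_nonneg _) (abs_nonneg _)
    · filter_upwards [hpair.ae_ne_zero, hpair.symm.ae_ne_zero] with ω h1 h2
      have hlog : ∀ z : ℂ, z ≠ 0 → Tendsto (fun n : ℕ => 1 / 2 * Real.log (1 / ((n : ℝ) + 1)
          + ‖z‖ ^ 2)) atTop (𝓝 (Real.log ‖z‖)) := by
        intro z hz
        have hz' : (0 : ℝ) + ‖z‖ ^ 2 ≠ 0 := by simpa using hz
        have h3 := ((tendsto_one_div_add_atTop_nhds_zero_nat (𝕜 := ℝ)).add_const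
          (‖z‖ ^ 2)).log hz'
        convert h3.const_mul (1 / 2) using 2
        rw [zero_add, Real.log_pow]
        push_cast
        ring
      have h4 : Tendsto (fun n => (approxLogIncrement F T n ω).re) atTop
          (𝓝 (Real.log ‖F T ω‖ - Real.log ‖F 0 ω‖)) := by
        simp_rw [hF.re_approxLogIncrement hT]
        exact (hlog _ h1).sub (hlog _ h2)
      rw [pow_two]
      exact (h4.comp tendsto_fst).mul (h4.comp tendsto_snd)
  have hBmem : ∀ n, MemLp (fun ω => (approxLogIncrement F T n ω).im) 2 μ := fun n =>
    (hF.memLp_approxLogIncrement T n).im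
  have hAmem : ∀ n, MemLp (fun ω => (approxLogIncrement F T n ω).re) 2 μ := fun n =>
    (hF.memLp_approxLogIncrement T n).re
  -- The real part of the unconjugated product is Re·Re - Im·Im. Hence the moments of the imaginary
  -- parts are those of the boundary terms plus the kernel integral.
  have hBval : ∀ p : ℕ × ℕ, ∫ ω, (approxLogIncrement F T p.1 ω).im *
      (approxLogIncrement F T p.2 ω).im ∂μ
      = (∫ ω, (approxLogIncrement F T p.1 ω).re * (approxLogIncrement F T p.2 ω).re ∂μ)
        + ∫ q, ‖deriv (spectralKernel ρ) (q.1 - q.2)‖ ^ 2 *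
          (∫ ω, approxDirac (1 / (p.1 + 1)) (F q.1 ω) * approxDirac (1 / (p.2 + 1)) (F q.2 ω) ∂μ)
          ∂((volume.restrict (Ioc 0 T)).prod (volume.restrict (Ioc 0 T))) := by
    intro p
    have h1 := congrArg Complex.re (hF.integral_approxLogIncrement_mul T p.1 p.2)
    rw [Complex.ofReal_re, ← Complex.reCLM_apply,
      ← Complex.reCLM.integral_comp_comm (hF.integrable_approxLogIncrement_mul T p.1 p.2)] at h1
    simp only [Complex.reCLM_apply, Complex.mul_re] at h1
    have h2 : Integrable (fun ω => (approxLogIncrement F T p.1 ω).re *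
      (approxLogIncrement F T p.2 ω).re) μ := (hAmem p.1).integrable_mul (hAmem p.2)
    have h3 : Integrable (fun ω => (approxLogIncrement F T p.1 ω).im *
      (approxLogIncrement F T p.2 ω).im) μ := (hBmem p.1).integrable_mul (hBmem p.2)
    rw [integral_sub h2 h3] at h1
    linarith
  have hL : Tendsto (fun p : ℕ × ℕ => ∫ ω, (approxLogIncrement F T p.1 ω).im *
      (approxLogIncrement F T p.2 ω).im ∂μ) (atTop ×ˢ atTop)
      (𝓝 ((∫ ω, (Real.log ‖F T ω‖ - Real.log ‖F 0 ω‖) ^ 2 ∂μ) + κ)) := by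
    simp_rw [hBval]
    exact hAlim.add (hF.tendsto_integral_approxDirac_kernel T)
  obtain ⟨hmem, hsq, hmean⟩ := memLp_two_of_tendsto_integral_mul (B₀ := B₀) hBmem (by
    filter_upwards [hF.ae_tendsto_approxLogIncrement hT] with ω hω
    exact (Complex.continuous_im.tendsto _).comp hω) hL
  have hmean0 : ∫ ω, B₀ ω ∂μ = 0 := by
    refine tendsto_nhds_unique hmean (tendsto_const_nhds.congr fun n => ?_)
    have h1 := congrArg Complex.im (hF.integral_approxLogIncrement T n)
    rw [← Complex.imCLM_apply, ← Complex.imCLM.integral_comp_comm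
      ((hF.memLp_approxLogIncrement T n).integrable one_le_two)] at h1
    simpa using h1.symm
  refine ⟨(memLp_congr_ae hW).2 hmem, ?_⟩
  rw [variance_congr hW, variance_of_integral_eq_zero hmem.aestronglyMeasurable.aemeasurable hmean0,
    hsq, hAval]

end IsSmoothGSP

/-! ### Nondegenerate zeros are countable. -/

section IsolatedZeros

/-- A zero with nonzero derivative is isolated, so these zeros form a discrete subspace of the line,
and such a subspace is countable. -/
lemma countable_setOf_eq_zero_deriv_ne_zero {φ : ℝ → ℂ} (hφ : Differentiable ℝ φ) :
    {x | φ x = 0 ∧ deriv φ x ≠ 0}.Countable := by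
  set S := {x | φ x = 0 ∧ deriv φ x ≠ 0} with hS
  have : DiscreteTopology S := by
    rw [discreteTopology_subtype_iff]
    intro x hx
    have h1 := ((hφ x).hasDerivAt.eventually_ne (c := 0) hx.2)
    rw [← disjoint_iff, Filter.disjoint_principal_right]
    filter_upwards [h1] with y hy h2
    exact hy h2.1
  exact (countable_of_Lindelof_of_discrete (X := S)).to_set

end IsolatedZeros

/-! ### Bounds for the winding kernel and its exceptional set. -/

section WindingKernel

variable {ρ : Measure ℝ} [IsProbabilityMeasure ρ]

lemma windingKernel_nonneg (x : ℝ) : 0 ≤ windingKernel ρ x := by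
  have := pow_le_one₀ (n := 2) (norm_nonneg _) (norm_spectralKernel_le (ρ := ρ) x)
  exact div_nonneg (by positivity) (by linarith)

lemma windingKernel_le (hρ : Integrable (fun x : ℝ => x ^ 2) ρ) (hmean : ∫ x, x ∂ρ = 0) (x : ℝ) :
    windingKernel ρ x ≤ ∫ x, x ^ 2 ∂ρ := by
  have h1 := pow_le_one₀ (n := 2) (norm_nonneg _) (norm_spectralKernel_le (ρ := ρ) x)
  exact div_le_of_le_mul₀ (by linarith) (integral_nonneg fun x => by positivity)
    (norm_deriv_spectralKernel_sq_le hρ hmean x)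

lemma continuous_spectralKernel (hρ : Integrable (fun x : ℝ => x ^ 2) ρ) :
    Continuous (spectralKernel ρ) :=
  continuous_iff_continuousAt.2 fun t => (hasDerivAt_spectralKernel hρ t).continuousAt

lemma measurable_windingKernel (hρ : Integrable (fun x : ℝ => x ^ 2) ρ) :
    Measurable (windingKernel ρ) := by
  have h1 := (continuous_spectralKernel hρ).measurable
  have h2 := (continuous_deriv_spectralKernel hρ).measurable
  unfold windingKernel
  fun_prop

/-- If |r(t)| = 1, the Cauchy–Schwarz bound forces r'(t) = 0, and zero variance forces e^{-itx} =
r(t) for ρ-almost every x. Hence r''(t) = -r(t)∫x² dρ ≠ 0, and t is a nondegenerate zero of r'. -/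
lemma countable_norm_spectralKernel_eq_one (hρ : Integrable (fun x : ℝ => x ^ 2) ρ)
    (hmean : ∫ x, x ∂ρ = 0) (hvar : ∫ x, x ^ 2 ∂ρ ≠ 0) :
    {x | ‖spectralKernel ρ x‖ = 1}.Countable := by
  have hdiff : Differentiable ℝ (deriv (spectralKernel ρ)) := fun t =>
    (hasDerivAt_deriv_spectralKernel hρ t).differentiableAt
  refine (countable_setOf_eq_zero_deriv_ne_zero hdiff).mono fun t ht => ?_
  have ht : ‖spectralKernel ρ t‖ = 1 := ht
  constructor
  · have h1 := norm_deriv_spectralKernel_sq_le hρ hmean t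
    rw [ht, one_pow, sub_self, mul_zero] at h1
    exact norm_eq_zero.1 (pow_eq_zero_iff two_ne_zero |>.1 (le_antisymm h1 (by positivity)))
  · obtain ⟨h1, h2⟩ := integral_norm_exp_sub_spectralKernel_sq (ρ := ρ) t
    rw [ht, one_pow, sub_self, integral_eq_zero_iff_of_nonneg (fun x => by positivity) h1] at h2
    rw [(hasDerivAt_deriv_spectralKernel hρ t).deriv]
    have h3 : ∫ x : ℝ, -(x : ℂ) ^ 2 * Complex.exp (-(Complex.I * (t : ℂ) * (x : ℂ))) ∂ρ
        = ∫ x : ℝ, ((-(x ^ 2) : ℝ) : ℂ) * spectralKernel ρ t ∂ρ := by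
      refine integral_congr_ae ?_
      filter_upwards [h2] with x hx
      have h4 : Complex.exp (-(Complex.I * (t : ℂ) * (x : ℂ))) - spectralKernel ρ t = 0 := by
        simpa using hx
      rw [sub_eq_zero.1 h4]
      push_cast
      rfl
    rw [h3, integral_mul_const, integral_complex_ofReal, integral_neg]
    refine mul_ne_zero (by exact_mod_cast neg_ne_zero.2 hvar) fun h => ?_
    rw [h, norm_zero] at ht
    exact zero_ne_one ht

end WindingKernel

/-! ### Translating the spectral measure to mean zero. -/

section Centring

/-- The translate of `ρ` with mean zero. -/
noncomputable def centred (ρ : Measure ℝ) : Measure ℝ := ρ.map fun x => x - ∫ y, y ∂ρ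

lemma spectralKernel_centred (ρ : Measure ℝ) (t : ℝ) : spectralKernel (centred ρ) t
    = Complex.exp (Complex.I * (t : ℂ) * ((∫ y, y ∂ρ : ℝ) : ℂ)) * spectralKernel ρ t := by
  rw [spectralKernel, centred, integral_map (by fun_prop)
    (Continuous.aestronglyMeasurable (by fun_prop)), spectralKernel, ← integral_const_mul]
  refine integral_congr_ae (ae_of_all _ fun x => ?_)
  simp only
  rw [← Complex.exp_add]
  congr 1
  push_cast
  ring

lemma norm_exp_I_mul_mul (t m : ℝ) : ‖Complex.exp (Complex.I * (t : ℂ) * (m : ℂ))‖ = 1 := by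
  simpa using norm_exp_neg_I_mul t (-m)

lemma norm_spectralKernel_centred (ρ : Measure ℝ) (t : ℝ) :
    ‖spectralKernel (centred ρ) t‖ = ‖spectralKernel ρ t‖ := by
  rw [spectralKernel_centred, norm_mul,
    norm_exp_I_mul_mul, one_mul]

variable {ρ : Measure ℝ} [IsProbabilityMeasure ρ]

instance : IsProbabilityMeasure (centred ρ) :=
  Measure.isProbabilityMeasure_map (by fun_prop)

lemma integrable_sq_centred (hρ : Integrable (fun x : ℝ => x ^ 2) ρ) :
    Integrable (fun x : ℝ => x ^ 2) (centred ρ) := by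
  rw [centred, integrable_map_measure (Continuous.aestronglyMeasurable (by fun_prop))
    (by fun_prop)]
  have h1 := (hρ.sub ((integrable_id_of_integrable_sq hρ).const_mul (2 * ∫ y, y ∂ρ))).add
    (integrable_const ((∫ y, y ∂ρ) ^ 2))
  refine h1.congr (ae_of_all _ fun x => ?_)
  simp
  ring

lemma integral_centred (hρ : Integrable (fun x : ℝ => x ^ 2) ρ) : ∫ x, x ∂centred ρ = 0 := by
  rw [centred, integral_map (by fun_prop) (by fun_prop),
    integral_sub (integrable_id_of_integrable_sq hρ) (integrable_const _)]
  simp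

/-- Zero variance would make x almost surely equal to its mean, and ρ a point mass. -/
lemma integral_sq_centred_ne_zero (hρ : Integrable (fun x : ℝ => x ^ 2) ρ)
    (hnondeg : ¬ ∃ a : ℝ, ρ = Measure.dirac a) : ∫ x, x ^ 2 ∂centred ρ ≠ 0 := by
  intro h
  rw [integral_eq_zero_iff_of_nonneg (fun x => by positivity) (integrable_sq_centred hρ)] at h
  have h1 := ae_of_ae_map (by fun_prop) h
  refine hnondeg ⟨∫ y, y ∂ρ, ?_⟩
  have h2 : (fun x : ℝ => x) =ᵐ[ρ] fun _ => ∫ y, y ∂ρ := by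
    filter_upwards [h1] with x hx
    have hx : (x - ∫ y, y ∂ρ) ^ 2 = 0 := hx
    exact sub_eq_zero.1 (pow_eq_zero_iff two_ne_zero |>.1 hx)
  have h3 : ρ.map (fun x => x) = ρ.map fun _ => ∫ y, y ∂ρ := Measure.map_congr h2
  rw [Measure.map_id', Measure.map_const] at h3
  simpa using h3

lemma deriv_spectralKernel_centred (hρ : Integrable (fun x : ℝ => x ^ 2) ρ) (t : ℝ) :
    deriv (spectralKernel (centred ρ)) t
      = Complex.exp (Complex.I * (t : ℂ) * ((∫ y, y ∂ρ : ℝ) : ℂ)) *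
        (deriv (spectralKernel ρ) t - deriv (spectralKernel ρ) 0 * spectralKernel ρ t) := by
  have h1 := ((((Complex.ofRealCLM.hasDerivAt (x := t)).const_mul Complex.I).mul_const
    (((∫ y, y ∂ρ : ℝ) : ℂ))).cexp).mul (hasDerivAt_spectralKernel hρ t).differentiableAt.hasDerivAt
  rw [funext (spectralKernel_centred ρ)]
  refine h1.deriv.trans ?_
  rw [deriv_spectralKernel_zero hρ]
  simp
  ring

lemma windingKernel_centred (hρ : Integrable (fun x : ℝ => x ^ 2) ρ) (t : ℝ) :
    windingKernel (centred ρ) t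
      = ‖deriv (spectralKernel ρ) t - deriv (spectralKernel ρ) 0 * spectralKernel ρ t‖ ^ 2
        / (1 - ‖spectralKernel ρ t‖ ^ 2) := by
  rw [windingKernel, norm_spectralKernel_centred, deriv_spectralKernel_centred hρ, norm_mul,
    norm_exp_I_mul_mul, one_mul]

end Centring

/-! ### Identification of K̃ with the winding kernel of the centred measure. -/

section KernelTilde

variable {ρ : Measure ℝ} [IsProbabilityMeasure ρ]

lemma hasDerivAt_norm_sq_spectralKernel (hρ : Integrable (fun x : ℝ => x ^ 2) ρ) (x : ℝ) :
    HasDerivAt (fun t => ‖spectralKernel ρ t‖ ^ 2)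
      (2 * (conj (spectralKernel ρ x) * deriv (spectralKernel ρ) x).re) x := by
  have h := (hasDerivAt_spectralKernel hρ x).differentiableAt.hasDerivAt.norm_sq
  refine h.congr_deriv ?_
  rw [Complex.inner, mul_comm (deriv _ _)]

/-- Let w = r'/r and recall r'(0) = -im. Then |r' - r'(0)r|² = |r|²((Re w)² + (Im w + m)²). The
imaginary part is the first term of K̃. The real part is the product of logarithmic derivatives,
since (|r|²)' = 2|r|² Re w. -/
theorem kernelTilde_eq_windingKernel_centred (hρ : Integrable (fun x : ℝ => x ^ 2) ρ) {x : ℝ}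
    (h0 : ‖spectralKernel ρ x‖ ≠ 0) (h1 : ‖spectralKernel ρ x‖ ≠ 1) :
    kernelTilde (spectralKernel ρ) x = windingKernel (centred ρ) x := by
  rw [kernelTilde, if_neg (by simp only [h0, h1, or_self, not_false_eq_true]),
    windingKernel_centred hρ]
  have hr0 : spectralKernel ρ x ≠ 0 := fun h => h0 (by rw [h, norm_zero])
  have hu0 : ‖spectralKernel ρ x‖ ^ 2 ≠ 0 := pow_ne_zero 2 h0
  have hlt : ‖spectralKernel ρ x‖ < 1 := lt_of_le_of_ne (norm_spectralKernel_le x) h1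
  have hu1 : 1 - ‖spectralKernel ρ x‖ ^ 2 ≠ 0 := by
    have := pow_lt_one₀ (norm_nonneg _) hlt two_ne_zero
    linarith
  have hd := hasDerivAt_norm_sq_spectralKernel hρ x
  have hlog0 := (hd.log hu0).deriv
  have hlog1 : deriv (fun t => Real.log (1 / (1 - ‖spectralKernel ρ t‖ ^ 2))) x
      = 2 * (conj (spectralKernel ρ x) * deriv (spectralKernel ρ) x).re
        / (1 - ‖spectralKernel ρ x‖ ^ 2) := by
    simp_rw [one_div, Real.log_inv]
    refine ((hd.const_sub 1).log hu1).neg.deriv.trans ?_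
    ring
  rw [hlog0, hlog1, logDerivKernel, logDerivKernel, spectralKernel_zero, div_one,
    deriv_spectralKernel_zero hρ]
  set a := deriv (spectralKernel ρ) x
  set m := ∫ y, y ∂ρ
  set z := spectralKernel ρ x with hz
  have ha : a = a / z * z := by field_simp
  set w := a / z with hw
  rw [ha]
  have e1 : conj z * (w * z) = ((‖z‖ ^ 2 : ℝ) : ℂ) * w := by
    rw [← Complex.normSq_eq_norm_sq, Complex.normSq_eq_conj_mul_self]
    ring
  have e2 : w * z - -(Complex.I * (m : ℂ)) * z = (w + Complex.I * m) * z := by ring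
  have e3 : ‖w + Complex.I * (m : ℂ)‖ ^ 2 = w.re ^ 2 + (w.im + m) ^ 2 := by
    rw [← Complex.normSq_eq_norm_sq, Complex.normSq_apply]
    simp
    ring
  rw [e1, Complex.re_ofReal_mul, e2, norm_mul, mul_pow, e3]
  have e4 : (w - -(Complex.I * (m : ℂ))).im = w.im + m := by simp
  rw [e4]
  field_simp
  ring

theorem kernelTilde_nonneg (hρ : Integrable (fun x : ℝ => x ^ 2) ρ) (x : ℝ) :
    0 ≤ kernelTilde (spectralKernel ρ) x := by
  by_cases h : ‖spectralKernel ρ x‖ = 0 ∨ ‖spectralKernel ρ x‖ = 1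
  · rw [kernelTilde, if_pos h]
    positivity
  · rw [not_or] at h
    rw [kernelTilde_eq_windingKernel_centred hρ h.1 h.2]
    exact windingKernel_nonneg x

/-- At a zero of r the two kernels are |r'|²/2 and |r'|², which differ unless r' = 0 there, so
equality can only hold almost everywhere. The zeros with r' ≠ 0 and the points with |r| = 1 are
countable, hence negligible. -/
theorem kernelTilde_ae_eq (hρ : Integrable (fun x : ℝ => x ^ 2) ρ)
    (hnondeg : ¬ ∃ a : ℝ, ρ = Measure.dirac a) :
    kernelTilde (spectralKernel ρ) =ᵐ[volume] windingKernel (centred ρ) := by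
  have hdiff : Differentiable ℝ (spectralKernel ρ) := fun t =>
    (hasDerivAt_spectralKernel hρ t).differentiableAt
  have h1 := (countable_setOf_eq_zero_deriv_ne_zero hdiff).ae_notMem volume
  have h2 := (countable_norm_spectralKernel_eq_one (integrable_sq_centred hρ)
    (integral_centred hρ) (integral_sq_centred_ne_zero hρ hnondeg)).ae_notMem volume
  filter_upwards [h1, h2] with x hx0 hx1
  simp only [norm_spectralKernel_centred] at hx0 hx1
  by_cases h0 : ‖spectralKernel ρ x‖ = 0
  · have h0' := norm_eq_zero.1 h0
    have h3 : deriv (spectralKernel ρ) x = 0 := by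
      by_contra h
      exact hx0 ⟨h0', h⟩
    rw [kernelTilde, if_pos (Or.inl h0), windingKernel_centred hρ, h3, h0']
    simp
  · exact kernelTilde_eq_windingKernel_centred hρ h0 hx1

end KernelTilde

/-! ### Reducing the double integral to one variable. -/

section DifferenceIntegral

/-- Integrating a function of the difference over a square. -/
theorem integral_sub_prod_restrict_Ioc {K : ℝ → ℝ} (hK : Measurable K) {C : ℝ}
    (hC : ∀ x, |K x| ≤ C) {T : ℝ} (hT : 0 ≤ T) :
    ∫ q, K (q.1 - q.2) ∂((volume.restrict (Ioc 0 T)).prod (volume.restrict (Ioc 0 T)))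
      = ∫ x in (-T)..T, (T - |x|) * K x := by
  have hint : Integrable (fun q : ℝ × ℝ => K (q.1 - q.2))
      ((volume.restrict (Ioc 0 T)).prod (volume.restrict (Ioc 0 T))) :=
    Integrable.of_bound (C := C) (Measurable.aestronglyMeasurable (by fun_prop))
      (ae_of_all _ fun q => hC _)
  have hS : MeasurableSet {q : ℝ × ℝ | -q.1 < q.2 ∧ q.2 ≤ T - q.1} :=
    (measurableSet_lt measurable_fst.neg measurable_snd).inter
      (measurableSet_le measurable_snd (measurable_fst.const_sub T))
  have hint2 : Integrable (Function.uncurry fun t x => (Ioc (-t) (T - t)).indicator K x)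
      ((volume.restrict (Ioc 0 T)).prod (volume.restrict (Ioc (-T) T))) := by
    have h1 : (Function.uncurry fun t x => (Ioc (-t) (T - t)).indicator K x)
        = {q : ℝ × ℝ | -q.1 < q.2 ∧ q.2 ≤ T - q.1}.indicator fun q => K q.2 := by
      ext q
      rfl
    rw [h1]
    refine Integrable.of_bound (C := C)
      ((hK.comp measurable_snd).indicator hS).aestronglyMeasurable (ae_of_all _ fun q => ?_)
    exact (norm_indicator_le_norm_self _ _).trans (hC _)
  rw [integral_prod_symm _ hint]
  -- Shift by t and extend by an indicator to the fixed interval (-T, T]. After swapping, the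
  -- t-section is (0, T] ∩ (-x, T-x], of length T - |x|.
  have h1 : ∀ t ∈ Ioc 0 T, ∫ s in Ioc 0 T, K (s - t)
      = ∫ x in Ioc (-T) T, (Ioc (-t) (T - t)).indicator K x := by
    intro t ht
    have hsub : Ioc (-t) (T - t) ⊆ Ioc (-T) T := Ioc_subset_Ioc (by linarith [ht.2])
      (by linarith [ht.1])
    rw [setIntegral_indicator measurableSet_Ioc, inter_eq_self_of_subset_right hsub,
      ← intervalIntegral.integral_of_le hT, intervalIntegral.integral_comp_sub_right,
      intervalIntegral.integral_of_le (by linarith), zero_sub]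
  rw [setIntegral_congr_fun measurableSet_Ioc h1, integral_integral_swap hint2,
    intervalIntegral.integral_of_le (by linarith)]
  refine setIntegral_congr_fun measurableSet_Ioc fun x hx => ?_
  have h2 : ∀ t, (Ioc (-t) (T - t)).indicator K x = (Ioc (-x) (T - x)).indicator (fun _ => K x) t := by
    intro t
    have : x ∈ Ioc (-t) (T - t) ↔ t ∈ Ioc (-x) (T - x) := by
      simp only [mem_Ioc]
      constructor <;> rintro ⟨h3, h4⟩ <;> constructor <;> linarith
    by_cases h : x ∈ Ioc (-t) (T - t)
    · rw [indicator_of_mem h, indicator_of_mem (this.1 h)]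
    · rw [indicator_of_notMem h, indicator_of_notMem (fun h' => h (this.2 h'))]
  simp only [h2]
  rw [setIntegral_indicator measurableSet_Ioc, Ioc_inter_Ioc, setIntegral_const, smul_eq_mul,
    Real.volume_real_Ioc]
  congr 1
  rcases le_total 0 x with h | h
  · have e1 : max 0 (-x) = 0 := max_eq_left (by linarith)
    have e2 : min T (T - x) = T - x := min_eq_right (by linarith)
    rw [e1, e2, abs_of_nonneg h, sub_zero, max_eq_left (by linarith [hx.2])]
  · have e1 : max 0 (-x) = -x := max_eq_right (by linarith)
    have e2 : min T (T - x) = T := min_eq_left (by linarith)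
    rw [e1, e2, abs_of_nonpos h, max_eq_left (by linarith [hx.1])]

end DifferenceIntegral

/-! ### Rotation and measurable modification of the process. -/

section Modification

variable {Ω : Type*} [MeasurableSpace Ω] {μ : Measure Ω} {f : ℝ → Ω → ℂ}

lemma IsComplexGSP.aemeasurable (hf : IsComplexGSP μ f) (t : ℝ) : AEMeasurable (f t) μ := 
  (hf.gaussian 1 fun _ => t).aemeasurable 0

lemma IsComplexGSP.integral_mul_conj (hf : IsComplexGSP μ f) (s t : ℝ) :
    ∫ ω, f s ω * conj (f t ω) ∂μ = covKernel μ f (s - t) := by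
  have hm : Measurable fun x : Fin 2 → ℂ => x 0 * conj (x 1) := by fun_prop
  have h := ((hf.stationary 2 ![s, t] (-t)).comp hm).integral_eq
  simpa [covKernel, sub_eq_add_neg] using h

lemma IsComplexGaussianVector.mul_congr {n : ℕ} {X Y : Ω → Fin n → ℂ}
    (hX : IsComplexGaussianVector μ X) (c : Fin n → ℂ) (hY : ∀ᵐ ω ∂μ, ∀ i, Y ω i = c i * X ω i) :
    IsComplexGaussianVector μ Y := by
  obtain ⟨m, A, h⟩ := hX
  refine ⟨m, Matrix.diagonal c * A, ?_⟩
  have hm : Measurable fun (x : Fin n → ℂ) i => c i * x i := by fun_prop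
  have h1 := h.comp hm
  have h2 : (fun (x : Fin n → ℂ) i => c i * x i) ∘ (fun v : Fin m → ℂ => A.mulVec v)
      = fun v => (Matrix.diagonal c * A).mulVec v := by
    funext v i
    rw [← Matrix.mulVec_mulVec, Matrix.mulVec_diagonal]
    rfl
  rw [h2] at h1
  refine (IdentDistrib.of_ae_eq h1.aemeasurable_fst ?_).symm.trans h1
  filter_upwards [hY] with ω hω
  funext i
  exact (hω i).symm

variable {ρ : Measure ℝ} [IsProbabilityMeasure ρ]

/-- After rotation at constant speed the process has a smooth measurable modification with centred
spectral measure. -/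
theorem IsComplexGSP.exists_isSmoothGSP (hf : IsComplexGSP μ f)
    (hC1 : ∀ᵐ ω ∂μ, ContDiff ℝ 1 fun t => f t ω) (hcov : covKernel μ f = spectralKernel ρ)
    (hρ : Integrable (fun x : ℝ => x ^ 2) ρ) :
    ∃ F : ℝ → Ω → ℂ, IsSmoothGSP μ F (centred ρ) ∧ ∀ᵐ ω ∂μ, ∀ t,
      F t ω = Complex.exp (Complex.I * (t : ℂ) * ((∫ y, y ∂ρ : ℝ) : ℂ)) * f t ω := by
  set m := ∫ y, y ∂ρ with hm
  set c : ℝ → ℂ := fun t => Complex.exp (Complex.I * (t : ℂ) * (m : ℂ)) with hc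
  -- Each `f t` is only almost everywhere measurable. Off a measurable null set N the paths are
  -- smooth and agree with measurable versions at all rational times. Setting F = 0 on N makes F
  -- measurable at rational times, and path continuity extends this to all times.
  have hgood : ∀ᵐ ω ∂μ, (ContDiff ℝ 1 fun t => f t ω) ∧
      ∀ q : ℚ, f q ω = (hf.aemeasurable q).mk (f q) ω :=
    hC1.and (ae_all_iff.2 fun q => (hf.aemeasurable q).ae_eq_mk)
  obtain ⟨N, hN, hNm, hN0⟩ := exists_measurable_superset_of_null (ae_iff.1 hgood)
  have hgoodN : ∀ ω ∉ N, (ContDiff ℝ 1 fun t => f t ω) ∧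
      ∀ q : ℚ, f q ω = (hf.aemeasurable q).mk (f q) ω := by
    intro ω hω
    by_contra h
    exact hω (hN h)
  have hNae : ∀ᵐ ω ∂μ, ω ∉ N := measure_eq_zero_iff_ae_notMem.1 hN0
  set F : ℝ → Ω → ℂ := fun t => Nᶜ.indicator fun ω => c t * f t ω with hF
  have hFin : ∀ ω ∈ N, ∀ t, F t ω = 0 := fun ω hω t => indicator_of_notMem (by simpa using hω) _
  have hFout : ∀ ω ∉ N, ∀ t, F t ω = c t * f t ω := fun ω hω t =>
    indicator_of_mem (by simpa using hω) _
  have hcC : ContDiff ℝ 1 c :=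
    Complex.contDiff_exp.comp ((contDiff_const.mul Complex.ofRealCLM.contDiff).mul contDiff_const)
  have hsmooth : ∀ ω, ContDiff ℝ 1 fun t => F t ω := by
    intro ω
    by_cases hω : ω ∈ N
    · rw [funext (hFin ω hω)]
      exact contDiff_const
    · rw [funext (hFout ω hω)]
      exact hcC.mul (hgoodN ω hω).1
  have hae : ∀ᵐ ω ∂μ, ∀ t, F t ω = c t * f t ω := hNae.mono hFout
  have hmeas : ∀ t, Measurable (F t) := by
    have hq : ∀ q : ℚ, Measurable (F q) := by
      intro q
      have : F q = Nᶜ.indicator fun ω => c q * (hf.aemeasurable q).mk (f q) ω := by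
        funext ω
        by_cases hω : ω ∈ N
        · rw [hFin ω hω, indicator_of_notMem (by simpa using hω)]
        · rw [hFout ω hω, indicator_of_mem (by simpa using hω), (hgoodN ω hω).2 q]
      rw [this]
      exact ((hf.aemeasurable q).measurable_mk.const_mul _).indicator hNm.compl
    intro t
    obtain ⟨u, hu, hut⟩ := mem_closure_iff_seq_limit.1 (Rat.denseRange_cast (𝕜 := ℝ) t)
    refine measurable_of_tendsto_metrizable (f := fun n => F (u n)) (fun n => ?_)
      (tendsto_pi_nhds.2 fun ω => ((hsmooth ω).continuous.tendsto t).comp hut)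
    obtain ⟨q, hq'⟩ := hu n
    rw [← hq']
    exact hq q
  refine ⟨F, ⟨hmeas, hsmooth, fun n t => ?_, fun s t => ?_, integrable_sq_centred hρ,
    integral_centred hρ⟩, hae⟩
  · exact (hf.gaussian n t).mul_congr (fun i => c (t i)) (hae.mono fun ω h i => h (t i))
  · have h1 : ∫ ω, F s ω * conj (F t ω) ∂μ
        = ∫ ω, (c s * conj (c t)) * (f s ω * conj (f t ω)) ∂μ := by
      refine integral_congr_ae (hae.mono fun ω h => ?_)
      simp only [h s, h t, map_mul]
      ring
    rw [h1, integral_const_mul, hf.integral_mul_conj, hcov, spectralKernel_centred]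
    congr 1
    simp only [hc]
    rw [← Complex.exp_conj, ← Complex.exp_add]
    congr 1
    simp
    ring

lemma IsSmoothGSP.ae_ae_ne_zero [IsProbabilityMeasure μ] {F : ℝ → Ω → ℂ} (hF : IsSmoothGSP μ F ρ)
    {S : Set ℝ} : ∀ᵐ ω ∂μ, ∀ᵐ t ∂volume.restrict S, F t ω ≠ 0 := by
  have h := Measure.ae_ae_comm (μ := volume.restrict S) (ν := μ) (p := fun t ω => F t ω ≠ 0)
    (hF.measurable_uncurry (measurableSet_singleton 0).compl)
  exact h.1 (ae_of_all _ fun t => (hF.isGaussianPair t t).ae_ne_zero)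

/-- Rotation adds the constant im to the logarithmic derivative, so it changes the winding by a
nonrandom amount. -/
lemma div_deriv_eq_of_rotation {g G : ℝ → ℂ} {m : ℝ} (hg : Differentiable ℝ g)
    (hG : ∀ t, G t = Complex.exp (Complex.I * (t : ℂ) * (m : ℂ)) * g t) {t : ℝ} (ht : G t ≠ 0) :
    deriv G t / G t = Complex.I * m + deriv g t / g t := by
  have h1 := ((((Complex.ofRealCLM.hasDerivAt (x := t)).const_mul Complex.I).mul_const
    (m : ℂ)).cexp).mul (hg t).hasDerivAt
  have h2 : deriv G t = Complex.exp (Complex.I * (t : ℂ) * (m : ℂ)) *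
      (Complex.I * m * g t + deriv g t) := by
    rw [funext hG]
    refine h1.deriv.trans ?_
    simp
    ring
  rw [hG t] at ht
  have h3 := (mul_ne_zero_iff.1 ht).2
  rw [h2, hG t, mul_div_mul_left _ _ (Complex.exp_ne_zero _)]
  field_simp

end Modification

/-! ### Undoing the rotation, and the moment condition. -/

section WindingVariance

variable {Ω : Type*} [MeasurableSpace Ω] {μ : Measure Ω} [IsProbabilityMeasure μ]
  {f : ℝ → Ω → ℂ} {ρ : Measure ℝ} [IsProbabilityMeasure ρ]

/-- The winding of a stationary Gaussian process whose spectral measure has a second moment. -/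
theorem IsComplexGSP.variance_winding (hf : IsComplexGSP μ f)
    (hC1 : ∀ᵐ ω ∂μ, ContDiff ℝ 1 fun t => f t ω) (hcov : covKernel μ f = spectralKernel ρ)
    (hρ : Integrable (fun x : ℝ => x ^ 2) ρ) {T : ℝ} (hT : 0 ≤ T) :
    (∀ᵐ ω ∂μ, IntervalIntegrable (fun t => deriv (fun s => f s ω) t / f t ω) volume 0 T) ∧
      MemLp (winding f T) 2 μ ∧
      Var[winding f T; μ] = 1 / 2 * (∫ y in (‖spectralKernel ρ T‖ ^ 2)..1,
          Real.log (1 / (1 - y)) / y)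
        + ∫ x in (-T)..T, (T - |x|) * windingKernel (centred ρ) x := by
  obtain ⟨F, hF, hFf⟩ := hf.exists_isSmoothGSP hC1 hcov hρ
  set m := ∫ y, y ∂ρ with hm
  have hquot : ∀ᵐ ω ∂μ, ∀ᵐ t ∂volume.restrict (Ioc 0 T),
      deriv (fun s => f s ω) t / f t ω = pathDeriv F t ω / F t ω - Complex.I * m := by
    filter_upwards [hC1, hFf, hF.ae_ae_ne_zero (S := Ioc 0 T)] with ω h1 h2 h3
    filter_upwards [h3] with t ht
    rw [pathDeriv, div_deriv_eq_of_rotation (g := fun t => f t ω) (G := fun t => F t ω)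
      (h1.differentiable one_ne_zero) h2 ht, add_sub_cancel_left]
  have hint : ∀ᵐ ω ∂μ,
      IntervalIntegrable (fun t => deriv (fun s => f s ω) t / f t ω) volume 0 T := by
    filter_upwards [hquot, hF.ae_intervalIntegrable hT] with ω h1 h2
    have h3 := h2.sub (intervalIntegrable_const (c := Complex.I * m))
    rw [intervalIntegrable_iff_integrableOn_Ioc_of_le hT] at h3 ⊢
    exact h3.congr (h1.mono fun t ht => ht.symm)
  -- A deterministic shift preserves square integrability and variance, so the formula for the
  -- centred process carries over.
  have hW : winding f T =ᵐ[μ] fun ω => winding F T ω + -(m * T) := by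
    filter_upwards [hquot, hF.ae_intervalIntegrable hT] with ω h1 h2
    have h2' : IntervalIntegrable (fun t => (pathDeriv F t ω / F t ω).im) volume 0 T := by
      rw [intervalIntegrable_iff_integrableOn_Ioc_of_le hT] at h2 ⊢
      exact h2.im
    have h3 : winding f T ω = ∫ t in (0 : ℝ)..T, ((pathDeriv F t ω / F t ω).im - m) := by
      rw [winding, intervalIntegral.integral_of_le hT, intervalIntegral.integral_of_le hT]
      refine integral_congr_ae (h1.mono fun t ht => ?_)
      simp only
      rw [ht]
      simp
    rw [h3, intervalIntegral.integral_sub h2' intervalIntegrable_const,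
      intervalIntegral.integral_const, smul_eq_mul, sub_zero, mul_comm T, ← sub_eq_add_neg]
    rfl
  obtain ⟨hmem, hvar⟩ := hF.variance_winding hT
  refine ⟨hint, (memLp_congr_ae hW).2 (hmem.add (memLp_const _)), ?_⟩
  rw [variance_congr hW, variance_add_const hmem.aestronglyMeasurable, hvar,
    norm_spectralKernel_centred]
  congr 1
  refine integral_sub_prod_restrict_Ioc (measurable_windingKernel hF.integrable_sq)
    (C := ∫ x, x ^ 2 ∂centred ρ) (fun x => ?_) hT
  rw [abs_of_nonneg (windingKernel_nonneg x)]
  exact windingKernel_le hF.integrable_sq hF.mean x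

/-- Where 1 + |x| ≥ e the logarithmic weight is at least 1; elsewhere x² ≤ e². -/
lemma LogMomentCondition.integrable_sq (h : LogMomentCondition ρ) :
    Integrable (fun x : ℝ => x ^ 2) ρ := by
  obtain ⟨α, hα, h⟩ := h
  refine (h.add (integrable_const (Real.exp 1 ^ 2))).mono'
    (Continuous.aestronglyMeasurable (by fun_prop)) (ae_of_all _ fun x => ?_)
  rw [Real.norm_of_nonneg (by positivity)]
  simp only [Pi.add_apply]
  have hlog : 0 ≤ Real.log (1 + |x|) := Real.log_nonneg (by linarith [abs_nonneg x])
  have hpow : 0 ≤ Real.log (1 + |x|) ^ (1 + α) := Real.rpow_nonneg hlog _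
  rcases le_total (Real.exp 1) (1 + |x|) with h1 | h1
  · have h2 : 1 ≤ Real.log (1 + |x|) := (Real.le_log_iff_exp_le (by positivity)).2 h1
    have h3 : 1 ≤ Real.log (1 + |x|) ^ (1 + α) := Real.one_le_rpow h2 (by linarith)
    nlinarith [sq_nonneg x, sq_nonneg (Real.exp 1)]
  · have h2 : x ^ 2 ≤ Real.exp 1 ^ 2 := by
      rw [← sq_abs x]
      exact pow_le_pow_left₀ (abs_nonneg x) (by linarith) 2
    have h3 : 0 ≤ x ^ 2 * Real.log (1 + |x|) ^ (1 + α) := by positivity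
    linarith

end WindingVariance

end WindingGSP

end WindingTheory

/-! ### The variance formula. -/

theorem proposition4p1 {Ω : Type*} [MeasurableSpace Ω] (μ : Measure Ω) [IsProbabilityMeasure μ]
    (f : ℝ → Ω → ℂ) (hf : WindingGSP.IsComplexGSP μ f)
    (hC1 : ∀ᵐ ω ∂μ, ContDiff ℝ 1 fun t => f t ω)
    (hnorm : WindingGSP.covKernel μ f 0 = 1)
    (ρ : Measure ℝ) (hρ : WindingGSP.IsSpectralMeasure ρ (WindingGSP.covKernel μ f))
    (hlog : WindingGSP.LogMomentCondition ρ)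
    (hnondeg : ¬ ∃ φ : ℝ, ρ = Measure.dirac φ) :
    (∀ x : ℝ, 0 ≤ WindingGSP.kernelTilde (WindingGSP.covKernel μ f) x) ∧
    (∀ s : Set ℝ, IsCompact s →
      IntegrableOn (WindingGSP.kernelTilde (WindingGSP.covKernel μ f)) s volume) ∧
    (∀ T : ℝ, 0 < T →
      (∀ᵐ ω ∂μ, IntervalIntegrable (fun t => deriv (fun s => f s ω) t / f t ω) volume 0 T) ∧
      MemLp (WindingGSP.winding f T) 2 μ ∧
      IntervalIntegrable (fun y : ℝ => Real.log (1 / (1 - y)) / y) volume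
        (‖WindingGSP.covKernel μ f T‖ ^ 2) 1 ∧
      Var[WindingGSP.winding f T; μ] / T
        = (∫ x in (-T)..T,
            (1 - |x| / T) * WindingGSP.kernelTilde (WindingGSP.covKernel μ f) x)
          + 1 / (2 * T) *
            ∫ y in (‖WindingGSP.covKernel μ f T‖ ^ 2)..1, Real.log (1 / (1 - y)) / y) := by
  obtain ⟨hprob, hker⟩ := hρ
  have hcov : WindingGSP.covKernel μ f = WindingGSP.spectralKernel ρ := funext hker
  have hsq := hlog.integrable_sq
  have hae := WindingGSP.kernelTilde_ae_eq hsq hnondeg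
  rw [hcov]
  refine ⟨WindingGSP.kernelTilde_nonneg hsq, fun s hs => ?_, fun T hT => ?_⟩
  · have h1 : IntegrableOn (WindingGSP.windingKernel (WindingGSP.centred ρ)) s volume := by
      have hC := WindingGSP.integrable_sq_centred hsq
      refine Measure.integrableOn_of_bounded (M := ∫ x, x ^ 2 ∂WindingGSP.centred ρ)
        hs.measure_lt_top.ne (WindingGSP.measurable_windingKernel hC).aestronglyMeasurable
        (ae_of_all _ fun x => ?_)
      rw [Real.norm_of_nonneg (WindingGSP.windingKernel_nonneg x)]
      exact WindingGSP.windingKernel_le hC (WindingGSP.integral_centred hsq) x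
    exact h1.congr (ae_restrict_of_ae (hae.mono fun x hx => hx.symm))
  · obtain ⟨hint, hmem, hvar⟩ := hf.variance_winding hC1 hcov hsq hT.le
    refine ⟨hint, hmem, WindingGSP.intervalIntegrable_log_div (by positivity)
      (pow_le_one₀ (norm_nonneg _) (WindingGSP.norm_spectralKernel_le T)), ?_⟩
    have h1 : ∫ x in (-T)..T, (1 - |x| / T) * WindingGSP.kernelTilde (WindingGSP.spectralKernel ρ) x
        = T⁻¹ * ∫ x in (-T)..T, (T - |x|) * WindingGSP.windingKernel (WindingGSP.centred ρ) x := by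
      rw [← intervalIntegral.integral_const_mul]
      refine intervalIntegral.integral_congr_ae (hae.mono fun x hx _ => ?_)
      rw [hx]
      field_simp
    rw [hvar, h1]
    field_simp
    ring
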